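/- **Setting.** Let $(M,g)$ be a compact smooth Riemannian manifold with (possibly empty) boundary, with volume measure $*1$. Let $(\cdot,\cdot)^\sharp$ be the Lorentzian inner product of $\mathbb R^{m,1}$, $X^\sharp=(X,\cdot)^\sharp$, $\mathbb H=\{X:(X,X)^\sharp=-1,\ X_{m+1}\ge 1\}$, and let $N=\Gamma\backslash\mathbb H$ be a hyperbolic manifold, where $\Gamma\subset SO^+(m,1)$ acts freely and properly discontinuously on $\mathbb H$. Let $1<p<\infty$ and let $u:M\to N$ be continuous and of class $W^{1,p}$. Let $E$ and $ad(E)$ be the flat bundles over $M$ with fibres $\mathbb R^{m,1}$ and $\mathfrak g=so(m,1)$ obtained by pulling back by $u$ the flat bundles $\mathbb H\times_\Gamma\mathbb R^{m,1}$ and $\mathbb H\times_{\Gamma}\mathfrak g$ (adjoint action) over $N$, and let $d$ be their flat connections; locally, sections are functions with values in $\mathbb R^{m,1}$ or $\mathfrak g$, once a local lift of $u$ to $\mathbb H$ is chosen, and $u$ itself is a section of $E$. For $W\in T^*M\otimes E$ and an orthonormal frame $e_\alpha$ of $TM$ put $Q(W)^2=\sum_\alpha W(e_\alpha)W(e_\alpha)^\sharp$,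 and let $S_{p-1}(du)=Q(du)^{p-2}du$. For $v\in E$ put $v\times u=u\,v^\sharp-v\,u^\sharp\in ad(E)$. Write $\langle A,B\rangle=\int_M (A;B)^\sharp *1$, where on $ad(E)$ one uses $(A,B)^\sharp=\operatorname{Tr}AB$. Sections $\xi$ of $u^{-1}(TN)$ are sections of $E$ with $(\xi,u)^\sharp=0$, and $D\xi=d\xi+(d\xi,u)^\sharp u$ is the pullback of the Levi-Civita connection of $N$. **Theorem.** 1. If $u$ satisfies the $J_p$-Euler–Lagrange equations $\langle Q(du)^{p-2}du, D\xi\rangle=0$ for all sections $\xi$ of $u^{-1}(TN)$ that are continuous and of class $W^{1,p}$, then for every smooth section $\phi$ of $ad(E)$ the function $(S_{p-1}(du)\times u;d\phi)^\sharp$ is integrable on $M$ and $$\langle S_{p-1}(du)\times u,\ d\phi\rangle=0 .$$ 2. If $u$ satisfies the $J_p$-Euler–Lagrange equations in the interior, $D^*(Q(du)^{p-2}du)=0$, that is, the equations above for those $\xi$ that are compactly supported away from $\partial M$, then the Noether current $S_{p-1}(du)\times u$ is co-closed in the sense of distributions, $$d^*\big(S_{p-1}(du)\times u\big)=0,$$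 that is, $(S_{p-1}(du)\times u;d\phi)^\sharp$ is integrable and $\langle S_{p-1}(du)\times u,d\phi\rangle=0$ for every smooth section $\phi$ of $ad(E)$ that is compactly supported away from $\partial M$. -/

import Mathlib

open scoped Manifold ContDiff Matrix
open MeasureTheory

noncomputable section

namespace HypNoether

/-! ### Minkowski space, hyperbolic space and its isometry group -/

/-- Index set of the coordinates of `ℝ^{m,1}`: `m` space coordinates and one time coordinate. -/
abbrev Idx (m : ℕ) : Type := Fin m ⊕ Fin 1

/-- The vector space underlying `ℝ^{m,1}`. -/
abbrev Mink (m : ℕ) : Type := Idx m → ℝ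

/-- The matrix `e^♯ = diag(1, …, 1, -1)`. -/
abbrev eSharp (m : ℕ) : Matrix (Idx m) (Idx m) ℝ :=
  LieAlgebra.Orthogonal.indefiniteDiagonal (Fin m) (Fin 1) ℝ

/-- The row vector `X^♯ = (e^♯ X)ᵀ`. -/
def sharp {m : ℕ} (X : Mink m) : Mink m := eSharp m *ᵥ X

/-- The Lorentzian inner product `(X, Y)^♯` of `ℝ^{m,1}`. -/
def mink {m : ℕ} (X Y : Mink m) : ℝ := sharp X ⬝ᵥ Y

/-- The points of the hyperboloid model: `(X, X)^♯ = -1` and last coordinate at least one. -/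
def hyperboloid (m : ℕ) : Set (Mink m) := {X | mink X X = -1 ∧ 1 ≤ X (Sum.inr 0)}

/-- Hyperbolic space `ℍ^m`, with the subspace topology of `ℝ^{m,1}`. -/
abbrev Hyp (m : ℕ) : Type := hyperboloid m

lemma mink_mulVec {m : ℕ} {A : Matrix (Idx m) (Idx m) ℝ} (hA : Aᵀ * eSharp m * A = eSharp m)
    (X Y : Mink m) : mink (A *ᵥ X) (A *ᵥ Y) = mink X Y := by
  have hs : (eSharp m)ᵀ = eSharp m := by
    simp [LieAlgebra.Orthogonal.indefiniteDiagonal]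
  unfold mink sharp
  rw [Matrix.dotProduct_mulVec, ← Matrix.mulVec_transpose, Matrix.mulVec_mulVec,
    Matrix.mulVec_mulVec, hA]

lemma mink_neg_neg {m : ℕ} (X : Mink m) : mink (-X) (-X) = mink X X := by
  simp [mink, sharp, Matrix.mulVec_neg]

lemma mink_self {m : ℕ} (X : Mink m) :
    mink X X = (∑ i, X (Sum.inl i) ^ 2) - X (Sum.inr 0) ^ 2 := by
  simp [mink, sharp, LieAlgebra.Orthogonal.indefiniteDiagonal, Matrix.mulVec_diagonal,
    dotProduct, sq]
  ring

lemma mem_or_neg_mem {m : ℕ} {X : Mink m} (h : mink X X = -1) :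
    X ∈ hyperboloid m ∨ -X ∈ hyperboloid m := by
  have h1 : (0 : ℝ) ≤ ∑ i, X (Sum.inl i) ^ 2 := Finset.sum_nonneg fun i _ => sq_nonneg _
  have h2 := mink_self X
  rcases le_total 0 (X (Sum.inr 0)) with h0 | h0
  · left
    exact ⟨h, by nlinarith⟩
  · right
    refine ⟨by rw [mink_neg_neg, h], ?_⟩
    simp only [Pi.neg_apply]
    nlinarith

/-- The group `SO⁺(m, 1)`: matrices of determinant one preserving the Lorentzian inner product
and the upper sheet of the hyperboloid. -/
def SOplus (m : ℕ) : Subgroup (Matrix.SpecialLinearGroup (Idx m) ℝ) where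
  carrier := {A | A.1ᵀ * eSharp m * A.1 = eSharp m ∧
    ∀ X ∈ hyperboloid m, A.1 *ᵥ X ∈ hyperboloid m}
  mul_mem' := by
    rintro A B ⟨hA, hA'⟩ ⟨hB, hB'⟩
    refine ⟨?_, fun X hX => ?_⟩
    · rw [Matrix.SpecialLinearGroup.coe_mul, Matrix.transpose_mul]
      calc B.1ᵀ * A.1ᵀ * eSharp m * (A.1 * B.1)
          = B.1ᵀ * (A.1ᵀ * eSharp m * A.1) * B.1 := by simp only [Matrix.mul_assoc]
        _ = eSharp m := by rw [hA, hB]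
    · rw [Matrix.SpecialLinearGroup.coe_mul, ← Matrix.mulVec_mulVec]
      exact hA' _ (hB' _ hX)
  one_mem' := by
    refine ⟨by simp, fun X hX => by simpa using hX⟩
  inv_mem' := by
    rintro A ⟨hA, hA'⟩
    have h1 : A.1 * (A⁻¹).1 = 1 := by
      rw [← Matrix.SpecialLinearGroup.coe_mul, mul_inv_cancel, Matrix.SpecialLinearGroup.coe_one]
    have h2 : (A⁻¹).1ᵀ * eSharp m * (A⁻¹).1 = eSharp m := by
      have h1' : (A⁻¹).1ᵀ * A.1ᵀ = 1 := by
        rw [← Matrix.transpose_mul, h1, Matrix.transpose_one]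
      calc (A⁻¹).1ᵀ * eSharp m * (A⁻¹).1
          = (A⁻¹).1ᵀ * (A.1ᵀ * eSharp m * A.1) * (A⁻¹).1 := by rw [hA]
        _ = ((A⁻¹).1ᵀ * A.1ᵀ) * eSharp m * (A.1 * (A⁻¹).1) := by
            simp only [Matrix.mul_assoc]
        _ = eSharp m := by rw [h1', h1, Matrix.one_mul, Matrix.mul_one]
    refine ⟨h2, fun X hX => ?_⟩
    have h3 : mink ((A⁻¹).1 *ᵥ X) ((A⁻¹).1 *ᵥ X) = -1 := by
      rw [mink_mulVec h2]
      exact hX.1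
    rcases mem_or_neg_mem h3 with h | h
    · exact h
    · exfalso
      have h4 := hA' _ h
      rw [Matrix.mulVec_neg, Matrix.mulVec_mulVec, h1, Matrix.one_mulVec] at h4
      have h5 := h4.2
      have h6 := hX.2
      simp only [Pi.neg_apply] at h5
      linarith

/-- The isometric action of `SO⁺(m, 1)` on hyperbolic space. -/
instance (m : ℕ) : MulAction (SOplus m) (Hyp m) where
  smul A X := ⟨A.1.1 *ᵥ X.1, A.2.2 X.1 X.2⟩
  one_smul X := Subtype.ext (by
    change (1 : Matrix.SpecialLinearGroup (Idx m) ℝ).1 *ᵥ X.1 = X.1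
    simp)
  mul_smul A B X := Subtype.ext (by
    change (A.1 * B.1).1 *ᵥ X.1 = A.1.1 *ᵥ (B.1.1 *ᵥ X.1)
    rw [Matrix.SpecialLinearGroup.coe_mul, Matrix.mulVec_mulVec])

/-- The matrix of an element of a subgroup of `SO⁺(m, 1)`. -/
def toMat {m : ℕ} {Γ : Subgroup (SOplus m)} (γ : Γ) : Matrix (Idx m) (Idx m) ℝ := γ.1.1.1

/-- `Γ` acts freely and properly discontinuously on `ℍ^m`, so that `Γ \ ℍ^m` is a (complete)
hyperbolic manifold with fundamental group `Γ`. -/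
structure IsHyperbolicGroup {m : ℕ} (Γ : Subgroup (SOplus m)) : Prop where
  properlyDiscontinuous : ProperlyDiscontinuousSMul Γ (Hyp m)
  free : ∀ (γ : Γ) (X : Hyp m), γ • X = X → γ = 1

/-- The hyperbolic manifold `N = Γ \ ℍ^m`, with the quotient topology. -/
abbrev HypMfd {m : ℕ} (Γ : Subgroup (SOplus m)) : Type := MulAction.orbitRel.Quotient Γ (Hyp m)

/-- The covering projection `ℍ^m → N`. -/
def proj {m : ℕ} (Γ : Subgroup (SOplus m)) (X : Hyp m) : HypMfd Γ := Quotient.mk _ X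

/-- `X × Y = Y X^♯ - X Y^♯ ∈ so(m, 1)`. -/
def cross {m : ℕ} (X Y : Mink m) : Matrix (Idx m) (Idx m) ℝ :=
  Matrix.vecMulVec Y (sharp X) - Matrix.vecMulVec X (sharp Y)

/-- The projection `Π(X) ξ = ξ + (ξ, X)^♯ X` of `ℝ^{m,1}` onto `T_X ℍ = X^⊥`. -/
def tanProj {m : ℕ} (X ξ : Mink m) : Mink m := ξ + mink ξ X • X

/-- The positive definite inner product `(v, w)^{+, X}` on `ℝ^{m,1}` determined by `X ∈ ℍ`: it
agrees with `(v, w)^♯` on `T_X ℍ` and with `-(v, w)^♯` on `ℝ X`. -/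
def plusInner {m : ℕ} (X v w : Mink m) : ℝ := mink v w + 2 * mink v X * mink w X

/-- Functional calculus for a matrix that is diagonalizable over `ℝ`: the matrix with the same
eigenvectors as `T` on which the eigenvalue `t` is replaced by `f t`. It is the value at `T` of
the polynomial interpolating `f` on the eigenvalues of `T`. -/
def matFun {ι : Type*} [Fintype ι] [DecidableEq ι] (f : ℝ → ℝ) (T : Matrix ι ι ℝ) :
    Matrix ι ι ℝ :=
  Polynomial.aeval T (Lagrange.interpolate T.charpoly.roots.toFinset id f)

section Manifold

variable {n : ℕ} {H : Type*} [TopologicalSpace H]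
  {I : ModelWithCorners ℝ (EuclideanSpace ℝ (Fin n)) H}
  {M : Type*} [TopologicalSpace M] [ChartedSpace H M] [IsManifold I ∞ M]

variable (I M) in
/-- A smooth Riemannian metric on `M`. -/
abbrev Metric : Type _ :=
  Bundle.ContMDiffRiemannianMetric I ∞ (EuclideanSpace ℝ (Fin n)) (fun x : M => TangentSpace I x)

/-! ### The domain: Riemannian volume and fibrewise inner products -/

variable (I) in
/-- The `i`-th vector of the basis of `T_x M` given by the preferred chart at `x`. -/
def basisVec (x : M) (i : Fin n) : TangentSpace I x :=
  (EuclideanSpace.single i (1 : ℝ) : EuclideanSpace ℝ (Fin n))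

variable (I) in
/-- The inverse `ψ⁻¹` of the chart at `x₀`, and its differential at a point `y` of the target. -/
def chartInvD (x₀ : M) (y : EuclideanSpace ℝ (Fin n)) :
    EuclideanSpace ℝ (Fin n) →L[ℝ] TangentSpace I ((extChartAt I x₀).symm y) :=
  mfderivWithin 𝓘(ℝ, EuclideanSpace ℝ (Fin n)) I (extChartAt I x₀).symm (Set.range I) y

/-- The coefficients `g_{ij}` of the metric at the point `ψ⁻¹ y`, in the coordinates `ψ` given by
the chart at `x₀`. -/
def chartGram (g : Metric I M) (x₀ : M) (y : EuclideanSpace ℝ (Fin n)) :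
    Matrix (Fin n) (Fin n) ℝ :=
  Matrix.of fun i j => g.inner ((extChartAt I x₀).symm y)
    (chartInvD I x₀ y (EuclideanSpace.single i 1)) (chartInvD I x₀ y (EuclideanSpace.single j 1))

/-- The Riemannian volume measure of the domain of the chart at `x₀`: the image under `ψ⁻¹` of
`√(det g_{ij}) dy` on the target of `ψ`. -/
def chartVolume [MeasurableSpace M] (g : Metric I M) (x₀ : M) : Measure M :=
  Measure.map (extChartAt I x₀).symm
    ((volume.restrict (extChartAt I x₀).target).withDensity
      fun y => ENNReal.ofReal (Real.sqrt (chartGram g x₀ y).det))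

/-- The Riemannian volume measure `*1` of `M`. The measures of the chart domains agree on overlaps,
and the volume measure is the least measure that dominates all of them. -/
def riemVolume [MeasurableSpace M] (g : Metric I M) : Measure M := ⨆ x₀ : M, chartVolume g x₀

/-- The Gram matrix of the metric at `x` in the basis `basisVec I x`. -/
def gram (g : Metric I M) (x : M) : Matrix (Fin n) (Fin n) ℝ :=
  Matrix.of fun i j => g.inner x (basisVec I x i) (basisVec I x j)

/-- For linear maps `A, B` on `T_x M` with values in a space `F` and a bilinear expression `b` on
`F`, the pairing `∑ g^{ij} b(A_i, B_j)`, that is, `∑_α b(A e_α, B e_α)` for an orthonormal basis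
`e_α` of `T_x M`. -/
def pair (g : Metric I M) (x : M) {F : Type*} [AddCommGroup F] [Module ℝ F] [TopologicalSpace F]
    {K : Type*} [AddCommGroup K] [Module ℝ K] (b : F → F → K)
    (A B : TangentSpace I x →L[ℝ] F) : K :=
  ∑ i, ∑ j, ((gram g x)⁻¹ i j) • b (A (basisVec I x i)) (B (basisVec I x j))

/-- `Q(W)² = (W; W^♯)`, an endomorphism of `ℝ^{m,1}`, for `W ∈ T_x^* M ⊗ ℝ^{m,1}`. If `W` takes
values in `T_X ℍ` this is `W Wᵀ` on `T_X ℍ`, and zero on `X`. -/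
def Qsq {m : ℕ} (g : Metric I M) (x : M) (W : TangentSpace I x →L[ℝ] Mink m) :
    Matrix (Idx m) (Idx m) ℝ :=
  pair g x (fun v w => Matrix.vecMulVec v (sharp w)) W W

/-- `Q(W)^r = (Q(W)²)^{r/2}`. -/
def Qpow {m : ℕ} (g : Metric I M) (x : M) (r : ℝ) (W : TangentSpace I x →L[ℝ] Mink m) :
    Matrix (Idx m) (Idx m) ℝ :=
  matFun (fun t => t ^ (r / 2)) (Qsq g x W)

/-- `S_{p-1}(W) = Q(W)^{p-2} W`. -/
def Scur {m : ℕ} (g : Metric I M) (p : ℝ) (x : M) (W : TangentSpace I x →L[ℝ] Mink m) :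
    TangentSpace I x →L[ℝ] Mink m :=
  (LinearMap.toContinuousLinearMap (Matrix.toLin' (Qpow g x (p - 2) W))).comp W

/-- The linear map `v ↦ v × X` from `ℝ^{m,1}` to matrices. -/
def crossRight {m : ℕ} (X : Mink m) : Mink m →L[ℝ] Matrix (Idx m) (Idx m) ℝ :=
  LinearMap.toContinuousLinearMap
    { toFun := fun v => cross v X
      map_add' := fun v w => by
        ext i j
        simp [cross, sharp, Matrix.vecMulVec_apply, Matrix.mulVec_add]
        ring
      map_smul' := fun c v => by
        ext i j
        simp [cross, sharp, Matrix.vecMulVec_apply, Matrix.mulVec_smul]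
        ring }

/-- The linear map `Π(X)`. -/
def tanProjL {m : ℕ} (X : Mink m) : Mink m →L[ℝ] Mink m :=
  LinearMap.toContinuousLinearMap
    { toFun := tanProj X
      map_add' := fun v w => by
        ext i
        simp [tanProj, mink, sharp, Matrix.mulVec_add]
        ring
      map_smul' := fun c v => by
        ext i
        simp [tanProj, mink, sharp, Matrix.mulVec_smul]
        ring }

/-! ### The flat bundles determined by a map to a hyperbolic manifold

Let `u : M → N = Γ \ ℍ^m`. The `Γ`-covering of `M` determined by `u` is
`M_u = {(x, X) ∈ M × ℍ | u x = proj X}`, with the action of `Γ` on the second entry. The flat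
bundle `E` with fibre `ℝ^{m,1}` is `M_u ×_Γ ℝ^{m,1}`; its sections are the maps
`s : M_u → ℝ^{m,1}` with `s (x, γ X) = γ s (x, X)`. In the same way sections of `ad(E)` are the maps
`φ : M_u → so(m, 1)` with `φ (x, γ X) = γ φ (x, X) γ⁻¹`. Below such maps are written as functions
of `x : M` and `X : ℍ^m`, and only their values at the points of `M_u` matter. The flat connection
`d` differentiates `s` along the local sections of `M_u → M`, that is, along the local lifts of `u`
to `ℍ^m`. The map `u` itself is the section `(x, X) ↦ X` of `E`. -/

variable {m : ℕ} {Γ : Subgroup (SOplus m)}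

/-- `v : M → ℍ^m` is a continuous lift of `u` over the open set `U`. -/
structure IsLocalLift (u : M → HypMfd Γ) (U : Set M) (v : M → Hyp m) : Prop where
  isOpen : IsOpen U
  continuousOn : ContinuousOn v U
  lifts : ∀ x ∈ U, proj Γ (v x) = u x

/-- A point of `ℍ^m` over `u x`. The functions on `M` formed with it below do not depend on its
choice, by equivariance. -/
def base (u : M → HypMfd Γ) (x : M) : Hyp m := Quotient.out (u x)

/-- `s` is a section of `E`. -/
def IsSection (u : M → HypMfd Γ) (s : M → Hyp m → Mink m) : Prop :=
  ∀ (x : M) (X : Hyp m), proj Γ X = u x → ∀ γ : Γ, s x (γ • X) = toMat γ *ᵥ s x X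

/-- `W` is a section of `T^*M ⊗ E`. -/
def IsFormSection (u : M → HypMfd Γ)
    (W : (x : M) → Hyp m → (TangentSpace I x →L[ℝ] Mink m)) : Prop :=
  ∀ (x : M) (X : Hyp m), proj Γ X = u x → ∀ (γ : Γ) (v : TangentSpace I x),
    W x (γ • X) v = toMat γ *ᵥ W x X v

variable (I) in
/-- The smooth sections of `ad(E)`: those whose local expressions are smooth maps to `so(m, 1)`. -/
structure IsSmoothAdSection (u : M → HypMfd Γ)
    (φ : M → Hyp m → Matrix (Idx m) (Idx m) ℝ) : Prop where
  mem_so : ∀ (x : M) (X : Hyp m), proj Γ X = u x →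
    φ x X ∈ LieAlgebra.Orthogonal.so' (Fin m) (Fin 1) ℝ
  equivariant : ∀ (x : M) (X : Hyp m), proj Γ X = u x → ∀ γ : Γ,
    φ x (γ • X) = toMat γ * φ x X * toMat γ⁻¹
  smooth : ∀ (U : Set M) (v : M → Hyp m), IsLocalLift u U v →
    ContMDiffOn I 𝓘(ℝ, Idx m → Idx m → ℝ) ∞ (fun y => Matrix.of.symm (φ y (v y))) U

variable (I) in
open Classical in
/-- The differential `dφ` of a smooth section of `ad(E)` for the flat connection, at `(x, X)`: the
differential at `x` of the expression of `φ` along the local lift of `u` through `(x, X)`. -/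
def flatD (u : M → HypMfd Γ) (φ : M → Hyp m → Matrix (Idx m) (Idx m) ℝ) (x : M) (X : Hyp m) :
    TangentSpace I x →L[ℝ] Matrix (Idx m) (Idx m) ℝ :=
  if h : ∃ v : M → Hyp m, (∃ U : Set M, x ∈ U ∧ IsLocalLift u U v) ∧ v x = X then
    (LinearMap.toContinuousLinearMap (Matrix.ofLinearEquiv ℝ).toLinearMap).comp
      (mfderiv I 𝓘(ℝ, Idx m → Idx m → ℝ) (fun y => Matrix.of.symm (φ y (h.choose y))) x)
  else 0

/-- `η` is the weak differential of `f : M → ℝ^{m,1}` on the open set `U`: in the interior `O` of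
every chart, `f` and the components of `η` are locally integrable, and integration by parts holds
against all test functions. -/
def HasWeakDifferentialOn (U : Set M) (f : M → Mink m)
    (η : (x : M) → (TangentSpace I x →L[ℝ] Mink m)) : Prop :=
  ∀ x₀ : M, ∀ O : Set (EuclideanSpace ℝ (Fin n)),
    O = interior ((extChartAt I x₀).target ∩ (extChartAt I x₀).symm ⁻¹' U) →
    LocallyIntegrableOn (fun y => f ((extChartAt I x₀).symm y)) O ∧
    (∀ w, LocallyIntegrableOn
      (fun y => η ((extChartAt I x₀).symm y) (chartInvD I x₀ y w)) O) ∧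
    ∀ ζ : EuclideanSpace ℝ (Fin n) → ℝ, ContDiff ℝ ∞ ζ → HasCompactSupport ζ →
      tsupport ζ ⊆ O → ∀ w,
      ∫ y, fderiv ℝ ζ y w • f ((extChartAt I x₀).symm y) =
        -∫ y, ζ y • η ((extChartAt I x₀).symm y) (chartInvD I x₀ y w)

/-- `s` is a continuous section of `E` of class `W^{1,p}`, and `η`, a section of `T^*M ⊗ E`, is its
weak differential for the flat connection. The norm of `η` is the one of the metric of `M` and of
the positive definite metric `( , )^{+, u}` of `E`. -/
structure MemSobolev [MeasurableSpace M] (g : Metric I M) (p : ℝ) (u : M → HypMfd Γ)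
    (s : M → Hyp m → Mink m) (η : (x : M) → Hyp m → (TangentSpace I x →L[ℝ] Mink m)) : Prop where
  isSection : IsSection u s
  isFormSection : IsFormSection u η
  continuousOn : ∀ (U : Set M) (v : M → Hyp m), IsLocalLift u U v →
    ContinuousOn (fun y => s y (v y)) U
  weakDifferential : ∀ (U : Set M) (v : M → Hyp m), IsLocalLift u U v →
    HasWeakDifferentialOn U (fun y => s y (v y)) (fun y => η y (v y))
  finiteEnergy : ∫⁻ x, ENNReal.ofReal
    (pair g x (plusInner (base u x).1) (η x (base u x)) (η x (base u x)) ^ (p / 2))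
      ∂(riemVolume g) < ⊤

/-- `u : M → N` is continuous and of class `W^{1,p}`, with weak differential `du`: this is the
condition above for the section `u` of `E`. -/
def IsSobolevMap [MeasurableSpace M] (g : Metric I M) (p : ℝ) (u : M → HypMfd Γ)
    (du : (x : M) → Hyp m → (TangentSpace I x →L[ℝ] Mink m)) : Prop :=
  Continuous u ∧ MemSobolev g p u (fun _ X => X.1) du

/-- The section `s` takes values in the tangent spaces of the target, `s_u = s`; in other words it
is a section of `u^{-1}(TN)`. -/
def IsTangent (u : M → HypMfd Γ) (s : M → Hyp m → Mink m) : Prop :=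
  ∀ (x : M) (X : Hyp m), proj Γ X = u x → tanProj X.1 (s x X) = s x X

variable (I) in
/-- The section `s` (of `E` or of `ad(E)`) vanishes over a neighbourhood of the boundary. On a
compact manifold: it is compactly supported away from the boundary. -/
def VanishesNearBoundary {F : Type*} [Zero F] (u : M → HypMfd Γ) (s : M → Hyp m → F) : Prop :=
  ∃ O : Set M, IsOpen O ∧ I.boundary M ⊆ O ∧
    ∀ x ∈ O, ∀ X : Hyp m, proj Γ X = u x → s x X = 0

/-! ### The Euler–Lagrange equations and the Noether current -/

/-- The integrand `(Q(du)^{p-2} du; D ξ)^♯` of the first variation, where `D ξ = Π(u) dξ` is the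
pullback of the Levi-Civita connection of `N`, for `η = dξ`. -/
def variationDensity (g : Metric I M) (p : ℝ) (u : M → HypMfd Γ)
    (du η : (x : M) → Hyp m → (TangentSpace I x →L[ℝ] Mink m)) (x : M) : ℝ :=
  pair g x mink (Scur g p x (du x (base u x)))
    ((tanProjL (base u x).1).comp (η x (base u x)))

/-- The Euler–Lagrange equations of `J_p(u) = ∫ Tr Q(du)^p`, in weak form with all variations
(no condition on the boundary): `∫ (Q(du)^{p-2} du; D ξ)^♯ = 0` for all sections `ξ` of
`u^{-1}(TN)`. -/
def EulerLagrange [MeasurableSpace M] (g : Metric I M) (p : ℝ) (u : M → HypMfd Γ)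
    (du : (x : M) → Hyp m → (TangentSpace I x →L[ℝ] Mink m)) : Prop :=
  ∀ ξ η, MemSobolev g p u ξ η → IsTangent u ξ →
    ∫ x, variationDensity g p u du η x ∂(riemVolume g) = 0

/-- The Euler–Lagrange equations of `J_p` in the interior, `D^* (Q(du)^{p-2} du) = 0`: as above,
with variations compactly supported away from the boundary. -/
def InteriorEulerLagrange [MeasurableSpace M] (g : Metric I M) (p : ℝ) (u : M → HypMfd Γ)
    (du : (x : M) → Hyp m → (TangentSpace I x →L[ℝ] Mink m)) : Prop :=
  ∀ ξ η, MemSobolev g p u ξ η → IsTangent u ξ → VanishesNearBoundary I u ξ →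
    ∫ x, variationDensity g p u du η x ∂(riemVolume g) = 0

/-- The Noether current `S_{p-1}(du) × u`, a section of `T^*M ⊗ ad(E)`. -/
def noetherCurrent (g : Metric I M) (p : ℝ)
    (du : (x : M) → Hyp m → (TangentSpace I x →L[ℝ] Mink m)) (x : M) (X : Hyp m) :
    TangentSpace I x →L[ℝ] Matrix (Idx m) (Idx m) ℝ :=
  (crossRight X.1).comp (Scur g p x (du x X))

/-- The integrand of `⟨T, dφ⟩ = ∫ (T; dφ)^♯ *1`, for a section `T` of `T^*M ⊗ ad(E)` and a section
`φ` of `ad(E)`, where `(A, B)^♯ = Tr A B` on `so(m, 1)`. -/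
def currentDensity (g : Metric I M) (u : M → HypMfd Γ)
    (T : (x : M) → Hyp m → (TangentSpace I x →L[ℝ] Matrix (Idx m) (Idx m) ℝ))
    (φ : M → Hyp m → Matrix (Idx m) (Idx m) ℝ) (x : M) : ℝ :=
  pair g x (fun A B => (A * B).trace) (T x (base u x)) (flatD I u φ x (base u x))

/-- `⟨T, dφ⟩ = 0` for all smooth sections `φ` of `ad(E)`. -/
def OrthogonalToExact [MeasurableSpace M] (g : Metric I M) (u : M → HypMfd Γ)
    (T : (x : M) → Hyp m → (TangentSpace I x →L[ℝ] Matrix (Idx m) (Idx m) ℝ)) : Prop :=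
  ∀ φ, IsSmoothAdSection I u φ →
    Integrable (currentDensity g u T φ) (riemVolume g) ∧
    ∫ x, currentDensity g u T φ x ∂(riemVolume g) = 0

/-- `d^* T = 0` in the sense of distributions: `⟨T, dφ⟩ = 0` for all smooth sections `φ` of `ad(E)`
with compact support in the interior of `M`. -/
def IsDistribCoclosed [MeasurableSpace M] (g : Metric I M) (u : M → HypMfd Γ)
    (T : (x : M) → Hyp m → (TangentSpace I x →L[ℝ] Matrix (Idx m) (Idx m) ℝ)) : Prop :=
  ∀ φ, IsSmoothAdSection I u φ → VanishesNearBoundary I u φ →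
    Integrable (currentDensity g u T φ) (riemVolume g) ∧
    ∫ x, currentDensity g u T φ x ∂(riemVolume g) = 0

end Manifold

end HypNoether

end

/-!
The theorem is Noether's theorem for the isometry group of hyperbolic space. Let `φ` be a smooth
section of `ad(E)`. Because `φ` has values in `so(m, 1)`, the section `ξ = φ u` of `E` is orthogonal
to `u`, so it is an admissible variation: it is tangent to the target, continuous and of class
`W^{1,p}` with weak differential `(dφ) u + φ du` (`memSobolev_adVariation`,
`isTangent_adVariation`), and it vanishes wherever `φ` does. In the first variation the term `φ du`
drops out: `Q(du)^{p-2} Q(du)²` is symmetric for `( , )^♯` and `φ` is skew, so the trace of their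
product is zero (`sum_mink_matFun_stress`). What remains is
`(S_{p-1}(du); (dφ) u)^♯`, and `Tr ((S × u) B) = 2 (S, B u)^♯` for `B` in `so(m, 1)`
(`trace_cross_mul`). Hence the density `(S_{p-1}(du) × u; dφ)^♯` is twice that of the first
variation in the direction `φ u` (`currentDensity_ae_eq`), and both parts of the theorem follow.

Three points need work. The first is that `du` is tangent to hyperbolic space almost everywhere
(`ae_mink_eq_zero`): by the chain rule for squares, `2 (du, u)^♯` is the weak differential of the
constant `(u, u)^♯ = -1`. This is used for the projection `Π(u)` in the first variation, and because
`Q(du)²` is then diagonalizable with nonnegative eigenvalues, with an eigenbasis that is orthonormal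
for `( , )^{+, u}` (`exists_eigenbasis_stress`).

The second is integrability of the density (`integrable_currentDensity`). The eigenbasis gives
`|S_{p-1}(du)|² ≤ (m + 1) |du|^{2(p-1)}` (`sum_plusInner_matFun_stress_le`), so the density is
bounded by a constant times `1 + |du|^p`, and a compact manifold has finite volume. It is measurable
since powers of `Q(du)²` are pointwise limits of polynomials in `Q(du)²`
(`aemeasurable_Qpow`).

The third is the passage between `M` and Euclidean space. Locally `u` lifts to `ℍ^m`, because the
projection to `Γ \ ℍ^m` is a local homeomorphism (`exists_localLift`), and the densities do not
depend on the lift. In a chart the Riemannian volume is absolutely continuous with respect to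
Lebesgue measure (`map_riemVolume_absolutelyContinuous`): the volumes of two charts agree on the overlap by
the change of variables formula, and the range of the model with corners is convex, so that its
boundary is a null set.
-/

noncomputable section

namespace HypNoether

/-! ### Linear algebra of Minkowski space -/

section Minkowski

variable {m : ℕ}

lemma eSharp_transpose (m : ℕ) : (eSharp m)ᵀ = eSharp m := by
  simp [LieAlgebra.Orthogonal.indefiniteDiagonal]

lemma eSharp_mul_self (m : ℕ) : eSharp m * eSharp m = 1 := by
  unfold eSharp LieAlgebra.Orthogonal.indefiniteDiagonal
  rw [Matrix.diagonal_mul_diagonal, ← Matrix.diagonal_one]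
  congr 1
  ext i
  cases i <;> simp

lemma mink_comm (X Y : Mink m) : mink X Y = mink Y X := by
  unfold mink sharp
  rw [dotProduct_comm, Matrix.dotProduct_mulVec, ← Matrix.mulVec_transpose, eSharp_transpose]

/-- The inner product `( , )^♯` as a bilinear map. -/
def minkB (m : ℕ) : Mink m →ₗ[ℝ] Mink m →ₗ[ℝ] ℝ :=
  LinearMap.mk₂ ℝ mink
    (fun x y z => by simp [mink, sharp, Matrix.mulVec_add])
    (fun c x y => by simp [mink, sharp, Matrix.mulVec_smul])
    (fun x y z => by simp [mink, sharp])
    (fun c x y => by simp [mink, sharp])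

lemma minkB_apply (X Y : Mink m) : minkB m X Y = mink X Y := rfl

lemma mink_add_left (X Y Z : Mink m) : mink (X + Y) Z = mink X Z + mink Y Z :=
  LinearMap.map_add₂ (minkB m) X Y Z

lemma mink_add_right (X Y Z : Mink m) : mink X (Y + Z) = mink X Y + mink X Z :=
  (minkB m X).map_add Y Z

lemma mink_smul_left (c : ℝ) (X Y : Mink m) : mink (c • X) Y = c * mink X Y :=
  LinearMap.map_smul₂ (minkB m) c X Y

lemma mink_smul_right (c : ℝ) (X Y : Mink m) : mink X (c • Y) = c * mink X Y :=
  (minkB m X).map_smul c Y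

lemma mink_zero_left (X : Mink m) : mink 0 X = 0 := LinearMap.map_zero₂ (minkB m) X

/-- The inner product `( , )^{+, X}` as a bilinear map. -/
def plusB (X : Mink m) : Mink m →ₗ[ℝ] Mink m →ₗ[ℝ] ℝ :=
  LinearMap.mk₂ ℝ (plusInner X)
    (fun x y z => by simp only [plusInner, mink_add_left]; ring)
    (fun c x y => by simp only [plusInner, mink_smul_left, smul_eq_mul]; ring)
    (fun x y z => by simp only [plusInner, mink_add_left, mink_add_right]; ring)
    (fun c x y => by simp only [plusInner, mink_smul_left, mink_smul_right, smul_eq_mul]; ring)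

lemma plusB_apply (X v w : Mink m) : plusB X v w = plusInner X v w := rfl

/-- The Gram matrix of `( , )^{+, X}` in the standard basis. -/
def plusGram (X : Mink m) : Matrix (Idx m) (Idx m) ℝ :=
  eSharp m + (2 : ℝ) • Matrix.vecMulVec (sharp X) (sharp X)

lemma plusGram_mulVec (X v : Mink m) :
    plusGram X *ᵥ v = sharp v + (2 * mink X v) • sharp X := by
  rw [plusGram, Matrix.add_mulVec, Matrix.smul_mulVec, Matrix.vecMulVec_mulVec]
  ext i
  simp [sharp, mink, mul_assoc]

lemma plusGram_mulVec_of_tangent {X v : Mink m} (h : mink v X = 0) :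
    plusGram X *ᵥ v = sharp v := by
  rw [plusGram_mulVec, mink_comm, h]; simp

lemma plusInner_eq_dotProduct (X v w : Mink m) :
    plusInner X v w = v ⬝ᵥ (plusGram X *ᵥ w) := by
  rw [plusGram_mulVec, dotProduct_add, dotProduct_smul, plusInner, mink_comm v w, mink,
    mink_comm v X, mink_comm w X]
  have h1 : v ⬝ᵥ sharp X = mink X v := by rw [dotProduct_comm]; rfl
  rw [h1, dotProduct_comm, smul_eq_mul]; ring

lemma plusInner_eq_mink {X v : Mink m} (h : mink v X = 0) (w : Mink m) :
    plusInner X v w = mink v w := by simp [plusInner, h]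

lemma plusInner_comm (X v w : Mink m) : plusInner X v w = plusInner X w v := by
  simp only [plusInner, mink_comm v w]; ring

lemma plusGram_transpose (X : Mink m) : (plusGram X)ᵀ = plusGram X := by
  rw [plusGram, Matrix.transpose_add, eSharp_transpose, Matrix.transpose_smul,
    Matrix.transpose_vecMulVec]

lemma mink_eq (X Y : Mink m) :
    mink X Y = (∑ i, X (Sum.inl i) * Y (Sum.inl i)) - X (Sum.inr 0) * Y (Sum.inr 0) := by
  simp [mink, sharp, LieAlgebra.Orthogonal.indefiniteDiagonal, Matrix.mulVec_diagonal,
    dotProduct]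
  ring

/-- The Lorentzian inner product is positive definite on `T_X ℍ`, by the Cauchy–Schwarz inequality
for the space coordinates. -/
lemma mink_self_pos_of_tangent {X w : Mink m} (hX : X ∈ hyperboloid m) (h : mink w X = 0)
    (hw : w ≠ 0) : 0 < mink w w := by
  obtain ⟨h1, h2⟩ := hX
  rw [mink_self] at h1 ⊢
  rw [mink_eq] at h
  have cs := Finset.sum_mul_sq_le_sq_mul_sq Finset.univ (fun i => w (Sum.inl i))
    (fun i => X (Sum.inl i))
  set A := ∑ i, w (Sum.inl i) ^ 2 with hA
  set s := X (Sum.inr 0)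
  set t := w (Sum.inr 0)
  have hB : ∑ i, X (Sum.inl i) ^ 2 = s ^ 2 - 1 := by linarith
  have hst : ∑ i, w (Sum.inl i) * X (Sum.inl i) = t * s := by linarith
  rw [hst, hB] at cs
  have hA0 : 0 < A := by
    refine (Finset.sum_nonneg fun i _ => sq_nonneg _).lt_of_ne' fun h0 => hw ?_
    have h0' := (Finset.sum_eq_zero_iff_of_nonneg (fun i _ => sq_nonneg _)).1 h0
    have hz : ∀ i, w (Sum.inl i) = 0 := fun i => by simpa using h0' i (Finset.mem_univ i)
    have ht : t = 0 := by
      have : t * s = 0 := by rw [← hst]; simp [hz]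
      rcases mul_eq_zero.1 this with h | h
      · exact h
      · linarith
    ext i
    rcases i with i | i
    · exact hz i
    · rw [Subsingleton.elim i 0]; exact ht
  have hs : 0 < s ^ 2 := by positivity
  by_contra hcon
  nlinarith

lemma plusInner_self_pos {X v : Mink m} (hX : X ∈ hyperboloid m) (hv : v ≠ 0) :
    0 < plusInner X v v := by
  -- split `v` into its component in `T_X ℍ` and a multiple of `X`
  set c := mink v X
  have hw : mink (v + c • X) X = 0 := by
    rw [mink_add_left, mink_smul_left, hX.1]; ring
  have hexp : plusInner X v v = mink (v + c • X) (v + c • X) + c ^ 2 := by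
    rw [mink_add_right, mink_smul_right, hw, mink_add_left, mink_smul_left, mink_comm X v]
    simp only [plusInner]; ring
  rw [hexp]
  by_cases h0 : v + c • X = 0
  · have hc : c ≠ 0 := by
      rintro h; rw [h] at h0; simp at h0; exact hv h0
    rw [h0, mink_zero_left]; positivity
  · have := mink_self_pos_of_tangent hX hw h0
    positivity

lemma plusInner_self_nonneg {X : Mink m} (hX : X ∈ hyperboloid m) (v : Mink m) :
    0 ≤ plusInner X v v := by
  by_cases hv : v = 0
  · subst hv; simp [plusInner, mink_zero_left]
  · exact (plusInner_self_pos hX hv).le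

lemma plusGram_posDef {X : Mink m} (hX : X ∈ hyperboloid m) : (plusGram X).PosDef := by
  refine Matrix.PosDef.of_dotProduct_mulVec_pos ?_ fun v hv => ?_
  · rw [Matrix.IsHermitian, Matrix.conjTranspose_eq_transpose_of_trivial, plusGram_transpose]
  · have := plusInner_self_pos hX hv
    rwa [plusInner_eq_dotProduct] at this

end Minkowski

/-! ### Functional calculus for diagonalizable matrices -/

section MatFun

variable {ι : Type*} [Fintype ι] [DecidableEq ι]

lemma exists_isUnit_transpose_mul_self {P : Matrix ι ι ℝ} (hP : P.PosDef) :
    ∃ B : Matrix ι ι ℝ, IsUnit B ∧ P = Bᵀ * B := by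
  obtain ⟨B, hB⟩ : ∃ B : Matrix ι ι ℝ, P = Bᵀ * B := by
    open scoped MatrixOrder in
    obtain ⟨B, hB⟩ := (CStarAlgebra.nonneg_iff_eq_star_mul_self (a := P)).1
      (Matrix.nonneg_iff_posSemidef.2 hP.posSemidef)
    exact ⟨B, by rw [hB, Matrix.star_eq_conjTranspose,
      Matrix.conjTranspose_eq_transpose_of_trivial]⟩
  refine ⟨B, ?_, hB⟩
  have h := hP.isUnit
  rw [Matrix.isUnit_iff_isUnit_det] at h ⊢
  rw [hB, Matrix.det_mul] at h
  exact isUnit_of_mul_isUnit_right h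

/-- Simultaneous diagonalization: a matrix that is self-adjoint for a positive definite inner
product has an eigenbasis that is orthonormal for it. -/
lemma exists_orthonormal_eigenbasis {P T : Matrix ι ι ℝ} (hP : P.PosDef) (hT : (P * T)ᵀ = P * T) :
    ∃ (V : Matrix ι ι ℝ) (d : ι → ℝ), Vᵀ * P * V = 1 ∧ T * V = V * Matrix.diagonal d := by
  obtain ⟨B, hB, rfl⟩ := exists_isUnit_transpose_mul_self hP
  have hBd : IsUnit B.det := (Matrix.isUnit_iff_isUnit_det B).1 hB
  have hBBi : B * B⁻¹ = 1 := Matrix.mul_nonsing_inv _ hBd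
  have hBiB : B⁻¹ * B = 1 := Matrix.nonsing_inv_mul _ hBd
  have hBt : (B⁻¹)ᵀ * Bᵀ = 1 := by rw [← Matrix.transpose_mul, hBBi, Matrix.transpose_one]
  have hS : (B * T * B⁻¹).IsHermitian := by
    rw [Matrix.IsHermitian, Matrix.conjTranspose_eq_transpose_of_trivial]
    have h1 : Tᵀ * (Bᵀ * B) = Bᵀ * B * T := by
      rw [← hT, Matrix.transpose_mul, Matrix.transpose_mul, Matrix.transpose_transpose]
    calc (B * T * B⁻¹)ᵀ = (B⁻¹)ᵀ * (Tᵀ * Bᵀ) := by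
          rw [Matrix.transpose_mul, Matrix.transpose_mul]
      _ = (B⁻¹)ᵀ * (Tᵀ * (Bᵀ * B)) * B⁻¹ := by
          simp only [Matrix.mul_assoc]; rw [hBBi, Matrix.mul_one]
      _ = ((B⁻¹)ᵀ * Bᵀ) * (B * T * B⁻¹) := by rw [h1]; simp only [Matrix.mul_assoc]
      _ = B * T * B⁻¹ := by rw [hBt, Matrix.one_mul]
  obtain ⟨U, d, hU1, hspec⟩ : ∃ (U : Matrix ι ι ℝ) (d : ι → ℝ), Uᵀ * U = 1 ∧
      B * T * B⁻¹ = U * Matrix.diagonal d * Uᵀ := by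
    refine ⟨hS.eigenvectorUnitary, hS.eigenvalues, ?_, ?_⟩
    · have := Unitary.coe_star_mul_self hS.eigenvectorUnitary
      rwa [Matrix.star_eq_conjTranspose, Matrix.conjTranspose_eq_transpose_of_trivial] at this
    · have := hS.spectral_theorem
      rwa [Unitary.conjStarAlgAut_apply, Matrix.star_eq_conjTranspose,
        Matrix.conjTranspose_eq_transpose_of_trivial] at this
  refine ⟨B⁻¹ * U, d, ?_, ?_⟩
  · calc (B⁻¹ * U)ᵀ * (Bᵀ * B) * (B⁻¹ * U)
        = Uᵀ * (((B⁻¹)ᵀ * Bᵀ) * (B * B⁻¹)) * U := by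
          rw [Matrix.transpose_mul]; simp only [Matrix.mul_assoc]
      _ = 1 := by rw [hBt, hBBi, Matrix.mul_one, Matrix.mul_one, hU1]
  · calc T * (B⁻¹ * U) = B⁻¹ * (B * T * B⁻¹) * U := by
          simp only [← Matrix.mul_assoc]; rw [hBiB, Matrix.one_mul]
      _ = B⁻¹ * (U * Matrix.diagonal d * (Uᵀ * U)) := by
          rw [hspec]; simp only [Matrix.mul_assoc]
      _ = B⁻¹ * U * Matrix.diagonal d := by
          rw [hU1, Matrix.mul_one, Matrix.mul_assoc]

lemma aeval_mul_eq_mul_diagonal {T V : Matrix ι ι ℝ} {d : ι → ℝ}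
    (h : T * V = V * Matrix.diagonal d) (q : Polynomial ℝ) :
    Polynomial.aeval T q * V = V * Matrix.diagonal fun i => q.eval (d i) := by
  induction q using Polynomial.induction_on' with
  | add p q hp hq =>
    rw [map_add, Matrix.add_mul, hp, hq, ← Matrix.mul_add, Matrix.diagonal_add]
    simp
  | monomial k a =>
    have hk : T ^ k * V = V * Matrix.diagonal fun i => d i ^ k := by
      induction k with
      | zero => simp
      | succ k ih =>
        rw [pow_succ, Matrix.mul_assoc, h, ← Matrix.mul_assoc, ih, Matrix.mul_assoc,
          Matrix.diagonal_mul_diagonal]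
        simp [pow_succ]
    rw [Polynomial.aeval_monomial, Matrix.mul_assoc, hk, ← Matrix.mul_assoc,
      Algebra.commutes, Matrix.mul_assoc]
    congr 1
    ext i j
    rw [Matrix.algebraMap_eq_diagonal, Matrix.diagonal_mul_diagonal]
    simp [Polynomial.eval_monomial]

lemma roots_charpoly_of_mul_eq_mul_diagonal {T V V' : Matrix ι ι ℝ} {d : ι → ℝ}
    (h : T * V = V * Matrix.diagonal d) (hV : V * V' = 1) :
    T.charpoly.roots.toFinset = Finset.univ.image d := by
  have hT : T = V * (Matrix.diagonal d * V') := by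
    rw [← Matrix.mul_assoc, ← h, Matrix.mul_assoc, hV, Matrix.mul_one]
  rw [hT, Matrix.charpoly_mul_comm, Matrix.mul_assoc, mul_eq_one_comm.1 hV, Matrix.mul_one,
    Matrix.charpoly_diagonal, Polynomial.roots_prod _ _
      (Finset.prod_ne_zero_iff.2 fun i _ => Polynomial.X_sub_C_ne_zero _)]
  ext x
  simp [eq_comm]

/-- On a diagonalizable matrix `matFun f` acts on the eigenvectors by `f` of the eigenvalue. -/
lemma matFun_mul_eq_mul_diagonal {T V V' : Matrix ι ι ℝ} {d : ι → ℝ} (f : ℝ → ℝ)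
    (h : T * V = V * Matrix.diagonal d) (hV : V * V' = 1) :
    matFun f T * V = V * Matrix.diagonal fun i => f (d i) := by
  rw [matFun, aeval_mul_eq_mul_diagonal h]
  congr 2
  ext i
  have hi : d i ∈ T.charpoly.roots.toFinset := by
    rw [roots_charpoly_of_mul_eq_mul_diagonal h hV]
    exact Finset.mem_image_of_mem d (Finset.mem_univ i)
  exact Lagrange.eval_interpolate_at_node f (fun x _ y _ hxy => hxy) hi

lemma matFun_conj {A A' : Matrix ι ι ℝ} (f : ℝ → ℝ) (T : Matrix ι ι ℝ) (h : A * A' = 1) :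
    matFun f (A * T * A') = A * matFun f T * A' := by
  have h' : A' * A = 1 := mul_eq_one_comm.1 h
  have hc : (A * T * A').charpoly = T.charpoly := by
    rw [Matrix.mul_assoc, Matrix.charpoly_mul_comm, Matrix.mul_assoc, h', Matrix.mul_one]
  rw [matFun, matFun, hc]
  generalize Lagrange.interpolate T.charpoly.roots.toFinset id f = q
  induction q using Polynomial.induction_on' with
  | add p q hp hq => rw [map_add, map_add, hp, hq, Matrix.mul_add, Matrix.add_mul]
  | monomial k a =>
    have hk : (A * T * A') ^ k = A * T ^ k * A' := by
      induction k with
      | zero => simp [h]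
      | succ k ih =>
        rw [pow_succ, ih, pow_succ]
        simp only [Matrix.mul_assoc]
        rw [← Matrix.mul_assoc A' A, h', Matrix.one_mul]
    rw [Polynomial.aeval_monomial, Polynomial.aeval_monomial, hk]
    simp only [← Matrix.mul_assoc]
    rw [Algebra.commutes a A]

/-- Every real power is on `[0, ∞)` the pointwise limit of a sequence of polynomials. For negative
exponents the limit is discontinuous at `0`, where by convention the power vanishes. -/
lemma exists_polynomial_tendsto_rpow (a : ℝ) :
    ∃ q : ℕ → Polynomial ℝ, ∀ t : ℝ, 0 ≤ t →
      Filter.Tendsto (fun k => (q k).eval t) Filter.atTop (nhds (t ^ a)) := by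
  obtain ⟨f, hfc, hf⟩ : ∃ f : ℕ → ℝ → ℝ, (∀ k, Continuous (f k)) ∧ ∀ t : ℝ, 0 ≤ t →
      Filter.Tendsto (fun k => f k t) Filter.atTop (nhds (t ^ a)) := by
    rcases le_or_gt 0 a with ha | ha
    · exact ⟨fun _ t => t ^ a, fun _ => Real.continuous_rpow_const ha,
        fun t _ => tendsto_const_nhds⟩
    · -- regularize `|t|^a = |t| / |t|^{1-a}` in the denominator, which gives the value `0` at `0`
      refine ⟨fun k t => |t| / (|t| ^ (1 - a) + 1 / ((k : ℝ) + 1)), fun k => ?_, fun t ht => ?_⟩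
      · refine continuous_abs.div ?_ fun t => by positivity
        exact (continuous_abs.rpow_const fun _ => Or.inr (by linarith)).add continuous_const
      · rcases ht.eq_or_lt with rfl | ht
        · simp [Real.zero_rpow ha.ne]
        · have h1 : t ^ a = |t| / (|t| ^ (1 - a) + 0) := by
            rw [abs_of_pos ht, add_zero, Real.rpow_sub ht, Real.rpow_one]
            have := (Real.rpow_pos_of_pos ht a).ne'
            field_simp
          rw [h1]
          refine tendsto_const_nhds.div (tendsto_const_nhds.add
            tendsto_one_div_add_atTop_nhds_zero_nat) ?_
          rw [add_zero, abs_of_pos ht]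
          exact (Real.rpow_pos_of_pos ht _).ne'
  -- Weierstrass approximation of `f k` on `[-k, k]`, up to `1 / (k + 1)`
  have hq : ∀ k : ℕ, ∃ q : Polynomial ℝ, ∀ t ∈ Set.Icc (-(k : ℝ)) k,
      |q.eval t - f k t| < 1 / ((k : ℝ) + 1) := fun k =>
    exists_polynomial_near_of_continuousOn _ _ (f k) (hfc k).continuousOn _ (by positivity)
  choose q hq using hq
  refine ⟨q, fun t ht => ?_⟩
  have h0 : Filter.Tendsto (fun k => (q k).eval t - f k t) Filter.atTop (nhds 0) := by
    refine squeeze_zero_norm' ?_ tendsto_one_div_add_atTop_nhds_zero_nat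
    obtain ⟨K, hK⟩ := exists_nat_ge t
    filter_upwards [Filter.eventually_ge_atTop K] with k hk
    have hk' : (K : ℝ) ≤ k := by exact_mod_cast hk
    exact (hq k t ⟨by linarith, by linarith⟩).le
  simpa using h0.add (hf t ht)

lemma tendsto_aeval_matFun {q : ℕ → Polynomial ℝ} {f : ℝ → ℝ} {T V V' : Matrix ι ι ℝ}
    {d : ι → ℝ} (h : T * V = V * Matrix.diagonal d) (hV : V * V' = 1)
    (hq : ∀ i, Filter.Tendsto (fun k => (q k).eval (d i)) Filter.atTop (nhds (f (d i)))) :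
    Filter.Tendsto (fun k => Polynomial.aeval T (q k)) Filter.atTop (nhds (matFun f T)) := by
  have hk : ∀ A : Matrix ι ι ℝ, A = A * V * V' := fun A => by
    rw [Matrix.mul_assoc, hV, Matrix.mul_one]
  have hqk : ∀ k, Polynomial.aeval T (q k) =
      V * (Matrix.diagonal fun i => (q k).eval (d i)) * V' := fun k => by
    rw [hk (Polynomial.aeval T (q k)), aeval_mul_eq_mul_diagonal h]
  rw [hk (matFun f T), matFun_mul_eq_mul_diagonal f h hV]
  simp_rw [hqk]
  have hc : Continuous fun d' : ι → ℝ => V * Matrix.diagonal d' * V' :=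
    (continuous_const.matrix_mul continuous_id.matrix_diagonal).matrix_mul continuous_const
  exact (hc.tendsto fun i => f (d i)).comp (tendsto_pi_nhds.2 hq)

end MatFun

/-! ### The stress operator of a family of tangent vectors -/

section Stress

variable {m : ℕ}

lemma mem_so'_iff {φ : Matrix (Idx m) (Idx m) ℝ} :
    φ ∈ LieAlgebra.Orthogonal.so' (Fin m) (Fin 1) ℝ ↔ φᵀ * eSharp m = -(eSharp m * φ) := by
  rw [LieAlgebra.Orthogonal.so', mem_skewAdjointMatricesLieSubalgebra,
    mem_skewAdjointMatricesSubmodule, Matrix.IsSkewAdjoint, Matrix.IsAdjointPair]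
  rw [Matrix.mul_neg]

lemma mink_mulVec_left (A : Matrix (Idx m) (Idx m) ℝ) (v w : Mink m) :
    mink (A *ᵥ v) w = v ⬝ᵥ ((Aᵀ * eSharp m) *ᵥ w) := by
  rw [mink_comm, mink, ← Matrix.mulVec_mulVec, Matrix.mulVec_transpose, dotProduct_comm v,
    ← Matrix.dotProduct_mulVec]
  rfl

lemma mink_mulVec_right (A : Matrix (Idx m) (Idx m) ℝ) (v w : Mink m) :
    mink v (A *ᵥ w) = v ⬝ᵥ ((eSharp m * A) *ᵥ w) := by
  rw [mink_comm, mink, dotProduct_comm, ← Matrix.mulVec_mulVec]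
  rfl

lemma mink_mulVec_of_symm {A : Matrix (Idx m) (Idx m) ℝ} (hA : Aᵀ * eSharp m = eSharp m * A)
    (v w : Mink m) : mink (A *ᵥ v) w = mink v (A *ᵥ w) := by
  rw [mink_mulVec_left, hA, mink_mulVec_right]

lemma mink_mulVec_of_skew {φ : Matrix (Idx m) (Idx m) ℝ}
    (hφ : φ ∈ LieAlgebra.Orthogonal.so' (Fin m) (Fin 1) ℝ) (v w : Mink m) :
    mink (φ *ᵥ v) w = -mink v (φ *ᵥ w) := by
  rw [mink_mulVec_left, mem_so'_iff.1 hφ, mink_mulVec_right, Matrix.neg_mulVec, dotProduct_neg]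

lemma mink_mulVec_self_of_skew {φ : Matrix (Idx m) (Idx m) ℝ}
    (hφ : φ ∈ LieAlgebra.Orthogonal.so' (Fin m) (Fin 1) ℝ) (v : Mink m) :
    mink (φ *ᵥ v) v = 0 := by
  have h := mink_mulVec_of_skew hφ v v
  rw [mink_comm v] at h
  linarith

lemma trace_vecMulVec_mul (x y : Mink m) (B : Matrix (Idx m) (Idx m) ℝ) :
    (Matrix.vecMulVec x y * B).trace = y ⬝ᵥ (B *ᵥ x) := by
  rw [Matrix.vecMulVec_mul, Matrix.trace_vecMulVec, dotProduct_comm, Matrix.dotProduct_mulVec]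

/-- The pairing of `v × X` with an infinitesimal isometry `B`. -/
lemma trace_cross_mul {B : Matrix (Idx m) (Idx m) ℝ}
    (hB : B ∈ LieAlgebra.Orthogonal.so' (Fin m) (Fin 1) ℝ) (v X : Mink m) :
    (cross v X * B).trace = 2 * mink v (B *ᵥ X) := by
  have h := mink_mulVec_of_skew hB v X
  rw [cross, Matrix.sub_mul, Matrix.trace_sub, trace_vecMulVec_mul, trace_vecMulVec_mul]
  change mink v (B *ᵥ X) - mink X (B *ᵥ v) = _
  rw [mink_comm X, h]; ring

/-- The endomorphism `∑ w_α w_α^♯`. -/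
def stress {ι : Type*} [Fintype ι] (w : ι → Mink m) : Matrix (Idx m) (Idx m) ℝ :=
  ∑ α, Matrix.vecMulVec (w α) (sharp (w α))

variable {ι : Type*} [Fintype ι] (w : ι → Mink m)

lemma stress_symm : (stress w)ᵀ * eSharp m = eSharp m * stress w := by
  rw [stress, Matrix.transpose_sum, Matrix.sum_mul, Matrix.mul_sum]
  refine Finset.sum_congr rfl fun α _ => ?_
  rw [Matrix.transpose_vecMulVec, Matrix.vecMulVec_mul, Matrix.mul_vecMulVec,
    ← Matrix.mulVec_transpose, eSharp_transpose]
  rfl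

lemma aeval_symm {T : Matrix (Idx m) (Idx m) ℝ} (hT : Tᵀ * eSharp m = eSharp m * T)
    (q : Polynomial ℝ) :
    (Polynomial.aeval T q)ᵀ * eSharp m = eSharp m * Polynomial.aeval T q := by
  induction q using Polynomial.induction_on' with
  | add p q hp hq => rw [map_add, Matrix.transpose_add, Matrix.add_mul, hp, hq, Matrix.mul_add]
  | monomial k a =>
    have hk : (T ^ k)ᵀ * eSharp m = eSharp m * T ^ k := by
      induction k with
      | zero => simp
      | succ k ih =>
        rw [pow_succ, Matrix.transpose_mul, Matrix.mul_assoc, ih, ← Matrix.mul_assoc, hT,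
          Matrix.mul_assoc, ← pow_succ', pow_succ]
    rw [Polynomial.aeval_monomial, ← Algebra.smul_def, Matrix.transpose_smul, Matrix.smul_mul, hk,
      Matrix.mul_smul]

lemma aeval_mulVec_of_ker {T : Matrix (Idx m) (Idx m) ℝ} {X : Mink m} (hT : T *ᵥ X = 0)
    (q : Polynomial ℝ) : Polynomial.aeval T q *ᵥ X = q.eval 0 • X := by
  induction q using Polynomial.induction_on' with
  | add p q hp hq => rw [map_add, Matrix.add_mulVec, hp, hq, Polynomial.eval_add, add_smul]
  | monomial k a =>
    rw [Polynomial.aeval_monomial, ← Algebra.smul_def, Matrix.smul_mulVec,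
      Polynomial.eval_monomial]
    cases k with
    | zero => simp
    | succ k => rw [pow_succ, ← Matrix.mulVec_mulVec, hT]; simp

lemma stress_mulVec_of_tangent {X : Mink m} (hw : ∀ α, mink (w α) X = 0) :
    stress w *ᵥ X = 0 := by
  rw [stress, Matrix.sum_mulVec]
  refine Finset.sum_eq_zero fun α _ => ?_
  rw [Matrix.vecMulVec_mulVec]
  have : sharp (w α) ⬝ᵥ X = 0 := hw α
  simp [this]

lemma mink_matFun_stress_mulVec {X : Mink m} (hw : ∀ α, mink (w α) X = 0) (f : ℝ → ℝ)
    {v : Mink m} (hv : mink v X = 0) : mink (matFun f (stress w) *ᵥ v) X = 0 := by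
  rw [matFun, mink_mulVec_of_symm (aeval_symm (stress_symm w) _),
    aeval_mulVec_of_ker (stress_mulVec_of_tangent w hw), mink_smul_right, hv, mul_zero]

/-- A function of `∑ w_α w_α^♯` is symmetric and commutes with it, so its composition with
`∑ w_α w_α^♯` is orthogonal to `so(m, 1)`. -/
lemma sum_mink_matFun_stress (f : ℝ → ℝ) {φ : Matrix (Idx m) (Idx m) ℝ}
    (hφ : φ ∈ LieAlgebra.Orthogonal.so' (Fin m) (Fin 1) ℝ) :
    ∑ α, mink (matFun f (stress w) *ᵥ w α) (φ *ᵥ w α) = 0 := by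
  set T := stress w
  have hT : Tᵀ * eSharp m = eSharp m * T := stress_symm w
  set F := matFun f T with hF
  have hFs : Fᵀ * eSharp m = eSharp m * F := aeval_symm hT _
  have hTF : T * F = F * T := by
    have hc : ∀ q : Polynomial ℝ, T * Polynomial.aeval T q = Polynomial.aeval T q * T := fun q => by
      have h := (Commute.all Polynomial.X q).map (Polynomial.aeval T)
      rwa [Polynomial.aeval_X] at h
    exact hc _
  have h1 : ∑ α, mink (F *ᵥ w α) (φ *ᵥ w α) = (φ * (T * F)).trace := by
    rw [← Matrix.mul_assoc, Matrix.trace_mul_comm, ← Matrix.mul_assoc, Matrix.trace_mul_comm]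
    rw [show T = ∑ α, Matrix.vecMulVec (w α) (sharp (w α)) from rfl, Matrix.sum_mul,
      Matrix.trace_sum]
    refine Finset.sum_congr rfl fun α _ => ?_
    rw [trace_vecMulVec_mul, mink_mulVec_of_symm hFs, Matrix.mulVec_mulVec]
    rfl
  rw [h1]
  -- the trace of the product of a symmetric and a skew matrix vanishes
  have hR : (T * F)ᵀ * eSharp m = eSharp m * (T * F) := by
    rw [hTF, Matrix.transpose_mul, Matrix.mul_assoc, hFs, ← Matrix.mul_assoc, hT,
      Matrix.mul_assoc, hTF]
  set R := T * F
  have h2 : (φ * R).trace = -(φ * R).trace := by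
    calc (φ * R).trace = (Rᵀ * φᵀ).trace := by
          rw [← Matrix.transpose_mul, Matrix.trace_transpose]
      _ = ((Rᵀ * eSharp m) * (eSharp m * φᵀ)).trace := by
          rw [Matrix.mul_assoc, ← Matrix.mul_assoc (eSharp m), eSharp_mul_self, Matrix.one_mul]
      _ = (R * (eSharp m * (φᵀ * eSharp m))).trace := by
          rw [hR, Matrix.mul_assoc, Matrix.trace_mul_comm]
          simp only [Matrix.mul_assoc]
      _ = -(φ * R).trace := by
          rw [mem_so'_iff.1 hφ, Matrix.mul_neg, ← Matrix.mul_assoc, eSharp_mul_self,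
            Matrix.one_mul, Matrix.mul_neg, Matrix.trace_neg, Matrix.trace_mul_comm]
  linarith

/-- Coordinates in which `∑ w_α w_α^♯` is diagonal, for vectors `w_α` tangent at `X`: an eigenbasis
(the columns of `V`) that is orthonormal for `( , )^{+, X}`, with eigenvalues the sums of squares
of the coordinates of the `w_α`. -/
lemma exists_eigenbasis_stress {X : Mink m} (hX : X ∈ hyperboloid m)
    (hw : ∀ α, mink (w α) X = 0) :
    ∃ (V : Matrix (Idx m) (Idx m) ℝ) (d : Idx m → ℝ), Vᵀ * plusGram X * V = 1 ∧
      stress w * V = V * Matrix.diagonal d ∧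
      ∀ i, d i = ∑ α, ((Vᵀ * plusGram X) *ᵥ w α) i ^ 2 := by
  have hPT : plusGram X * stress w = ∑ α, Matrix.vecMulVec (sharp (w α)) (sharp (w α)) := by
    rw [stress, Matrix.mul_sum]
    refine Finset.sum_congr rfl fun α _ => ?_
    rw [Matrix.mul_vecMulVec, plusGram_mulVec_of_tangent (hw α)]
  obtain ⟨V, d, hV, hd⟩ := exists_orthonormal_eigenbasis (T := stress w) (plusGram_posDef hX) (by
    rw [hPT, Matrix.transpose_sum]
    simp_rw [Matrix.transpose_vecMulVec])
  refine ⟨V, d, hV, hd, fun i => ?_⟩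
  have h1 : Matrix.diagonal d = ∑ α, Matrix.vecMulVec ((Vᵀ * plusGram X) *ᵥ w α)
      ((Vᵀ * plusGram X) *ᵥ w α) := by
    calc Matrix.diagonal d = Vᵀ * plusGram X * V * Matrix.diagonal d := by
          rw [hV, Matrix.one_mul]
      _ = Vᵀ * (plusGram X * stress w) * V := by
          rw [Matrix.mul_assoc, ← hd]; simp only [Matrix.mul_assoc]
      _ = _ := by
          rw [hPT, Matrix.mul_sum, Matrix.sum_mul]
          refine Finset.sum_congr rfl fun α _ => ?_
          rw [Matrix.mul_vecMulVec, Matrix.vecMulVec_mul, ← Matrix.mulVec_mulVec,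
            plusGram_mulVec_of_tangent (hw α), ← Matrix.mulVec_transpose]
  have h2 := congrFun (congrFun h1 i) i
  rw [Matrix.diagonal_apply_eq, Matrix.sum_apply] at h2
  rw [h2]
  exact Finset.sum_congr rfl fun α _ => by rw [Matrix.vecMulVec_apply, sq]

lemma plusInner_mulVec_of_orthonormal {X : Mink m} {V : Matrix (Idx m) (Idx m) ℝ}
    (hV : Vᵀ * plusGram X * V = 1) (a b : Mink m) :
    plusInner X (V *ᵥ a) (V *ᵥ b) = a ⬝ᵥ b := by
  rw [plusInner_eq_dotProduct, dotProduct_comm, Matrix.dotProduct_mulVec, ← Matrix.mulVec_transpose,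
    Matrix.mulVec_mulVec, Matrix.mulVec_mulVec, hV, Matrix.one_mulVec,
    dotProduct_comm]

/-- The estimate `|Q^{p-2} w|² ≤ (m + 1) |w|^{2 (p-1)}`, for `Q² = ∑ w_α w_α^♯`. -/
lemma sum_plusInner_matFun_stress_le {X : Mink m} (hX : X ∈ hyperboloid m)
    (hw : ∀ α, mink (w α) X = 0) {p : ℝ} (hp : 1 < p) :
    ∑ α, plusInner X (matFun (fun t => t ^ ((p - 2) / 2)) (stress w) *ᵥ w α)
        (matFun (fun t => t ^ ((p - 2) / 2)) (stress w) *ᵥ w α) ≤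
      Fintype.card (Idx m) * (∑ α, plusInner X (w α) (w α)) ^ (p - 1) := by
  obtain ⟨V, d, hV, hd, hdw⟩ := exists_eigenbasis_stress w hX hw
  have hV' : V * (Vᵀ * plusGram X) = 1 := mul_eq_one_comm.1 hV
  set c : ι → Mink m := fun α => (Vᵀ * plusGram X) *ᵥ w α with hc
  have hwc : ∀ α, w α = V *ᵥ c α := fun α => by
    rw [hc, Matrix.mulVec_mulVec, hV', Matrix.one_mulVec]
  set f : ℝ → ℝ := fun t => t ^ ((p - 2) / 2)
  have hF : ∀ α, matFun f (stress w) *ᵥ w α = V *ᵥ fun i => f (d i) * c α i := fun α => by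
    rw [hwc α, Matrix.mulVec_mulVec, matFun_mul_eq_mul_diagonal f hd hV', ← Matrix.mulVec_mulVec]
    congr 1
    ext i
    rw [Matrix.mulVec_diagonal]
  have hd0 : ∀ i, 0 ≤ d i := fun i => by
    rw [hdw]; exact Finset.sum_nonneg fun α _ => sq_nonneg _
  have hsum : ∑ α, plusInner X (w α) (w α) = ∑ i, d i := by
    simp_rw [hdw]
    rw [Finset.sum_comm]
    refine Finset.sum_congr rfl fun α _ => ?_
    conv_lhs => rw [hwc α, plusInner_mulVec_of_orthonormal hV]
    exact Finset.sum_congr rfl fun i _ => (sq _).symm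
  have hsumF : ∑ α, plusInner X (matFun f (stress w) *ᵥ w α) (matFun f (stress w) *ᵥ w α) =
      ∑ i, f (d i) ^ 2 * d i := by
    simp_rw [hdw _, Finset.mul_sum]
    rw [Finset.sum_comm]
    refine Finset.sum_congr rfl fun α _ => ?_
    rw [hF, plusInner_mulVec_of_orthonormal hV]
    refine Finset.sum_congr rfl fun i _ => ?_
    rw [← hdw]; ring
  rw [hsumF, hsum]
  calc ∑ i, f (d i) ^ 2 * d i ≤ ∑ _i : Idx m, (∑ j, d j) ^ (p - 1) := by
        refine Finset.sum_le_sum fun i _ => ?_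
        have h1 : f (d i) ^ 2 * d i = d i ^ (p - 1) := by
          -- for a zero eigenvalue both sides vanish, whatever the value `f 0` is
          rcases (hd0 i).eq_or_lt with h | h
          · rw [← h, mul_zero, Real.zero_rpow (by linarith)]
          · change (d i ^ ((p - 2) / 2)) ^ 2 * d i = _
            rw [← Real.rpow_natCast, ← Real.rpow_mul h.le, ← Real.rpow_add_one h.ne']
            congr 1; push_cast; ring
        rw [h1]
        exact Real.rpow_le_rpow (hd0 i)
          (Finset.single_le_sum (fun j _ => hd0 j) (Finset.mem_univ i)) (by linarith)
    _ = _ := by rw [Finset.sum_const, nsmul_eq_mul, Finset.card_univ]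

lemma exists_plusInner_eq_dotProduct {X : Mink m} (hX : X ∈ hyperboloid m) :
    ∃ B : Matrix (Idx m) (Idx m) ℝ, IsUnit B ∧ plusGram X = Bᵀ * B ∧
      ∀ v w, plusInner X v w = (B *ᵥ v) ⬝ᵥ (B *ᵥ w) := by
  obtain ⟨B, hB, hP⟩ := exists_isUnit_transpose_mul_self (plusGram_posDef hX)
  refine ⟨B, hB, hP, fun v w => ?_⟩
  rw [plusInner_eq_dotProduct, hP, ← Matrix.mulVec_mulVec, Matrix.dotProduct_mulVec,
    Matrix.vecMul_transpose]

/-- The square of the norm of an endomorphism for `( , )^{+, X}` is at most the trace of its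
composition with its adjoint. -/
lemma plusInner_mulVec_le {X : Mink m} (hX : X ∈ hyperboloid m)
    (φ : Matrix (Idx m) (Idx m) ℝ) (v : Mink m) :
    plusInner X (φ *ᵥ v) (φ *ᵥ v) ≤
      ((plusGram X)⁻¹ * φᵀ * plusGram X * φ).trace * plusInner X v v := by
  obtain ⟨B, hB, hP, hB'⟩ := exists_plusInner_eq_dotProduct hX
  have hBd : IsUnit B.det := (Matrix.isUnit_iff_isUnit_det B).1 hB
  have hBiB : B⁻¹ * B = 1 := Matrix.nonsing_inv_mul _ hBd
  set ψ := B * φ * B⁻¹ with hψ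
  have h1 : ((plusGram X)⁻¹ * φᵀ * plusGram X * φ).trace = ∑ i, ∑ j, ψ i j ^ 2 := by
    have h2 : ((plusGram X)⁻¹ * φᵀ * plusGram X * φ).trace = (ψ * ψᵀ).trace := by
      rw [hP, Matrix.mul_inv_rev, Matrix.trace_mul_comm ψ, hψ, Matrix.transpose_mul,
        Matrix.transpose_mul, Matrix.transpose_nonsing_inv]
      simp only [Matrix.mul_assoc]
      rw [Matrix.trace_mul_comm]
      simp only [Matrix.mul_assoc]
    rw [h2, Matrix.trace]
    refine Finset.sum_congr rfl fun i _ => ?_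
    rw [Matrix.diag_apply, Matrix.mul_apply]
    exact Finset.sum_congr rfl fun j _ => by rw [Matrix.transpose_apply, sq]
  have h3 : B *ᵥ (φ *ᵥ v) = ψ *ᵥ (B *ᵥ v) := by
    rw [hψ, Matrix.mulVec_mulVec, Matrix.mulVec_mulVec, Matrix.mul_assoc, hBiB, Matrix.mul_one]
  rw [h1, hB', hB', h3]
  set c := B *ᵥ v
  rw [Finset.sum_mul]
  refine Finset.sum_le_sum fun i _ => ?_
  have := Finset.sum_mul_sq_le_sq_mul_sq Finset.univ (fun j => ψ i j) c
  have h4 : c ⬝ᵥ c = ∑ j, c j ^ 2 := Finset.sum_congr rfl fun j _ => (sq _).symm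
  rw [h4, ← sq]
  exact this

lemma sum_plusInner_sq_le {X : Mink m} (hX : X ∈ hyperboloid m) (a b : ι → Mink m) :
    (∑ α, plusInner X (a α) (b α)) ^ 2 ≤
      (∑ α, plusInner X (a α) (a α)) * ∑ α, plusInner X (b α) (b α) := by
  obtain ⟨B, -, -, hB⟩ := exists_plusInner_eq_dotProduct hX
  simp_rw [hB, dotProduct, ← Finset.sum_product', Finset.univ_product_univ]
  have := Finset.sum_mul_sq_le_sq_mul_sq (Finset.univ : Finset (ι × Idx m))
    (fun z => (B *ᵥ a z.1) z.2) (fun z => (B *ᵥ b z.1) z.2)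
  simpa only [sq] using this

lemma plusInner_add_self_le {X : Mink m} (hX : X ∈ hyperboloid m) (a b : Mink m) :
    plusInner X (a + b) (a + b) ≤ 2 * plusInner X a a + 2 * plusInner X b b := by
  have h := plusInner_self_nonneg hX (a - b)
  have h1 : plusInner X (a - b) (a - b) = plusInner X a a - 2 * plusInner X a b
      + plusInner X b b := by
    simp only [← plusB_apply, map_sub, LinearMap.sub_apply]
    rw [plusB_apply, plusB_apply, plusB_apply, plusB_apply, plusInner_comm X b a]; ring
  have h2 : plusInner X (a + b) (a + b) = plusInner X a a + 2 * plusInner X a b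
      + plusInner X b b := by
    simp only [← plusB_apply, map_add, LinearMap.add_apply]
    rw [plusB_apply, plusB_apply, plusB_apply, plusB_apply, plusInner_comm X b a]; ring
  linarith

end Stress

/-! ### Weak derivatives in Euclidean space -/

section WeakDeriv

variable {E : Type*} [NormedAddCommGroup E] [NormedSpace ℝ E]

lemma contDiff_fderiv_apply {ζ : E → ℝ} (hζ : ContDiff ℝ ∞ ζ) (w : E) :
    ContDiff ℝ ∞ fun y => fderiv ℝ ζ y w :=
  (hζ.fderiv_right (m := ∞) (by simp)).clm_apply contDiff_const

lemma hasCompactSupport_fderiv_apply {ζ : E → ℝ} (hζ : HasCompactSupport ζ) (w : E) :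
    HasCompactSupport fun y => fderiv ℝ ζ y w :=
  hζ.fderiv_apply ℝ w

lemma tsupport_fderiv_apply_le {ζ : E → ℝ} (w : E) :
    tsupport (fun y => fderiv ℝ ζ y w) ⊆ tsupport ζ := tsupport_fderiv_apply_subset ℝ w

lemma exists_cutoff [FiniteDimensional ℝ E] {K O : Set E} (hK : IsCompact K) (hO : IsOpen O)
    (hKO : K ⊆ O) :
    ∃ χ : E → ℝ, ContDiff ℝ ∞ χ ∧ HasCompactSupport χ ∧ tsupport χ ⊆ O ∧
      ∀ y ∈ K, χ =ᶠ[nhds y] fun _ => 1 := by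
  obtain ⟨L, hL, hKL, hLO⟩ := exists_compact_between hK hO hKO
  obtain ⟨χ, h1, h0, -⟩ := exists_contMDiffMap_one_nhds_of_subset_interior (n := ⊤)
    (modelWithCornersSelf ℝ E) hK.isClosed hKL
  have hs : tsupport χ ⊆ L := closure_minimal (fun x hx => by
    by_contra h; exact hx (h0 x h)) hL.isClosed
  refine ⟨χ, χ.contMDiff.contDiff, hL.of_isClosed_subset (isClosed_tsupport _) hs, hs.trans hLO,
    fun y hy => ?_⟩
  exact Filter.eventually_iff_exists_mem.2 ⟨_,
    (Filter.Eventually.filter_mono (nhds_le_nhdsSet hy) h1),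
    fun _ h => h⟩

variable [MeasurableSpace E]

lemma integrable_mul_of_locallyIntegrableOn {E : Type*} [NormedAddCommGroup E] [MeasurableSpace E]
    [BorelSpace E] {μ : Measure E} {O : Set E} {f ζ : E → ℝ} (hf : LocallyIntegrableOn f O μ)
    (hζ : Continuous ζ) (hc : HasCompactSupport ζ) (hs : tsupport ζ ⊆ O) :
    Integrable (fun y => ζ y * f y) μ := by
  have h1 : IntegrableOn f (tsupport ζ) μ := hf.integrableOn_compact_subset hs hc
  have h2 := h1.continuousOn_mul hζ.continuousOn hc
  rwa [integrableOn_iff_integrable_of_support_subset] at h2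
  intro x hx
  refine subset_tsupport ζ fun h => hx ?_
  simp [h]

/-- `h` is the weak derivative of `f` in the direction `w` on the open set `O`; both functions are
locally integrable. -/
structure HasWeakDeriv (μ : Measure E) (O : Set E) (w : E) (f h : E → ℝ) : Prop where
  locInt : LocallyIntegrableOn f O μ
  locInt_deriv : LocallyIntegrableOn h O μ
  integral_eq : ∀ ζ : E → ℝ, ContDiff ℝ ∞ ζ → HasCompactSupport ζ → tsupport ζ ⊆ O →
    ∫ y, fderiv ℝ ζ y w * f y ∂μ = -∫ y, ζ y * h y ∂μ

variable {μ : Measure E} {O : Set E} {w : E} {f h f₁ h₁ f₂ h₂ : E → ℝ}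

namespace HasWeakDeriv

lemma zero : HasWeakDeriv μ O w (fun _ => 0) (fun _ => 0) where
  locInt := locallyIntegrable_zero.locallyIntegrableOn O
  locInt_deriv := locallyIntegrable_zero.locallyIntegrableOn O
  integral_eq ζ _ _ _ := by simp

variable [BorelSpace E]

lemma add (h1 : HasWeakDeriv μ O w f₁ h₁) (h2 : HasWeakDeriv μ O w f₂ h₂) :
    HasWeakDeriv μ O w (fun y => f₁ y + f₂ y) (fun y => h₁ y + h₂ y) where
  locInt := h1.locInt.add h2.locInt
  locInt_deriv := h1.locInt_deriv.add h2.locInt_deriv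
  integral_eq ζ hζ hc hs := by
    have hζ' := (contDiff_fderiv_apply hζ w).continuous
    have hc' := hasCompactSupport_fderiv_apply hc w
    have hs' := (tsupport_fderiv_apply_le w).trans hs
    simp_rw [mul_add]
    rw [integral_add (integrable_mul_of_locallyIntegrableOn h1.locInt hζ' hc' hs')
        (integrable_mul_of_locallyIntegrableOn h2.locInt hζ' hc' hs'),
      integral_add (integrable_mul_of_locallyIntegrableOn h1.locInt_deriv hζ.continuous hc hs)
        (integrable_mul_of_locallyIntegrableOn h2.locInt_deriv hζ.continuous hc hs),
      h1.integral_eq ζ hζ hc hs, h2.integral_eq ζ hζ hc hs]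
    ring

lemma sum {ι : Type*} (s : Finset ι) {f h : ι → E → ℝ}
    (H : ∀ i ∈ s, HasWeakDeriv μ O w (f i) (h i)) :
    HasWeakDeriv μ O w (fun y => ∑ i ∈ s, f i y) (fun y => ∑ i ∈ s, h i y) := by
  classical
  induction s using Finset.induction_on with
  | empty => simpa using zero
  | insert a s ha ih =>
    simp_rw [Finset.sum_insert ha]
    exact (H a (Finset.mem_insert_self a s)).add
      (ih fun i hi => H i (Finset.mem_insert_of_mem hi))

variable [FiniteDimensional ℝ E]

/-- The Leibniz rule for the product with a smooth function. -/
lemma smooth_mul (hO : IsOpen O) {a : E → ℝ} (ha : ContDiffOn ℝ ∞ a O)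
    (H : HasWeakDeriv μ O w f h) :
    HasWeakDeriv μ O w (fun y => a y * f y) (fun y => fderiv ℝ a y w * f y + a y * h y) := by
  have hac : ContinuousOn (fun y => fderiv ℝ a y w) O :=
    (ha.continuousOn_fderiv_of_isOpen hO (by simp)).clm_apply continuousOn_const
  have hl := hO.isLocallyClosed
  refine ⟨H.locInt.continuousOn_mul ha.continuousOn hl,
    (H.locInt.continuousOn_mul hac hl).add (H.locInt_deriv.continuousOn_mul ha.continuousOn hl),
    fun ζ hζ hc hs => ?_⟩
  have hsub : tsupport (fun y => ζ y * a y) ⊆ tsupport ζ := tsupport_mul_subset_left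
  have hζa : ContDiff ℝ ∞ fun y => ζ y * a y := by
    rw [contDiff_iff_contDiffAt]
    intro y
    by_cases hy : y ∈ tsupport ζ
    · exact hζ.contDiffAt.mul (ha.contDiffAt (hO.mem_nhds (hs hy)))
    · have : (fun y => ζ y * a y) =ᶠ[nhds y] fun _ => 0 := by
        filter_upwards [(isClosed_tsupport ζ).isOpen_compl.mem_nhds hy] with z hz
        rw [image_eq_zero_of_notMem_tsupport hz, zero_mul]
      exact contDiffAt_const.congr_of_eventuallyEq this
  have hcza : HasCompactSupport fun y => ζ y * a y := hc.mul_right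
  have hder : ∀ y, fderiv ℝ (fun y => ζ y * a y) y w =
      fderiv ℝ ζ y w * a y + ζ y * fderiv ℝ a y w := fun y => by
    by_cases hy : y ∈ tsupport ζ
    · have h1 : DifferentiableAt ℝ ζ y := (hζ.differentiable (by simp)) y
      have h2 : DifferentiableAt ℝ a y :=
        (ha.contDiffAt (hO.mem_nhds (hs hy))).differentiableAt (by simp)
      rw [fderiv_fun_mul h1 h2]
      simp only [add_apply, smul_apply, smul_eq_mul]
      ring
    · have h1 : fderiv ℝ (fun y => ζ y * a y) y w = 0 :=
        image_eq_zero_of_notMem_tsupport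
          (f := fun y => fderiv ℝ (fun y => ζ y * a y) y w)
          (fun h => hy (hsub (tsupport_fderiv_apply_le (ζ := fun y => ζ y * a y) w h)))
      have h2 : fderiv ℝ ζ y w = 0 :=
        image_eq_zero_of_notMem_tsupport
          (f := fun y => fderiv ℝ ζ y w) (fun h => hy (tsupport_fderiv_apply_le (ζ := ζ) w h))
      rw [h1, h2, image_eq_zero_of_notMem_tsupport hy]; ring
  have key := H.integral_eq _ hζa hcza (hsub.trans hs)
  have hζ' := (contDiff_fderiv_apply hζ w).continuous
  have hc' := hasCompactSupport_fderiv_apply hc w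
  have hs' := (tsupport_fderiv_apply_le w).trans hs
  have i1 := integrable_mul_of_locallyIntegrableOn
    (H.locInt.continuousOn_mul ha.continuousOn hl) hζ' hc' hs'
  have i2 := integrable_mul_of_locallyIntegrableOn
    (H.locInt.continuousOn_mul hac hl) hζ.continuous hc hs
  have i3 := integrable_mul_of_locallyIntegrableOn
    (H.locInt_deriv.continuousOn_mul ha.continuousOn hl) hζ.continuous hc hs
  have e1 : ∫ y, fderiv ℝ (fun y => ζ y * a y) y w * f y ∂μ =
      (∫ y, fderiv ℝ ζ y w * (a y * f y) ∂μ) + ∫ y, ζ y * (fderiv ℝ a y w * f y) ∂μ := by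
    rw [← integral_add i1 i2]
    exact integral_congr_ae (Filter.Eventually.of_forall fun y => by
      simp only [hder]; ring)
  have e2 : ∫ y, ζ y * (fderiv ℝ a y w * f y + a y * h y) ∂μ =
      (∫ y, ζ y * (fderiv ℝ a y w * f y) ∂μ) + ∫ y, ζ y * (a y * h y) ∂μ := by
    rw [← integral_add i2 i3]
    exact integral_congr_ae (Filter.Eventually.of_forall fun y => by simp only []; ring)
  have e3 : ∫ y, ζ y * a y * h y ∂μ = ∫ y, ζ y * (a y * h y) ∂μ :=
    integral_congr_ae (Filter.Eventually.of_forall fun y => by simp only []; ring)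
  rw [e1, e3] at key
  rw [e2]
  linarith

lemma const_mul (hO : IsOpen O) (c : ℝ) (H : HasWeakDeriv μ O w f h) :
    HasWeakDeriv μ O w (fun y => c * f y) (fun y => c * h y) := by
  simpa using smooth_mul hO (contDiffOn_const (c := c)) H

end HasWeakDeriv

section Mollify

variable [BorelSpace E] [FiniteDimensional ℝ E] [μ.IsAddHaarMeasure]

open scoped Convolution in
/-- The derivative of a mollification is the mollification of the weak derivative. -/
lemma fderiv_convolution_apply {ρ : E → ℝ} (hρ : ContDiff ℝ ∞ ρ) (hρc : HasCompactSupport ρ)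
    (H : HasWeakDeriv μ Set.univ w f h) (x : E) :
    fderiv ℝ (ρ ⋆[ContinuousLinearMap.lsmul ℝ ℝ, μ] f) x w = ∫ y, ρ (x - y) * h y ∂μ := by
  have hfl : LocallyIntegrable f μ := locallyIntegrableOn_univ.1 H.locInt
  have h1 := hρc.hasFDerivAt_convolution_left (ContinuousLinearMap.lsmul ℝ ℝ)
    (hρ.of_le (by simp)) hfl x
  rw [h1.fderiv]
  have hex := (hρc.fderiv ℝ).convolutionExists_left
    ((ContinuousLinearMap.lsmul ℝ ℝ).precompL E : (E →L[ℝ] ℝ) →L[ℝ] ℝ →L[ℝ] E →L[ℝ] ℝ)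
    (hρ.continuous_fderiv (by simp)) hfl x
  rw [convolution_eq_swap, ContinuousLinearMap.integral_apply hex.integrable_swap]
  -- the test function `y ↦ ρ (x - y)`
  have hcd : ContDiff ℝ ∞ fun y => ρ (x - y) := hρ.comp (contDiff_const.sub contDiff_id)
  have hcc : HasCompactSupport fun y => ρ (x - y) :=
    hρc.comp_homeomorph (Homeomorph.subLeft x)
  have key := H.integral_eq _ hcd hcc (Set.subset_univ _)
  have hder : ∀ y, fderiv ℝ (fun y => ρ (x - y)) y w = -fderiv ℝ ρ (x - y) w := fun y => by
    have hd : HasFDerivAt (fun y : E => x - y) (-ContinuousLinearMap.id ℝ E) y := by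
      exact (hasFDerivAt_id y).const_sub x
    have := ((hρ.differentiable (by simp) (x - y)).hasFDerivAt.comp y hd).fderiv
    change fderiv ℝ (ρ ∘ fun y => x - y) y w = _
    rw [this]; simp
  simp_rw [hder, neg_mul, integral_neg] at key
  simpa [ContinuousLinearMap.precompL_apply] using neg_injective key

/-- The chain rule for the square of a continuous weakly differentiable function with compact
support, by testing the weak derivative with products `ζ * f_k` for mollifications `f_k` of `f`. -/
lemma HasWeakDeriv.sq_of_compactSupport (hf : Continuous f) (hfc : HasCompactSupport f)
    (hh : Integrable h μ) (H : HasWeakDeriv μ Set.univ w f h) {ζ : E → ℝ} (hζ : ContDiff ℝ ∞ ζ)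
    (hc : HasCompactSupport ζ) :
    ∫ y, fderiv ℝ ζ y w * f y ^ 2 ∂μ = -∫ y, ζ y * (2 * f y * h y) ∂μ := by
  obtain ⟨φ, hφ⟩ : ∃ φ : ℕ → ContDiffBump (0 : E),
      Filter.Tendsto (fun k => (φ k).rOut) Filter.atTop (nhds 0) := by
    refine ⟨fun k => ⟨1 / ((k : ℝ) + 1) / 2, 1 / ((k : ℝ) + 1), by positivity,
      half_lt_self (by positivity)⟩, tendsto_one_div_add_atTop_nhds_zero_nat⟩
  set ρ : ℕ → E → ℝ := fun k => (φ k).normed μ with hρ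
  have hρs : ∀ k, ContDiff ℝ ∞ (ρ k) := fun k => (φ k).contDiff_normed
  have hρc : ∀ k, HasCompactSupport (ρ k) := fun k => (φ k).hasCompactSupport_normed
  have hfl : LocallyIntegrable f μ := hf.locallyIntegrable
  -- mollification of a continuous function with compact support
  let A : ℕ → (E → ℝ) → E → ℝ := fun k a x => ∫ y, ρ k (x - y) * a y ∂μ
  have hAconv : ∀ k a, A k a = convolution (ρ k) a (ContinuousLinearMap.lsmul ℝ ℝ) μ :=
    fun k a => by ext x; rw [convolution_eq_swap]; rfl
  have hAsmooth : ∀ k, ContDiff ℝ ∞ (A k f) := fun k => by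
    rw [hAconv]; exact (hρc k).contDiff_convolution_left (ContinuousLinearMap.lsmul ℝ ℝ) (hρs k) hfl
  have hAlim : ∀ a, Continuous a → ∀ x, Filter.Tendsto (fun k => A k a x) Filter.atTop
      (nhds (a x)) := fun a ha x => by
    simp_rw [hAconv]
    exact ContDiffBump.convolution_tendsto_right_of_continuous hφ ha x
  have hAcont : ∀ k a, Continuous a → Continuous (A k a) := fun k a ha => by
    rw [hAconv]
    exact (hρc k).continuous_convolution_left (ContinuousLinearMap.lsmul ℝ ℝ) (hρs k).continuous
      ha.locallyIntegrable
  have hAbound : ∀ a C, Continuous a → (∀ y, |a y| ≤ C) → ∀ k x, |A k a x| ≤ C := by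
    intro a C _ hC k x
    have hint : Integrable (fun y => ρ k (x - y)) μ :=
      ((φ k).integrable_normed).comp_sub_left x
    calc |A k a x| ≤ ∫ y, ρ k (x - y) * C ∂μ := by
          rw [← Real.norm_eq_abs]
          refine norm_integral_le_of_norm_le (hint.mul_const C)
            (Filter.Eventually.of_forall fun y => ?_)
          have h0 : 0 ≤ ρ k (x - y) := (φ k).nonneg_normed _
          rw [Real.norm_eq_abs, abs_mul, abs_of_nonneg h0]
          exact mul_le_mul_of_nonneg_left (hC y) h0
      _ = C := by
          rw [integral_mul_const, integral_sub_left_eq_self (ρ k) μ x, hρ, (φ k).integral_normed,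
            one_mul]
  obtain ⟨C, hC⟩ := hfc.exists_bound_of_continuous hf
  have hg : Continuous fun y => ζ y * f y := hζ.continuous.mul hf
  have hgc : HasCompactSupport fun y => ζ y * f y := hc.mul_right
  obtain ⟨C', hC'⟩ := hgc.exists_bound_of_continuous hg
  set dζ : E → ℝ := fun y => fderiv ℝ ζ y w with hdζ
  have hdζs := (contDiff_fderiv_apply hζ w).continuous
  have hdζc := hasCompactSupport_fderiv_apply hc w
  -- the integrated Leibniz rule for `ζ * A k f`
  have hkey : ∀ k, (∫ y, dζ y * A k f y * f y ∂μ) + ∫ y, h y * A k (fun z => ζ z * f z) y ∂μ =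
      -∫ y, ζ y * A k f y * h y ∂μ := fun k => by
    have hs : ContDiff ℝ ∞ fun y => ζ y * A k f y := hζ.mul (hAsmooth k)
    have hsc : HasCompactSupport fun y => ζ y * A k f y := hc.mul_right
    have h1 := H.integral_eq _ hs hsc (Set.subset_univ _)
    rw [← h1]
    have hder : ∀ y, fderiv ℝ (fun y => ζ y * A k f y) y w * f y =
        dζ y * A k f y * f y + ζ y * f y * A k h y := fun y => by
      rw [fderiv_fun_mul (hζ.differentiable (by simp) y) ((hAsmooth k).differentiable (by simp) y)]
      simp only [add_apply, smul_apply, smul_eq_mul]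
      rw [hAconv k f, fderiv_convolution_apply (hρs k) (hρc k) H y]
      simp only [hdζ, A]
      ring
    simp_rw [hder]
    have hcd : Continuous fun y => A k h y := by
      have : (fun y => A k h y) = fun y => fderiv ℝ (A k f) y w := by
        ext y; rw [hAconv k f, fderiv_convolution_apply (hρs k) (hρc k) H y]
      rw [this]; exact (contDiff_fderiv_apply (hAsmooth k) w).continuous
    rw [integral_add]
    · congr 1
      -- Fubini, and the symmetry of the mollifier
      have hsw : ∫ x, ∫ y, ζ x * f x * (ρ k (x - y) * h y) ∂μ ∂μ =
          ∫ y, ∫ x, ζ x * f x * (ρ k (x - y) * h y) ∂μ ∂μ := by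
        refine integral_integral_swap ?_
        have hprod : Integrable (fun z : E × E => (ζ z.1 * f z.1) * h z.2) (μ.prod μ) :=
          (hg.integrable_of_hasCompactSupport hgc).mul_prod hh
        obtain ⟨B, hB⟩ := (hρc k).exists_bound_of_continuous (hρs k).continuous
        refine (hprod.bdd_mul (c := B) (g := fun z => (ζ z.1 * f z.1) * h z.2)
          (f := fun z : E × E => ρ k (z.1 - z.2))
          ((hρs k).continuous.comp (continuous_fst.sub continuous_snd)).aestronglyMeasurable
          (Filter.Eventually.of_forall fun z => hB _)).congr
          (Filter.Eventually.of_forall fun z => ?_)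
        simp only [Function.uncurry]; ring
      have hl : ∀ x, ζ x * f x * A k h x = ∫ y, ζ x * f x * (ρ k (x - y) * h y) ∂μ :=
        fun x => (integral_const_mul _ _).symm
      have hr : ∀ y, h y * A k (fun z => ζ z * f z) y =
          ∫ x, ζ x * f x * (ρ k (x - y) * h y) ∂μ := fun y => by
        simp only [A]
        rw [← integral_const_mul]
        refine integral_congr_ae (Filter.Eventually.of_forall fun x => ?_)
        have : ρ k (y - x) = ρ k (x - y) := by
          rw [← neg_sub, hρ]; exact (φ k).normed_neg _
        simp only [this]; ring
      simp_rw [hl, hr]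
      exact hsw.symm
    · exact ((hdζs.mul (hAsmooth k).continuous).mul hf).integrable_of_hasCompactSupport
        (hdζc.mul_right.mul_right)
    · exact (hg.mul hcd).integrable_of_hasCompactSupport hgc.mul_right
  have hfi : Integrable f μ := hf.integrable_of_hasCompactSupport hfc
  have l1 : Filter.Tendsto (fun k => ∫ y, dζ y * A k f y * f y ∂μ) Filter.atTop
      (nhds (∫ y, dζ y * f y * f y ∂μ)) := by
    refine tendsto_integral_of_dominated_convergence (fun y => |dζ y * f y| * C)
      (fun k => ((hdζs.mul (hAsmooth k).continuous).mul hf).aestronglyMeasurable)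
      ((((hdζs.mul hf).integrable_of_hasCompactSupport hdζc.mul_right).abs).mul_const C)
      (fun k => Filter.Eventually.of_forall fun y => ?_)
      (Filter.Eventually.of_forall fun y => ((hAlim f hf y).const_mul _).mul_const _)
    rw [Real.norm_eq_abs, mul_right_comm, abs_mul]
    exact mul_le_mul_of_nonneg_left (hAbound f C hf hC k y) (abs_nonneg _)
  have l2 : Filter.Tendsto (fun k => ∫ y, h y * A k (fun z => ζ z * f z) y ∂μ) Filter.atTop
      (nhds (∫ y, h y * (ζ y * f y) ∂μ)) := by
    refine tendsto_integral_of_dominated_convergence (fun y => |h y| * C')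
      (fun k => hh.aestronglyMeasurable.mul (hAcont k _ hg).aestronglyMeasurable)
      (hh.abs.mul_const C')
      (fun k => Filter.Eventually.of_forall fun y => ?_)
      (Filter.Eventually.of_forall fun y => (hAlim _ hg y).const_mul _)
    rw [Real.norm_eq_abs, abs_mul]
    exact mul_le_mul_of_nonneg_left (hAbound _ C' hg hC' k y) (abs_nonneg _)
  have l3 : Filter.Tendsto (fun k => ∫ y, ζ y * A k f y * h y ∂μ) Filter.atTop
      (nhds (∫ y, ζ y * f y * h y ∂μ)) := by
    obtain ⟨D, hD⟩ := hc.exists_bound_of_continuous hζ.continuous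
    refine tendsto_integral_of_dominated_convergence (fun y => D * C * |h y|)
      (fun k => (hζ.continuous.mul (hAsmooth k).continuous).aestronglyMeasurable.mul
        hh.aestronglyMeasurable)
      (hh.abs.const_mul _)
      (fun k => Filter.Eventually.of_forall fun y => ?_)
      (Filter.Eventually.of_forall fun y => ((hAlim f hf y).const_mul _).mul_const _)
    rw [Real.norm_eq_abs, abs_mul, abs_mul]
    refine mul_le_mul_of_nonneg_right ?_ (abs_nonneg _)
    exact mul_le_mul (hD y) (hAbound f C hf hC k y) (abs_nonneg _) ((abs_nonneg _).trans (hD y))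
  have hlim := tendsto_nhds_unique ((l1.add l2).congr hkey) l3.neg
  have e1 : ∫ y, fderiv ℝ ζ y w * f y ^ 2 ∂μ = ∫ y, dζ y * f y * f y ∂μ :=
    integral_congr_ae (Filter.Eventually.of_forall fun y => by simp only [hdζ]; ring)
  have e2 : ∫ y, h y * (ζ y * f y) ∂μ = ∫ y, ζ y * f y * h y ∂μ :=
    integral_congr_ae (Filter.Eventually.of_forall fun y => by simp only []; ring)
  have e3 : ∫ y, ζ y * (2 * f y * h y) ∂μ = 2 * ∫ y, ζ y * f y * h y ∂μ := by
    rw [← integral_const_mul]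
    exact integral_congr_ae (Filter.Eventually.of_forall fun y => by simp only []; ring)
  rw [e2] at hlim
  rw [e1, e3]
  linarith

/-- The chain rule for the square of a continuous weakly differentiable function. -/
lemma HasWeakDeriv.sq (hO : IsOpen O) (hf : ContinuousOn f O) (H : HasWeakDeriv μ O w f h) :
    HasWeakDeriv μ O w (fun y => f y ^ 2) (fun y => 2 * f y * h y) := by
  refine ⟨(hf.pow 2).locallyIntegrableOn hO.measurableSet, ?_, fun ζ hζ hc hs => ?_⟩
  · exact H.locInt_deriv.continuousOn_mul (continuousOn_const.mul hf) hO.isLocallyClosed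
  · -- near the support of `ζ`, replace `f` by a function with compact support in `O`
    obtain ⟨χ, hχ, hχc, hχs, hχ1⟩ := exists_cutoff hc hO hs
    have H1 := H.smooth_mul hO hχ.contDiffOn
    have hcont : Continuous fun y => χ y * f y := by
      refine continuous_iff_continuousAt.2 fun y => ?_
      by_cases hy : y ∈ tsupport χ
      · exact hχ.continuous.continuousAt.mul (hf.continuousAt (hO.mem_nhds (hχs hy)))
      · refine continuousAt_const.congr (f := fun _ => (0 : ℝ)) ?_
        filter_upwards [(isClosed_tsupport χ).isOpen_compl.mem_nhds hy] with z hz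
        rw [image_eq_zero_of_notMem_tsupport hz, zero_mul]
    have hint : Integrable (fun y => fderiv ℝ χ y w * f y + χ y * h y) μ :=
      (integrable_mul_of_locallyIntegrableOn H.locInt (contDiff_fderiv_apply hχ w).continuous
        (hasCompactSupport_fderiv_apply hχc w) ((tsupport_fderiv_apply_le w).trans hχs)).add
      (integrable_mul_of_locallyIntegrableOn H.locInt_deriv hχ.continuous hχc hχs)
    have H2 : HasWeakDeriv μ Set.univ w (fun y => χ y * f y)
        (fun y => fderiv ℝ χ y w * f y + χ y * h y) := by
      refine ⟨(hcont.locallyIntegrable).locallyIntegrableOn _,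
        hint.locallyIntegrable.locallyIntegrableOn _, fun θ hθ hθc _ => ?_⟩
      -- test functions need not have support in `O`: cut them off outside the support of `χ`
      obtain ⟨χ', hχ', hχc', hχs', hχ1'⟩ := exists_cutoff hχc hO hχs
      have key := H1.integral_eq (fun y => χ' y * θ y) (hχ'.mul hθ) hθc.mul_left
        (tsupport_mul_subset_left.trans hχs')
      have e1 : ∀ y, fderiv ℝ (fun y => χ' y * θ y) y w * (χ y * f y) =
          fderiv ℝ θ y w * (χ y * f y) := fun y => by
        by_cases hy : y ∈ tsupport χ
        · have : (fun y => χ' y * θ y) =ᶠ[nhds y] θ := by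
            filter_upwards [hχ1' y hy] with z hz
            rw [hz, one_mul]
          rw [this.fderiv_eq]
        · rw [image_eq_zero_of_notMem_tsupport hy]; ring
      have e2 : ∀ y, χ' y * θ y * (fderiv ℝ χ y w * f y + χ y * h y) =
          θ y * (fderiv ℝ χ y w * f y + χ y * h y) := fun y => by
        by_cases hy : y ∈ tsupport χ
        · rw [(hχ1' y hy).self_of_nhds, one_mul]
        · have h2 : fderiv ℝ χ y w = 0 := image_eq_zero_of_notMem_tsupport
            (f := fun y => fderiv ℝ χ y w) (fun h => hy (tsupport_fderiv_apply_le w h))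
          rw [h2, image_eq_zero_of_notMem_tsupport hy]; ring
      simp_rw [e1, e2] at key
      exact key
    have key := H2.sq_of_compactSupport hcont hχc.mul_right hint hζ hc
    have e1 : ∀ y, fderiv ℝ ζ y w * (χ y * f y) ^ 2 = fderiv ℝ ζ y w * f y ^ 2 := fun y => by
      by_cases hy : y ∈ tsupport ζ
      · rw [(hχ1 y hy).self_of_nhds, one_mul]
      · have h2 : fderiv ℝ ζ y w = 0 := image_eq_zero_of_notMem_tsupport
          (f := fun y => fderiv ℝ ζ y w) (fun h => hy (tsupport_fderiv_apply_le w h))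
        rw [h2]; ring
    have e2 : ∀ y, ζ y * (2 * (χ y * f y) * (fderiv ℝ χ y w * f y + χ y * h y)) =
        ζ y * (2 * f y * h y) := fun y => by
      by_cases hy : y ∈ tsupport ζ
      · rw [(hχ1 y hy).fderiv_eq, (hχ1 y hy).self_of_nhds]; simp
      · rw [image_eq_zero_of_notMem_tsupport hy]; ring
    simp_rw [e1, e2] at key
    exact key

lemma integral_fderiv_apply_eq_zero {ζ : E → ℝ} (hζ : ContDiff ℝ ∞ ζ) (hc : HasCompactSupport ζ)
    (w : E) : ∫ y, fderiv ℝ ζ y w ∂μ = 0 := by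
  have h1 : Integrable (fun y => fderiv ℝ ζ y w) μ :=
    (contDiff_fderiv_apply hζ w).continuous.integrable_of_hasCompactSupport
      (hasCompactSupport_fderiv_apply hc w)
  have h2 : Integrable ζ μ := hζ.continuous.integrable_of_hasCompactSupport hc
  have h := integral_mul_fderiv_eq_neg_fderiv_mul_of_integrable (𝕜 := ℝ) (μ := μ) (v := w)
    (f := fun _ : E => (1 : ℝ)) (g := ζ) (by simp) (by simpa using h1) (by simpa using h2)
    (fun _ _ => differentiableAt_const _) (fun x _ => hζ.differentiable (by simp) x)
  simpa using h

lemma HasWeakDeriv.ae_eq_zero_of_const (hO : IsOpen O) {c : ℝ} (hf : ∀ y ∈ O, f y = c)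
    (H : HasWeakDeriv μ O w f h) : ∀ᵐ y ∂μ, y ∈ O → h y = 0 := by
  refine hO.ae_eq_zero_of_integral_contDiff_smul_eq_zero H.locInt_deriv fun ζ hζ hc hs => ?_
  have h1 := H.integral_eq ζ hζ hc hs
  have h2 : ∫ y, fderiv ℝ ζ y w * f y ∂μ = ∫ y, fderiv ℝ ζ y w * c ∂μ := by
    refine integral_congr_ae (Filter.Eventually.of_forall fun y => ?_)
    by_cases hy : y ∈ tsupport ζ
    · simp only [hf y (hs hy)]
    · have h2 : fderiv ℝ ζ y w = 0 := image_eq_zero_of_notMem_tsupport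
        (f := fun y => fderiv ℝ ζ y w) (fun h => hy (tsupport_fderiv_apply_le w h))
      simp only [h2, zero_mul]
  rw [h2, integral_mul_const, integral_fderiv_apply_eq_zero hζ hc, zero_mul] at h1
  simpa using h1.symm

end Mollify

end WeakDeriv

/-! ### Local lifts to hyperbolic space -/

section Covering

variable {m : ℕ} {Γ : Subgroup (SOplus m)}

lemma isClosed_hyperboloid (m : ℕ) : IsClosed (hyperboloid m) := by
  have h : Continuous fun X : Mink m => mink X X := by
    simp_rw [mink_self]; fun_prop
  exact (isClosed_eq h continuous_const).inter
    (isClosed_le continuous_const (continuous_apply _))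

instance (m : ℕ) : LocallyCompactSpace (Hyp m) := (isClosed_hyperboloid m).locallyCompactSpace

lemma coe_smul (γ : Γ) (X : Hyp m) : (γ • X).1 = toMat γ *ᵥ X.1 := rfl

instance : ContinuousConstSMul Γ (Hyp m) where
  continuous_const_smul γ := by
    refine Continuous.subtype_mk (f := fun X : Hyp m => toMat γ *ᵥ X.1) ?_ _
    exact continuous_const.matrix_mulVec continuous_subtype_val

lemma toMat_mul_toMat_inv (γ : Γ) : toMat γ * toMat γ⁻¹ = 1 := by
  have h : toMat (γ * γ⁻¹) = toMat γ * toMat γ⁻¹ := rfl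
  rw [← h, mul_inv_cancel]; rfl

lemma toMat_inv_mul_toMat (γ : Γ) : toMat γ⁻¹ * toMat γ = 1 :=
  mul_eq_one_comm.1 (toMat_mul_toMat_inv γ)

lemma toMat_isometry (γ : Γ) : (toMat γ)ᵀ * eSharp m * toMat γ = eSharp m := γ.1.2.1

lemma proj_smul (γ : Γ) (X : Hyp m) : proj Γ (γ • X) = proj Γ X :=
  Quotient.sound (MulAction.orbitRel_apply.2 ⟨γ, rfl⟩)

lemma exists_smul_eq_of_proj_eq {X Y : Hyp m} (h : proj Γ X = proj Γ Y) : ∃ γ : Γ, γ • Y = X :=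
  MulAction.orbitRel_apply.1 (Quotient.exact h)

lemma IsHyperbolicGroup.isLocalHomeomorph_proj (hΓ : IsHyperbolicGroup Γ) :
    IsLocalHomeomorph (proj Γ) := by
  have := hΓ.properlyDiscontinuous
  have : IsCancelSMul Γ (Hyp m) :=
    isCancelSMul_iff_eq_one_of_smul_eq.2 fun γ X h => hΓ.free γ X h
  exact (isQuotientCoveringMap_quotientMk_of_properlyDiscontinuousSMul
    (G := Γ) (E := Hyp m)).isCoveringMap.isLocalHomeomorph

variable {M : Type*} {u : M → HypMfd Γ}

lemma proj_base (u : M → HypMfd Γ) (x : M) : proj Γ (base u x) = u x := Quotient.out_eq (u x)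

variable [TopologicalSpace M]

lemma exists_localLift (hΓ : IsHyperbolicGroup Γ) (hu : Continuous u) {x : M} {X : Hyp m}
    (hX : proj Γ X = u x) : ∃ (U : Set M) (v : M → Hyp m), x ∈ U ∧ IsLocalLift u U v ∧ v x = X := by
  obtain ⟨e, heX, he⟩ := hΓ.isLocalHomeomorph_proj X
  have hx : u x ∈ e.target := by rw [← hX, he]; exact e.map_source heX
  refine ⟨u ⁻¹' e.target, fun y => e.symm (u y), hx,
    ⟨e.open_target.preimage hu, ?_, fun y hy => ?_⟩, ?_⟩
  · exact e.continuousOn_symm.comp hu.continuousOn fun y hy => hy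
  · rw [he]; exact e.right_inv hy
  · change e.symm (u x) = X
    rw [← hX, he, e.left_inv heX]

lemma IsLocalLift.eventuallyEq (hΓ : IsHyperbolicGroup Γ) {U U' : Set M} {v v' : M → Hyp m}
    (h : IsLocalLift u U v) (h' : IsLocalLift u U' v') {x : M} (hx : x ∈ U) (hx' : x ∈ U')
    (hv : v x = v' x) : v =ᶠ[nhds x] v' := by
  obtain ⟨e, heX, he⟩ := hΓ.isLocalHomeomorph_proj (v x)
  have hc := h.continuousOn.continuousAt (h.isOpen.mem_nhds hx)
  have hc' := h'.continuousOn.continuousAt (h'.isOpen.mem_nhds hx')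
  filter_upwards [h.isOpen.mem_nhds hx, h'.isOpen.mem_nhds hx',
    hc.preimage_mem_nhds (e.open_source.mem_nhds heX),
    hc'.preimage_mem_nhds (e.open_source.mem_nhds (hv ▸ heX))] with y hy hy' h1 h2
  refine e.injOn h1 h2 ?_
  rw [← he, h.lifts y hy, h'.lifts y hy']

lemma IsLocalLift.smul {U : Set M} {v : M → Hyp m} (h : IsLocalLift u U v) (γ : Γ) :
    IsLocalLift u U fun y => γ • v y where
  isOpen := h.isOpen
  continuousOn := h.continuousOn.const_smul γ
  lifts x hx := by rw [proj_smul, h.lifts x hx]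

lemma IsLocalLift.mono {U V : Set M} {v : M → Hyp m} (h : IsLocalLift u U v) (hV : IsOpen V)
    (hVU : V ⊆ U) : IsLocalLift u V v :=
  ⟨hV, h.continuousOn.mono hVU, fun x hx => h.lifts x (hVU hx)⟩

lemma IsLocalLift.exists_smul_eq_base {U : Set M} {v : M → Hyp m} (h : IsLocalLift u U v) {x : M}
    (hx : x ∈ U) : ∃ γ : Γ, γ • v x = base u x :=
  exists_smul_eq_of_proj_eq (by rw [proj_base, h.lifts x hx])

end Covering

/-! ### The flat connection along a local lift -/

section FlatD

/-- The differential of a vector-valued map, as a linear map into the fixed vector space. -/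
def vecD {n : ℕ} {H : Type*} [TopologicalSpace H]
    (I : ModelWithCorners ℝ (EuclideanSpace ℝ (Fin n)) H) {M : Type*} [TopologicalSpace M]
    [ChartedSpace H M] {F : Type*} [NormedAddCommGroup F] [NormedSpace ℝ F] (f : M → F) (x : M) :
    TangentSpace I x →L[ℝ] F :=
  mfderiv I 𝓘(ℝ, F) f x

/-- The expression of a section of `ad(E)` along a local lift, as an array of functions. -/
def alongLift {m : ℕ} {M : Type*} (φ : M → Hyp m → Matrix (Idx m) (Idx m) ℝ) (v : M → Hyp m) :
    M → Idx m → Idx m → ℝ := fun y => Matrix.of.symm (φ y (v y))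

variable {n m : ℕ} {H : Type*} [TopologicalSpace H]
  {I : ModelWithCorners ℝ (EuclideanSpace ℝ (Fin n)) H}
  {M : Type*} [TopologicalSpace M] [ChartedSpace H M]
  {Γ : Subgroup (SOplus m)} {u : M → HypMfd Γ} {φ : M → Hyp m → Matrix (Idx m) (Idx m) ℝ}
  {U : Set M} {v : M → Hyp m}

lemma vecD_congr {F : Type*} [NormedAddCommGroup F] [NormedSpace ℝ F] {f g : M → F} {x : M}
    (h : f =ᶠ[nhds x] g) : vecD I f x = vecD I g x := h.mfderiv_eq

lemma vecD_const {F : Type*} [NormedAddCommGroup F] [NormedSpace ℝ F] (c : F) (x : M) :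
    vecD I (fun _ => c) x = 0 := mfderiv_const

lemma vecD_clm_comp {F G : Type*} [NormedAddCommGroup F] [NormedSpace ℝ F]
    [NormedAddCommGroup G] [NormedSpace ℝ G] (L : F →L[ℝ] G) {f : M → F} {x : M}
    (hf : MDifferentiableAt I 𝓘(ℝ, F) f x) (t : TangentSpace I x) :
    vecD I (fun y => L (f y)) x t = L (vecD I f x t) := by
  have h := L.hasMFDerivAt (x := f x) |>.comp x hf.hasMFDerivAt
  have h' := h.mfderiv
  change mfderiv I 𝓘(ℝ, G) (L ∘ f) x t = _
  rw [h']; rfl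

lemma flatD_apply (hΓ : IsHyperbolicGroup Γ) (hv : IsLocalLift u U v) {x : M} (hx : x ∈ U)
    (t : TangentSpace I x) :
    flatD I u φ x (v x) t =
      Matrix.of (vecD I (alongLift φ v) x t) := by
  have h : ∃ v' : M → Hyp m, (∃ U' : Set M, x ∈ U' ∧ IsLocalLift u U' v') ∧ v' x = v x :=
    ⟨v, ⟨U, hx, hv⟩, rfl⟩
  obtain ⟨⟨U', hx', hv'⟩, hvx⟩ := h.choose_spec
  rw [flatD, dif_pos h]
  have he : (fun y => Matrix.of.symm (φ y (h.choose y))) =ᶠ[nhds x] alongLift φ v := by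
    filter_upwards [hv'.eventuallyEq hΓ hv hx' hx hvx] with y hy
    rw [alongLift, hy]
  change Matrix.of (vecD I (fun y => Matrix.of.symm (φ y (h.choose y))) x t) = _
  rw [vecD_congr he]

lemma IsSmoothAdSection.continuousOn (hφ : IsSmoothAdSection I u φ) (hv : IsLocalLift u U v) :
    ContinuousOn (fun x => φ x (v x)) U :=
  (hφ.smooth U v hv).continuousOn

lemma IsSmoothAdSection.mdifferentiableAt (hφ : IsSmoothAdSection I u φ) (hv : IsLocalLift u U v)
    {x : M} (hx : x ∈ U) : MDifferentiableAt I 𝓘(ℝ, Idx m → Idx m → ℝ) (alongLift φ v) x :=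
  ((hφ.smooth U v hv).contMDiffAt (hv.isOpen.mem_nhds hx)).mdifferentiableAt (by simp)

/-- Two-sided multiplication by matrices, on arrays. -/
def mulMulL (A B : Matrix (Idx m) (Idx m) ℝ) :
    (Idx m → Idx m → ℝ) →L[ℝ] (Idx m → Idx m → ℝ) :=
  LinearMap.toContinuousLinearMap
    { toFun := fun T => Matrix.of.symm (A * Matrix.of T * B)
      map_add' := fun S T => by
        change A * (Matrix.of S + Matrix.of T) * B = A * Matrix.of S * B + A * Matrix.of T * B
        rw [Matrix.mul_add, Matrix.add_mul]
      map_smul' := fun c T => by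
        change A * (c • Matrix.of T) * B = c • (A * Matrix.of T * B)
        rw [Matrix.mul_smul, Matrix.smul_mul] }

lemma flatD_smul (hΓ : IsHyperbolicGroup Γ) (hφ : IsSmoothAdSection I u φ)
    (hv : IsLocalLift u U v) {x : M} (hx : x ∈ U) (γ : Γ) (t : TangentSpace I x) :
    flatD I u φ x (γ • v x) t = toMat γ * flatD I u φ x (v x) t * toMat γ⁻¹ := by
  have he : alongLift φ (fun y => γ • v y) =ᶠ[nhds x]
      fun y => mulMulL (toMat γ) (toMat γ⁻¹) (alongLift φ v y) := by
    filter_upwards [hv.isOpen.mem_nhds hx] with y hy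
    rw [alongLift, hφ.equivariant y (v y) (hv.lifts y hy) γ]
    rfl
  rw [flatD_apply hΓ (hv.smul γ) hx, flatD_apply hΓ hv hx, vecD_congr he,
    vecD_clm_comp _ (hφ.mdifferentiableAt hv hx)]
  rfl

/-- The linear map whose kernel is `so(m, 1)`, on arrays. -/
def skewDefectL (m : ℕ) : (Idx m → Idx m → ℝ) →L[ℝ] (Idx m → Idx m → ℝ) :=
  LinearMap.toContinuousLinearMap
    { toFun := fun T => Matrix.of.symm ((Matrix.of T)ᵀ * eSharp m + eSharp m * Matrix.of T)
      map_add' := fun S T => by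
        change (Matrix.of S + Matrix.of T)ᵀ * eSharp m + eSharp m * (Matrix.of S + Matrix.of T) =
          ((Matrix.of S)ᵀ * eSharp m + eSharp m * Matrix.of S) +
            ((Matrix.of T)ᵀ * eSharp m + eSharp m * Matrix.of T)
        rw [Matrix.transpose_add, Matrix.mul_add, Matrix.add_mul]; abel
      map_smul' := fun c T => by
        change (c • Matrix.of T)ᵀ * eSharp m + eSharp m * (c • Matrix.of T) =
          c • ((Matrix.of T)ᵀ * eSharp m + eSharp m * Matrix.of T)
        rw [Matrix.transpose_smul, Matrix.mul_smul, Matrix.smul_mul, smul_add] }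

lemma skewDefectL_eq_zero_iff (T : Matrix (Idx m) (Idx m) ℝ) :
    skewDefectL m (Matrix.of.symm T) = 0 ↔ T ∈ LieAlgebra.Orthogonal.so' (Fin m) (Fin 1) ℝ := by
  rw [mem_so'_iff, ← add_eq_zero_iff_eq_neg]
  rfl

/-- The differential of a section of `ad(E)` has values in `so(m, 1)`. -/
lemma flatD_mem_so (hΓ : IsHyperbolicGroup Γ) (hφ : IsSmoothAdSection I u φ)
    (hv : IsLocalLift u U v) {x : M} (hx : x ∈ U) (t : TangentSpace I x) :
    flatD I u φ x (v x) t ∈ LieAlgebra.Orthogonal.so' (Fin m) (Fin 1) ℝ := by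
  rw [← skewDefectL_eq_zero_iff, flatD_apply hΓ hv hx, Equiv.symm_apply_apply,
    ← vecD_clm_comp _ (hφ.mdifferentiableAt hv hx)]
  have he : (fun y => skewDefectL m (alongLift φ v y)) =ᶠ[nhds x] fun _ => 0 := by
    filter_upwards [hv.isOpen.mem_nhds hx] with y hy
    exact (skewDefectL_eq_zero_iff _).2 (hφ.mem_so y (v y) (hv.lifts y hy))
  rw [vecD_congr he, vecD_const]
  rfl

/-- The differential of a section of `ad(E)` in the coordinates of a chart. -/
lemma flatD_chartInvD [IsManifold I ∞ M] (hΓ : IsHyperbolicGroup Γ) (hφ : IsSmoothAdSection I u φ)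
    (hv : IsLocalLift u U v) {x₀ : M} {y : EuclideanSpace ℝ (Fin n)}
    (hy : y ∈ (extChartAt I x₀).target) (hyU : (extChartAt I x₀).symm y ∈ U)
    (w : EuclideanSpace ℝ (Fin n)) :
    flatD I u φ ((extChartAt I x₀).symm y) (v ((extChartAt I x₀).symm y)) (chartInvD I x₀ y w) =
      Matrix.of (fderivWithin ℝ (alongLift φ v ∘ (extChartAt I x₀).symm) (Set.range I) y w) := by
  rw [flatD_apply hΓ hv hyU, ← mfderivWithin_eq_fderivWithin]
  have hyr : y ∈ Set.range I := extChartAt_target_subset_range x₀ hy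
  have h1 := hφ.mdifferentiableAt hv hyU
  have : IsManifold I 1 M := IsManifold.of_le (n := ∞) (by simp)
  have h2 := mdifferentiableWithinAt_extChartAt_symm (I := I) hy
  have h3 := mfderiv_comp_mfderivWithin y h1 h2
    (I.uniqueDiffOn.uniqueMDiffOn y hyr)
  rw [h3]
  rfl

lemma IsSmoothAdSection.contDiffOn [IsManifold I ∞ M] (hφ : IsSmoothAdSection I u φ)
    (hv : IsLocalLift u U v) (x₀ : M) :
    ContDiffOn ℝ ∞ (alongLift φ v ∘ (extChartAt I x₀).symm)
      ((extChartAt I x₀).target ∩ (extChartAt I x₀).symm ⁻¹' U) := by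
  rw [← contMDiffOn_iff_contDiffOn]
  exact (hφ.smooth U v hv).comp
    ((contMDiffOn_extChartAt_symm x₀).mono Set.inter_subset_left) fun y hy => hy.2

end FlatD

/-! ### Frames of the tangent spaces and the fibrewise pairing -/

section Frames

variable {n : ℕ} {H : Type*} [TopologicalSpace H]
  {I : ModelWithCorners ℝ (EuclideanSpace ℝ (Fin n)) H}
  {M : Type*} [TopologicalSpace M] [ChartedSpace H M] [IsManifold I ∞ M]

/-- The Gram matrix of the images of the standard basis under a linear map into `T_x M`. -/
def gramOf (g : Metric I M) (x : M) (L : EuclideanSpace ℝ (Fin n) →L[ℝ] TangentSpace I x) :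
    Matrix (Fin n) (Fin n) ℝ :=
  Matrix.of fun i j => g.inner x (L (EuclideanSpace.single i 1)) (L (EuclideanSpace.single j 1))

/-- The matrix of an endomorphism of `ℝⁿ` in the standard basis. -/
def stdMatrix (D : EuclideanSpace ℝ (Fin n) →L[ℝ] EuclideanSpace ℝ (Fin n)) :
    Matrix (Fin n) (Fin n) ℝ := Matrix.of fun k i => D (EuclideanSpace.single i 1) k

lemma eq_sum_single (v : EuclideanSpace ℝ (Fin n)) :
    v = ∑ k, v k • EuclideanSpace.single k (1 : ℝ) := by
  have h := (EuclideanSpace.basisFun (Fin n) ℝ).sum_repr v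
  simpa using h.symm

lemma map_sum_smul₂ {F G K : Type*} [AddCommGroup F] [Module ℝ F] [AddCommGroup G] [Module ℝ G]
    [AddCommGroup K] [Module ℝ K] (b : F →ₗ[ℝ] G →ₗ[ℝ] K) (a c : Fin n → ℝ) (v : Fin n → F)
    (w : Fin n → G) :
    b (∑ k, a k • v k) (∑ l, c l • w l) = ∑ k, ∑ l, (a k * c l) • b (v k) (w l) := by
  rw [LinearMap.map_sum₂]
  refine Finset.sum_congr rfl fun k _ => ?_
  rw [map_sum]
  refine Finset.sum_congr rfl fun l _ => ?_
  rw [LinearMap.map_smul₂, map_smul, smul_smul]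

lemma sum_smul_sum_congruence {K : Type*} [AddCommGroup K] [Module ℝ K]
    (J G : Matrix (Fin n) (Fin n) ℝ) (β : Fin n → Fin n → K) :
    ∑ i, ∑ j, G i j • ∑ k, ∑ l, (J k i * J l j) • β k l =
      ∑ k, ∑ l, (J * G * Jᵀ) k l • β k l := by
  simp_rw [Finset.smul_sum, smul_smul]
  calc ∑ i, ∑ j, ∑ k, ∑ l, (G i j * (J k i * J l j)) • β k l
      = ∑ i, ∑ k, ∑ j, ∑ l, (G i j * (J k i * J l j)) • β k l :=
        Finset.sum_congr rfl fun i _ => Finset.sum_comm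
    _ = ∑ k, ∑ i, ∑ j, ∑ l, (G i j * (J k i * J l j)) • β k l := Finset.sum_comm
    _ = ∑ k, ∑ i, ∑ l, ∑ j, (G i j * (J k i * J l j)) • β k l :=
        Finset.sum_congr rfl fun k _ => Finset.sum_congr rfl fun i _ => Finset.sum_comm
    _ = ∑ k, ∑ l, ∑ i, ∑ j, (G i j * (J k i * J l j)) • β k l :=
        Finset.sum_congr rfl fun k _ => Finset.sum_comm
    _ = _ := by
        refine Finset.sum_congr rfl fun k _ => Finset.sum_congr rfl fun l _ => ?_
        rw [Finset.sum_comm]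
        simp_rw [Matrix.mul_apply, Finset.sum_mul, Finset.sum_smul, Matrix.transpose_apply]
        exact Finset.sum_congr rfl fun j _ => Finset.sum_congr rfl fun i _ => by
          congr 1; ring

/-- The metric on `T_x M` as a bilinear map. -/
def metricB (g : Metric I M) (x : M) : TangentSpace I x →ₗ[ℝ] TangentSpace I x →ₗ[ℝ] ℝ :=
  LinearMap.mk₂ ℝ (fun v w => g.inner x v w) (fun _ _ _ => by simp) (fun _ _ _ => by simp)
    (fun _ _ _ => by simp) (fun _ _ _ => by simp)

lemma clm_single {F : Type*} [AddCommGroup F] [Module ℝ F] [TopologicalSpace F]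
    (A : EuclideanSpace ℝ (Fin n) →L[ℝ] F)
    (D : EuclideanSpace ℝ (Fin n) →L[ℝ] EuclideanSpace ℝ (Fin n)) (i : Fin n) :
    A (D (EuclideanSpace.single i 1)) =
      ∑ k, stdMatrix D k i • A (EuclideanSpace.single k (1 : ℝ)) := by
  conv_lhs => rw [eq_sum_single (D (EuclideanSpace.single i 1)), map_sum]
  exact Finset.sum_congr rfl fun k _ => by rw [map_smul]; rfl

lemma stdMatrix_eq_toMatrix (D : EuclideanSpace ℝ (Fin n) →L[ℝ] EuclideanSpace ℝ (Fin n)) :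
    stdMatrix D = LinearMap.toMatrix (EuclideanSpace.basisFun (Fin n) ℝ).toBasis
      (EuclideanSpace.basisFun (Fin n) ℝ).toBasis D.toLinearMap := by
  ext i j
  simp [stdMatrix, LinearMap.toMatrix_apply]

lemma det_stdMatrix (D : EuclideanSpace ℝ (Fin n) →L[ℝ] EuclideanSpace ℝ (Fin n)) :
    (stdMatrix D).det = D.det := by
  rw [stdMatrix_eq_toMatrix, LinearMap.det_toMatrix]

lemma stdMatrix_mul_of_comp_eq_id
    {D D' : EuclideanSpace ℝ (Fin n) →L[ℝ] EuclideanSpace ℝ (Fin n)}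
    (h : ∀ v, D (D' v) = v) : stdMatrix D * stdMatrix D' = 1 := by
  rw [stdMatrix_eq_toMatrix, stdMatrix_eq_toMatrix, ← LinearMap.toMatrix_comp]
  have : D.toLinearMap ∘ₗ D'.toLinearMap = LinearMap.id := LinearMap.ext h
  rw [this, LinearMap.toMatrix_id]

lemma gramOf_comp (g : Metric I M) (x : M)
    (L : EuclideanSpace ℝ (Fin n) →L[ℝ] TangentSpace I x)
    (D : EuclideanSpace ℝ (Fin n) →L[ℝ] EuclideanSpace ℝ (Fin n)) :
    gramOf g x (L.comp D) = (stdMatrix D)ᵀ * gramOf g x L * stdMatrix D := by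
  ext i j
  change metricB g x (L (D (EuclideanSpace.single i 1))) (L (D (EuclideanSpace.single j 1))) = _
  rw [clm_single L D i, clm_single L D j, map_sum_smul₂]
  simp only [Matrix.mul_apply, Matrix.transpose_apply, Finset.sum_mul]
  rw [Finset.sum_comm]
  refine Finset.sum_congr rfl fun k _ => Finset.sum_congr rfl fun l _ => ?_
  change _ * g.inner x (L (EuclideanSpace.single l 1)) (L (EuclideanSpace.single k 1)) =
    _ * g.inner x (L (EuclideanSpace.single l 1)) (L (EuclideanSpace.single k 1)) * _
  ring

lemma gramOf_posDef (g : Metric I M) (x : M)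
    {L : EuclideanSpace ℝ (Fin n) →L[ℝ] TangentSpace I x} (hL : Function.Injective L) :
    (gramOf g x L).PosDef := by
  refine Matrix.PosDef.of_dotProduct_mulVec_pos ?_ fun a ha => ?_
  · ext i j
    simp [gramOf, g.symm]
  · set v : EuclideanSpace ℝ (Fin n) := WithLp.toLp 2 a with hv
    have hv0 : v ≠ 0 := fun h => ha (by
      have := congrArg (fun z : EuclideanSpace ℝ (Fin n) => (z : Fin n → ℝ)) h
      simpa [hv] using this)
    have hp := g.pos x (L v) fun h => hv0 (hL (by rw [h, map_zero]))
    have hLv : L v = ∑ k, a k • L (EuclideanSpace.single k (1 : ℝ)) := by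
      conv_lhs => rw [eq_sum_single v, map_sum]
      exact Finset.sum_congr rfl fun k _ => by rw [map_smul]
    have he : g.inner x (L v) (L v) = a ⬝ᵥ (gramOf g x L *ᵥ a) := by
      change metricB g x (L v) (L v) = _
      rw [hLv, map_sum_smul₂]
      simp only [dotProduct, Matrix.mulVec, Finset.mul_sum]
      refine Finset.sum_congr rfl fun i _ => Finset.sum_congr rfl fun j _ => ?_
      change a i * a j * gramOf g x L i j = _
      ring
    rw [he] at hp
    exact hp

lemma gram_eq_gramOf (g : Metric I M) (x : M) :
    gram g x = gramOf g x (ContinuousLinearMap.id ℝ (EuclideanSpace ℝ (Fin n))) := rfl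

/-- The pairing of linear maps can be computed in any basis of the tangent space. -/
lemma pair_eq_sum_of_frame (g : Metric I M) (x : M) {F K : Type*} [AddCommGroup F] [Module ℝ F]
    [TopologicalSpace F] [AddCommGroup K] [Module ℝ K] (b : F →ₗ[ℝ] F →ₗ[ℝ] K)
    (A B : TangentSpace I x →L[ℝ] F) {L : EuclideanSpace ℝ (Fin n) →L[ℝ] TangentSpace I x}
    {L' : TangentSpace I x →L[ℝ] EuclideanSpace ℝ (Fin n)} (hL : ∀ t, L (L' t) = t)
    (hL' : ∀ v, L' (L v) = v) :
    pair g x (fun v w => b v w) A B = ∑ i, ∑ j, ((gramOf g x L)⁻¹ i j) •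
      b (A (L (EuclideanSpace.single i 1))) (B (L (EuclideanSpace.single j 1))) := by
  let D : EuclideanSpace ℝ (Fin n) →L[ℝ] EuclideanSpace ℝ (Fin n) := L'
  let D' : EuclideanSpace ℝ (Fin n) →L[ℝ] EuclideanSpace ℝ (Fin n) := L
  set J := stdMatrix D
  have hJ : J * stdMatrix D' = 1 := stdMatrix_mul_of_comp_eq_id hL'
  have hG : gram g x = Jᵀ * gramOf g x L * J := by
    rw [← gramOf_comp, gram_eq_gramOf]
    congr 1
    ext1 t
    exact (hL t).symm
  have hJi : IsUnit J.det := by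
    have := congrArg Matrix.det hJ
    rw [Matrix.det_mul, Matrix.det_one] at this
    exact IsUnit.of_mul_eq_one _ this
  have hGi : (gramOf g x L)⁻¹ = J * (gram g x)⁻¹ * Jᵀ := by
    have hJt : IsUnit (Jᵀ).det := by rwa [Matrix.det_transpose]
    rw [hG, Matrix.mul_inv_rev, Matrix.mul_inv_rev]
    simp only [Matrix.mul_assoc]
    rw [Matrix.nonsing_inv_mul _ hJt, Matrix.mul_one, ← Matrix.mul_assoc,
      Matrix.mul_nonsing_inv _ hJi, Matrix.one_mul]
  have hb : ∀ (A : TangentSpace I x →L[ℝ] F) (i : Fin n), A (basisVec I x i) =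
      ∑ k, J k i • A (L (EuclideanSpace.single k 1)) := fun A i => by
    have := clm_single (A.comp L) D i
    rw [ContinuousLinearMap.comp_apply] at this
    change A (L (L' (basisVec I x i))) = _ at this
    rw [hL] at this
    exact this
  rw [pair, hGi]
  simp_rw [hb, map_sum_smul₂]
  exact sum_smul_sum_congruence J _ _

/-- In an orthonormal frame the pairing is the sum over the frame. -/
lemma exists_orthonormal_frame (g : Metric I M) (x : M) :
    ∃ e : Fin n → TangentSpace I x, ∀ (F K : Type) [AddCommGroup F] [Module ℝ F]
      [TopologicalSpace F] [AddCommGroup K] [Module ℝ K] (b : F →ₗ[ℝ] F →ₗ[ℝ] K)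
      (A B : TangentSpace I x →L[ℝ] F),
      pair g x (fun v w => b v w) A B = ∑ α, b (A (e α)) (B (e α)) := by
  have hP : (gram g x).PosDef := by
    rw [gram_eq_gramOf]; exact gramOf_posDef g x fun _ _ h => h
  obtain ⟨C, hC, hP⟩ := exists_isUnit_transpose_mul_self hP
  refine ⟨fun α => ∑ i, C⁻¹ i α • basisVec I x i, fun F K _ _ _ _ _ b A B => ?_⟩
  have h1 : (gram g x)⁻¹ = C⁻¹ * 1 * (C⁻¹)ᵀ := by
    rw [hP, Matrix.mul_inv_rev, Matrix.mul_one, Matrix.transpose_nonsing_inv]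
  rw [pair, h1, ← sum_smul_sum_congruence]
  refine Finset.sum_congr rfl fun α _ => ?_
  rw [Finset.sum_eq_single α]
  · have hsum : ∀ A : TangentSpace I x →L[ℝ] F, A (∑ i, C⁻¹ i α • basisVec I x i) =
        ∑ i, C⁻¹ i α • A (basisVec I x i) := fun A => by
      rw [map_sum]
      exact Finset.sum_congr rfl fun i _ => by rw [map_smul]
    rw [Matrix.one_apply_eq, one_smul, hsum, hsum, map_sum_smul₂]
  · intro β _ hβ
    rw [Matrix.one_apply_ne' hβ, zero_smul]
  · intro h; exact absurd (Finset.mem_univ α) h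

variable (I) in
/-- The frame of `T_x M` given by the chart at `x₀`. -/
def chartFrame (x₀ x : M) : EuclideanSpace ℝ (Fin n) →L[ℝ] TangentSpace I x :=
  (trivializationAt (EuclideanSpace ℝ (Fin n)) (TangentSpace I) x₀).symmL ℝ x

variable (I) in
/-- The coordinates on `T_x M` given by the chart at `x₀`. -/
def chartCoframe (x₀ x : M) : TangentSpace I x →L[ℝ] EuclideanSpace ℝ (Fin n) :=
  (trivializationAt (EuclideanSpace ℝ (Fin n)) (TangentSpace I) x₀).continuousLinearMapAt ℝ x

lemma chartFrame_chartCoframe {x₀ x : M} (hx : x ∈ (extChartAt I x₀).source)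
    (t : TangentSpace I x) : chartFrame I x₀ x (chartCoframe I x₀ x t) = t :=
  Bundle.Trivialization.symmL_continuousLinearMapAt _ (by simpa using hx) t

lemma chartCoframe_chartFrame {x₀ x : M} (hx : x ∈ (extChartAt I x₀).source)
    (v : EuclideanSpace ℝ (Fin n)) : chartCoframe I x₀ x (chartFrame I x₀ x v) = v :=
  Bundle.Trivialization.continuousLinearMapAt_symmL _ (by simpa using hx) v

lemma chartInvD_eq_chartFrame {x₀ : M} {y : EuclideanSpace ℝ (Fin n)}
    (hy : y ∈ (extChartAt I x₀).target) :
    chartInvD I x₀ y = chartFrame I x₀ ((extChartAt I x₀).symm y) := by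
  have hx : (extChartAt I x₀).symm y ∈ (chartAt H x₀).source := by
    simpa using (extChartAt I x₀).map_target hy
  have h := TangentBundle.symmL_trivializationAt (I := I) (𝕜 := ℝ) hx
  rw [(extChartAt I x₀).right_inv hy] at h
  exact h.symm

lemma chartGram_eq_gramOf (g : Metric I M) {x₀ : M} {y : EuclideanSpace ℝ (Fin n)}
    (hy : y ∈ (extChartAt I x₀).target) :
    chartGram g x₀ y = gramOf g _ (chartFrame I x₀ ((extChartAt I x₀).symm y)) := by
  rw [← chartInvD_eq_chartFrame hy]; rfl

lemma continuousOn_inner_chartFrame (g : Metric I M) (x₀ : M) (v w : EuclideanSpace ℝ (Fin n)) :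
    ContinuousOn (fun x => g.inner x (chartFrame I x₀ x v) (chartFrame I x₀ x w))
      (extChartAt I x₀).source := by
  have hsec : ∀ v, ContMDiffOn I (I.prod 𝓘(ℝ, EuclideanSpace ℝ (Fin n))) 0
      (fun x => Bundle.TotalSpace.mk' (EuclideanSpace ℝ (Fin n)) (E := TangentSpace I) x
        (chartFrame I x₀ x v)) (extChartAt I x₀).source := fun v => by
    rw [contMDiffOn_zero_iff]
    set e := trivializationAt (EuclideanSpace ℝ (Fin n)) (TangentSpace I : M → Type _) x₀
    have h1 : ContinuousOn (fun x => e.toOpenPartialHomeomorph.symm (x, v))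
        (extChartAt I x₀).source :=
      e.toOpenPartialHomeomorph.continuousOn_symm.comp (by fun_prop) fun x hx => by
        rw [Bundle.Trivialization.target_eq]
        exact ⟨by simpa [e] using hx, Set.mem_univ _⟩
    refine h1.congr fun x hx => ?_
    have hb : x ∈ e.baseSet := by simpa [e] using hx
    have h2 := Bundle.Trivialization.mk_symm e hb v
    rw [← Bundle.Trivialization.symmL_apply (R := ℝ) e hb] at h2
    exact h2
  have hg : ContMDiffOn I (I.prod 𝓘(ℝ, EuclideanSpace ℝ (Fin n) →L[ℝ]
      EuclideanSpace ℝ (Fin n) →L[ℝ] ℝ)) 0 (fun b ↦ Bundle.TotalSpace.mk' (EuclideanSpace ℝ (Fin n)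
        →L[ℝ] EuclideanSpace ℝ (Fin n) →L[ℝ] ℝ)
        (E := fun x : M => TangentSpace I x →L[ℝ] TangentSpace I x →L[ℝ] ℝ) b (g.inner b))
      (extChartAt I x₀).source := (g.contMDiff.of_le (by simp)).contMDiffOn
  have h := ContMDiffOn.clm_bundle_apply₂ (F₁ := EuclideanSpace ℝ (Fin n))
    (F₂ := EuclideanSpace ℝ (Fin n)) (F₃ := ℝ) (E₃ := Bundle.Trivial M ℝ) hg (hsec v) (hsec w)
  intro x hx
  have hx' := h x hx
  rw [Bundle.contMDiffWithinAt_totalSpace] at hx'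
  exact hx'.2.continuousWithinAt

end Frames

/-! ### The Riemannian volume in charts -/

section Volume

variable {n : ℕ} {H : Type*} [TopologicalSpace H]
  {I : ModelWithCorners ℝ (EuclideanSpace ℝ (Fin n)) H}
  {M : Type*} [TopologicalSpace M] [ChartedSpace H M]

lemma measurableSet_extChartAt_target (x₀ : M) : MeasurableSet (extChartAt I x₀).target := by
  rw [extChartAt_target]
  exact ((chartAt H x₀).open_target.preimage I.continuous_symm).measurableSet.inter
    I.isClosed_range.measurableSet

/-- Up to a null set the target of a chart is open, because the boundary of a convex set is a null
set. -/
lemma ae_mem_interior (x₀ : M) {U : Set M} (hU : IsOpen U) :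
    ∀ᵐ y ∂(volume.restrict ((extChartAt I x₀).target ∩ (extChartAt I x₀).symm ⁻¹' U)),
      y ∈ interior ((extChartAt I x₀).target ∩ (extChartAt I x₀).symm ⁻¹' U) := by
  obtain ⟨W, hW, hWU⟩ := (continuousOn_iff'.1 (continuousOn_extChartAt_symm (I := I) x₀)) U hU
  set W' := I.symm ⁻¹' (chartAt H x₀).target ∩ W with hW'
  have hW'o : IsOpen W' := ((chartAt H x₀).open_target.preimage I.continuous_symm).inter hW
  have hT : (extChartAt I x₀).target ∩ (extChartAt I x₀).symm ⁻¹' U = Set.range I ∩ W' := by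
    rw [Set.inter_comm, hWU, extChartAt_target, hW']
    ext y; simp only [Set.mem_inter_iff]; tauto
  rw [hT]
  have hnull : volume (frontier (Set.range I)) = 0 := I.convex_range.addHaar_frontier volume
  have hms : MeasurableSet (Set.range I ∩ W') :=
    I.isClosed_range.measurableSet.inter hW'o.measurableSet
  rw [ae_restrict_iff' hms]
  have : ∀ᵐ y ∂(volume : Measure (EuclideanSpace ℝ (Fin n))), y ∉ frontier (Set.range I) :=
    measure_eq_zero_iff_ae_notMem.1 hnull
  filter_upwards [this] with y hy hyT
  rw [interior_inter, hW'o.interior_eq]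
  refine ⟨?_, hyT.2⟩
  by_contra hc
  exact hy ⟨subset_closure hyT.1, hc⟩

lemma measurableSet_target_inter_preimage [MeasurableSpace M] [BorelSpace M] (x₀ : M)
    {A : Set M} (hA : MeasurableSet A) :
    MeasurableSet ((extChartAt I x₀).target ∩ (extChartAt I x₀).symm ⁻¹' A) := by
  have hc := (continuousOn_extChartAt_symm (I := I) x₀).domRestrict.measurable hA
  have := (MeasurableEmbedding.subtype_coe
    (measurableSet_extChartAt_target (I := I) x₀)).measurableSet_image.2 hc
  rwa [Set.domRestrict_eq, Set.preimage_comp, Subtype.image_preimage_coe] at this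

lemma aemeasurable_extChartAt_symm [MeasurableSpace M] [BorelSpace M] (x₀ : M) :
    AEMeasurable (extChartAt I x₀).symm (volume.restrict (extChartAt I x₀).target) :=
  (continuousOn_extChartAt_symm x₀).aemeasurable (measurableSet_extChartAt_target x₀)

variable [IsManifold I ∞ M]

lemma continuousOn_gramOf_chartFrame (g : Metric I M) (x₀ : M) :
    ContinuousOn (fun x => gramOf g x (chartFrame I x₀ x)) (extChartAt I x₀).source :=
  continuousOn_pi.2 fun _ => continuousOn_pi.2 fun _ => continuousOn_inner_chartFrame g x₀ _ _

lemma gramOf_chartFrame_posDef (g : Metric I M) {x₀ x : M} (hx : x ∈ (extChartAt I x₀).source) :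
    (gramOf g x (chartFrame I x₀ x)).PosDef :=
  gramOf_posDef g x (Function.LeftInverse.injective (chartCoframe_chartFrame hx))

lemma hasFDerivWithinAt_transition {x₀ x₁ : M} {y : EuclideanSpace ℝ (Fin n)}
    (hy : y ∈ (extChartAt I x₀).target)
    (hy₁ : (extChartAt I x₀).symm y ∈ (extChartAt I x₁).source) :
    HasFDerivWithinAt (extChartAt I x₁ ∘ (extChartAt I x₀).symm)
      ((chartCoframe I x₁ ((extChartAt I x₀).symm y)).comp
        (chartFrame I x₀ ((extChartAt I x₀).symm y))) (Set.range I) y := by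
  have h1 : (extChartAt I x₀).symm y ∈ (chartAt H x₁).source := by simpa using hy₁
  have hm1 := (mdifferentiableAt_extChartAt (I := I) h1).hasMFDerivAt
  have hm0 := (mdifferentiableWithinAt_extChartAt_symm (I := I) hy).hasMFDerivWithinAt
  have h := hm1.comp_hasMFDerivWithinAt y hm0
  rw [hasMFDerivWithinAt_iff_hasFDerivWithinAt] at h
  rw [chartCoframe, TangentBundle.continuousLinearMapAt_trivializationAt h1,
    ← chartInvD_eq_chartFrame hy]
  exact h

/-- The density of the Riemannian volume with respect to the coordinates given by the chart at
`x₀`. -/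
def volDensity (g : Metric I M) (x₀ x : M) : ENNReal :=
  ENNReal.ofReal (Real.sqrt (gramOf g x (chartFrame I x₀ x)).det)

lemma volDensity_eq_mul (g : Metric I M) {x₀ x₁ x : M} (hx₁ : x ∈ (extChartAt I x₁).source) :
    volDensity g x₀ x = ENNReal.ofReal |((chartCoframe I x₁ x).comp (chartFrame I x₀ x)).det| *
      volDensity g x₁ x := by
  have hc : chartFrame I x₀ x = (chartFrame I x₁ x).comp
      ((chartCoframe I x₁ x).comp (chartFrame I x₀ x)) := by
    ext1 v
    exact (chartFrame_chartCoframe hx₁ _).symm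
  rw [volDensity, volDensity, ← ENNReal.ofReal_mul (abs_nonneg _)]
  congr 1
  conv_lhs => rw [hc, gramOf_comp, Matrix.det_mul, Matrix.det_mul, Matrix.det_transpose,
    det_stdMatrix]
  rw [← Real.sqrt_sq_eq_abs, ← Real.sqrt_mul (sq_nonneg _)]
  congr 1
  ring

variable [MeasurableSpace M] [BorelSpace M]

lemma chartVolume_apply (g : Metric I M) (x₀ : M) {A : Set M} (hA : MeasurableSet A) :
    chartVolume g x₀ A = ∫⁻ y in (extChartAt I x₀).target ∩ (extChartAt I x₀).symm ⁻¹' A,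
      volDensity g x₀ ((extChartAt I x₀).symm y) := by
  rw [chartVolume, Measure.map_apply_of_aemeasurable
    ((aemeasurable_extChartAt_symm x₀).mono_ac (withDensity_absolutelyContinuous _ _)) hA,
    withDensity_apply', Measure.restrict_restrict' (measurableSet_extChartAt_target x₀),
    Set.inter_comm]
  refine setLIntegral_congr_fun (measurableSet_target_inter_preimage x₀ hA) fun y hy => ?_
  rw [volDensity, chartGram_eq_gramOf g hy.1]

/-- The volume measures of two charts agree on the overlap. -/
lemma chartVolume_overlap_le (g : Metric I M) (x₀ x₁ : M) {A : Set M} (hA : MeasurableSet A) :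
    chartVolume g x₁ (A ∩ (extChartAt I x₀).source) ≤ chartVolume g x₀ A := by
  have ho : ∀ z : M, MeasurableSet (extChartAt I z).source := fun z =>
    (isOpen_extChartAt_source z).measurableSet
  rw [chartVolume_apply g x₁ (hA.inter (ho x₀)), chartVolume_apply g x₀ hA]
  set S := (extChartAt I x₀).target ∩ (extChartAt I x₀).symm ⁻¹' (A ∩ (extChartAt I x₁).source)
  have hS : MeasurableSet S := measurableSet_target_inter_preimage x₀ (hA.inter (ho x₁))
  set τ := extChartAt I x₁ ∘ (extChartAt I x₀).symm with hτ
  have himg : (extChartAt I x₁).target ∩ (extChartAt I x₁).symm ⁻¹' (A ∩ (extChartAt I x₀).source)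
      = τ '' S := by
    ext z
    constructor
    · rintro ⟨hz, hzA, hz0⟩
      refine ⟨extChartAt I x₀ ((extChartAt I x₁).symm z),
        ⟨(extChartAt I x₀).map_source hz0, ?_⟩, ?_⟩
      · rw [Set.mem_preimage, (extChartAt I x₀).left_inv hz0]
        exact ⟨hzA, (extChartAt I x₁).map_target hz⟩
      · rw [hτ, Function.comp_apply, (extChartAt I x₀).left_inv hz0, (extChartAt I x₁).right_inv hz]
    · rintro ⟨y, ⟨hy, hyA, hy1⟩, rfl⟩
      refine ⟨(extChartAt I x₁).map_source hy1, ?_⟩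
      rw [hτ, Function.comp_apply, Set.mem_preimage, (extChartAt I x₁).left_inv hy1]
      exact ⟨hyA, (extChartAt I x₀).map_target hy⟩
  have hinj : Set.InjOn τ S := fun y hy y' hy' h => by
    have h' := (extChartAt I x₁).injOn hy.2.2 hy'.2.2 h
    exact (extChartAt I x₀).symm.injOn hy.1 hy'.1 h'
  rw [himg, lintegral_image_eq_lintegral_abs_det_fderiv_mul volume hS
    (fun y hy => (hasFDerivWithinAt_transition (x₁ := x₁) hy.1 hy.2.2).mono
      (Set.inter_subset_left.trans (extChartAt_target_subset_range x₀))) hinj]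
  have h1 : ∫⁻ y in S, ENNReal.ofReal |((chartCoframe I x₁ ((extChartAt I x₀).symm y)).comp
        (chartFrame I x₀ ((extChartAt I x₀).symm y))).det| *
        volDensity g x₁ ((extChartAt I x₁).symm (τ y)) =
      ∫⁻ y in S, volDensity g x₀ ((extChartAt I x₀).symm y) := by
    refine setLIntegral_congr_fun hS fun y hy => ?_
    simp only
    rw [hτ, Function.comp_apply, (extChartAt I x₁).left_inv hy.2.2]
    exact (volDensity_eq_mul g hy.2.2).symm
  rw [h1]
  exact lintegral_mono_set fun y hy => ⟨hy.1, hy.2.1⟩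

/-- On the domain of a chart the Riemannian volume measure is the one of the chart. -/
lemma riemVolume_restrict_le (g : Metric I M) (x₀ : M) :
    (riemVolume g).restrict (extChartAt I x₀).source ≤ chartVolume g x₀ := by
  have ho : MeasurableSet (extChartAt I x₀).source := (isOpen_extChartAt_source x₀).measurableSet
  -- the right-hand side dominates every chart volume, and the Riemannian volume is their supremum
  have hle : riemVolume g ≤ chartVolume g x₀ +
      (riemVolume g).restrict ((extChartAt I x₀).source)ᶜ := by
    refine iSup_le fun x₁ => Measure.le_iff.2 fun A hA => ?_
    rw [Measure.add_apply, Measure.restrict_apply hA, ← measure_inter_add_sdiff A ho]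
    refine add_le_add (chartVolume_overlap_le g x₀ x₁ hA) ?_
    exact le_iSup (fun x => chartVolume g x) x₁ _
  refine Measure.le_iff.2 fun A hA => ?_
  rw [Measure.restrict_apply hA]
  refine (hle _).trans ?_
  rw [Measure.add_apply, Measure.restrict_apply (hA.inter ho), Set.inter_assoc,
    Set.inter_compl_self, Set.inter_empty, measure_empty, add_zero]
  exact measure_mono Set.inter_subset_left

lemma aemeasurable_extChartAt_riemVolume (g : Metric I M) (x₀ : M) {U : Set M}
    (hU : U ⊆ (extChartAt I x₀).source) (hUm : MeasurableSet U) :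
    AEMeasurable (extChartAt I x₀) ((riemVolume g).restrict U) :=
  ((continuousOn_extChartAt x₀).mono hU).aemeasurable hUm

/-- In the coordinates of a chart the Riemannian volume is absolutely continuous with respect to
Lebesgue measure. -/
lemma map_riemVolume_absolutelyContinuous (g : Metric I M) (x₀ : M) {U : Set M} (hU : IsOpen U)
    (hUs : U ⊆ (extChartAt I x₀).source) :
    ((riemVolume g).restrict U).map (extChartAt I x₀) ≪
      volume.restrict (interior ((extChartAt I x₀).target ∩ (extChartAt I x₀).symm ⁻¹' U)) := by
  refine Measure.AbsolutelyContinuous.mk fun N hN hN0 => ?_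
  have hae := aemeasurable_extChartAt_riemVolume g x₀ hUs hU.measurableSet
  rw [Measure.map_apply_of_aemeasurable hae hN]
  set T := (extChartAt I x₀).target ∩ (extChartAt I x₀).symm ⁻¹' U
  have hmeas : MeasurableSet (U ∩ extChartAt I x₀ ⁻¹' N) := by
    have hc := ((continuousOn_extChartAt (I := I) x₀).mono hUs).domRestrict.measurable hN
    have := (MeasurableEmbedding.subtype_coe hU.measurableSet).measurableSet_image.2 hc
    rwa [Set.domRestrict_eq, Set.preimage_comp, Subtype.image_preimage_coe] at this
  have hNT : volume (N ∩ T) = 0 := by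
    have h1 : volume (N ∩ interior T) = 0 := by rwa [Measure.restrict_apply hN] at hN0
    have hTm : MeasurableSet T := measurableSet_target_inter_preimage x₀ hU.measurableSet
    have h2 : volume ((interior T)ᶜ ∩ T) = 0 := by
      have h3 := ae_mem_interior (I := I) x₀ hU
      rw [ae_iff, Measure.restrict_apply' hTm] at h3
      exact h3
    refine measure_mono_null (fun y hy => ?_) (measure_union_null h1 h2)
    by_cases h : y ∈ interior T
    · exact Or.inl ⟨hy.1, h⟩
    · exact Or.inr ⟨h, hy.2⟩
  have hle : (riemVolume g).restrict U (extChartAt I x₀ ⁻¹' N) ≤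
      chartVolume g x₀ (U ∩ extChartAt I x₀ ⁻¹' N) := by
    rw [Measure.restrict_apply' hU.measurableSet, Set.inter_comm]
    calc riemVolume g (U ∩ extChartAt I x₀ ⁻¹' N) =
        (riemVolume g).restrict (extChartAt I x₀).source (U ∩ extChartAt I x₀ ⁻¹' N) := by
          rw [Measure.restrict_apply hmeas,
            Set.inter_eq_left.2 (Set.inter_subset_left.trans hUs)]
      _ ≤ _ := riemVolume_restrict_le g x₀ _
  refine nonpos_iff_eq_zero.1 (hle.trans ?_)
  rw [chartVolume_apply g x₀ hmeas]
  refine (setLIntegral_measure_zero _ _ (measure_mono_null (fun y hy => ?_) hNT)).le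
  refine ⟨?_, hy.1, hy.2.1⟩
  have := hy.2.2
  rwa [Set.mem_preimage, (extChartAt I x₀).right_inv hy.1] at this

/-- Near each point the volume is that of a chart, with a bounded density and a bounded image. -/
instance [CompactSpace M] (g : Metric I M) : IsFiniteMeasure (riemVolume g) := by
  have hloc : ∀ x₀ : M, ∃ U ∈ nhds x₀, riemVolume g U < ⊤ := fun x₀ => by
    have hs := isOpen_extChartAt_source (I := I) x₀
    have hx₀ := mem_extChartAt_source (I := I) x₀
    have hcd : ContinuousOn (fun x => (gramOf g x (chartFrame I x₀ x)).det)
        (extChartAt I x₀).source :=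
      continuous_id.matrix_det.comp_continuousOn (continuousOn_gramOf_chartFrame g x₀)
    set C := (gramOf g x₀ (chartFrame I x₀ x₀)).det + 1
    have h1 := (hcd.continuousAt (hs.mem_nhds hx₀)).preimage_mem_nhds
      (Iio_mem_nhds (lt_add_one _))
    have h2 := (continuousAt_extChartAt (I := I) x₀).preimage_mem_nhds
      (Metric.ball_mem_nhds _ one_pos)
    obtain ⟨U, hUs, hUo, hxU⟩ := mem_nhds_iff.1
      (Filter.inter_mem (hs.mem_nhds hx₀) (Filter.inter_mem h1 h2))
    refine ⟨U, hUo.mem_nhds hxU, ?_⟩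
    have hle : riemVolume g U ≤ chartVolume g x₀ U := by
      calc riemVolume g U = (riemVolume g).restrict (extChartAt I x₀).source U := by
            rw [Measure.restrict_apply hUo.measurableSet,
              Set.inter_eq_left.2 fun x hx => (hUs hx).1]
        _ ≤ _ := riemVolume_restrict_le g x₀ _
    refine hle.trans_lt ?_
    rw [chartVolume_apply g x₀ hUo.measurableSet]
    calc ∫⁻ y in (extChartAt I x₀).target ∩ (extChartAt I x₀).symm ⁻¹' U,
          volDensity g x₀ ((extChartAt I x₀).symm y)
        ≤ ∫⁻ _ in (extChartAt I x₀).target ∩ (extChartAt I x₀).symm ⁻¹' U,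
          ENNReal.ofReal (Real.sqrt C) := by
          refine setLIntegral_mono' (measurableSet_target_inter_preimage x₀ hUo.measurableSet)
            fun y hy => ENNReal.ofReal_le_ofReal (Real.sqrt_le_sqrt ?_)
          exact (hUs hy.2).2.1.le
      _ = ENNReal.ofReal (Real.sqrt C) *
          volume ((extChartAt I x₀).target ∩ (extChartAt I x₀).symm ⁻¹' U) :=
          setLIntegral_const _ _
      _ < ⊤ := by
          refine ENNReal.mul_lt_top ENNReal.ofReal_lt_top
            ((measure_mono fun y hy => ?_).trans_lt
              (measure_ball_lt_top (x := extChartAt I x₀ x₀) (r := 1)))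
          have := (hUs hy.2).2.2
          rwa [Set.mem_preimage, (extChartAt I x₀).right_inv hy.1] at this
  refine ⟨?_⟩
  refine isCompact_univ.measure_lt_top_of_nhdsWithin fun x _ => ?_
  rw [nhdsWithin_univ]
  exact hloc x

end Volume

/-! ### Weak differentials of sections -/

section WeakDifferential

lemma locallyIntegrableOn_pi {X ι : Type*} [Fintype ι] [TopologicalSpace X] [MeasurableSpace X]
    {μ : Measure X} {O : Set X} {f : X → ι → ℝ} :
    LocallyIntegrableOn f O μ ↔ ∀ a, LocallyIntegrableOn (fun y => f y a) O μ := by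
  constructor
  · intro h a x hx
    obtain ⟨s, hs, hf⟩ := h x hx
    exact ⟨s, hs, Integrable.eval hf a⟩
  · intro h x hx
    choose s hs hf using fun a => h a x hx
    exact ⟨⋂ a, s a, Filter.iInter_mem.2 hs, Integrable.of_eval fun a =>
      (hf a).mono_set (Set.iInter_subset s a)⟩

lemma locallyIntegrableOn_congr_set {X : Type*} [TopologicalSpace X] [MeasurableSpace X]
    {μ : Measure X} {O : Set X} {f f' : X → ℝ} (h : LocallyIntegrableOn f O μ)
    (hO : MeasurableSet O) (hf : ∀ y ∈ O, f y = f' y) : LocallyIntegrableOn f' O μ := by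
  intro x hx
  obtain ⟨s, hs, hi⟩ := h x hx
  refine ⟨s ∩ O, Filter.inter_mem hs self_mem_nhdsWithin, ?_⟩
  refine Integrable.congr (hi.mono_set Set.inter_subset_left) ?_
  filter_upwards [ae_restrict_of_ae_restrict_of_subset Set.inter_subset_right
    (ae_restrict_mem hO)] with y hy
  exact hf y hy

lemma HasWeakDeriv.congr {E : Type*} [NormedAddCommGroup E] [NormedSpace ℝ E] [MeasurableSpace E]
    {μ : Measure E} {O : Set E} {w : E} {f h f' h' : E → ℝ} (H : HasWeakDeriv μ O w f h)
    (hO : MeasurableSet O) (hf : ∀ y ∈ O, f y = f' y) (hh : ∀ y ∈ O, h y = h' y) :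
    HasWeakDeriv μ O w f' h' where
  locInt := locallyIntegrableOn_congr_set H.locInt hO hf
  locInt_deriv := locallyIntegrableOn_congr_set H.locInt_deriv hO hh
  integral_eq ζ hζ hc hs := by
    have e1 : ∀ y, fderiv ℝ ζ y w * f' y = fderiv ℝ ζ y w * f y := fun y => by
      by_cases hy : y ∈ tsupport ζ
      · rw [hf y (hs hy)]
      · have h2 : fderiv ℝ ζ y w = 0 := image_eq_zero_of_notMem_tsupport
          (f := fun y => fderiv ℝ ζ y w) (fun h => hy (tsupport_fderiv_apply_le w h))
        rw [h2, zero_mul, zero_mul]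
    have e2 : ∀ y, ζ y * h' y = ζ y * h y := fun y => by
      by_cases hy : y ∈ tsupport ζ
      · rw [hh y (hs hy)]
      · rw [image_eq_zero_of_notMem_tsupport hy, zero_mul, zero_mul]
    simp_rw [e1, e2]
    exact H.integral_eq ζ hζ hc hs

variable {n m : ℕ} {H : Type*} [TopologicalSpace H]
  {I : ModelWithCorners ℝ (EuclideanSpace ℝ (Fin n)) H}
  {M : Type*} [TopologicalSpace M] [ChartedSpace H M]

variable (I) in
/-- The interior, in the coordinates of the chart at `x₀`, of the part of `U` in that chart. -/
def chartInterior (x₀ : M) (U : Set M) : Set (EuclideanSpace ℝ (Fin n)) :=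
  interior ((extChartAt I x₀).target ∩ (extChartAt I x₀).symm ⁻¹' U)

lemma isOpen_chartInterior (x₀ : M) (U : Set M) : IsOpen (chartInterior I x₀ U) := isOpen_interior

lemma mem_target_of_mem_chartInterior {x₀ : M} {U : Set M} {y : EuclideanSpace ℝ (Fin n)}
    (hy : y ∈ chartInterior I x₀ U) : y ∈ (extChartAt I x₀).target := (interior_subset hy).1

lemma symm_mem_of_mem_chartInterior {x₀ : M} {U : Set M} {y : EuclideanSpace ℝ (Fin n)}
    (hy : y ∈ chartInterior I x₀ U) : (extChartAt I x₀).symm y ∈ U := (interior_subset hy).2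

lemma hasWeakDifferentialOn_iff {U : Set M} {f : M → Mink m}
    {η : (x : M) → (TangentSpace I x →L[ℝ] Mink m)} :
    HasWeakDifferentialOn U f η ↔ ∀ x₀ w a, HasWeakDeriv volume (chartInterior I x₀ U) w
      (fun y => f ((extChartAt I x₀).symm y) a)
      (fun y => η ((extChartAt I x₀).symm y) (chartInvD I x₀ y w) a) := by
  constructor
  · intro h x₀ w a
    obtain ⟨h1, h2, h3⟩ := h x₀ _ rfl
    have h1' := locallyIntegrableOn_pi.1 h1
    have h2' := locallyIntegrableOn_pi.1 (h2 w)
    refine ⟨h1' a, h2' a, fun ζ hζ hc hs => ?_⟩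
    have h4 := congrFun (h3 ζ hζ hc hs w) a
    rw [Pi.neg_apply, eval_integral fun a => ?_, eval_integral fun a => ?_] at h4
    · exact h4
    · exact integrable_mul_of_locallyIntegrableOn (h2' a) hζ.continuous hc hs
    · exact integrable_mul_of_locallyIntegrableOn (h1' a) (contDiff_fderiv_apply hζ w).continuous
        (hasCompactSupport_fderiv_apply hc w) ((tsupport_fderiv_apply_le w).trans hs)
  · rintro h x₀ O rfl
    refine ⟨locallyIntegrableOn_pi.2 fun a => (h x₀ 0 a).locInt, fun w =>
      locallyIntegrableOn_pi.2 fun a => (h x₀ w a).locInt_deriv, fun ζ hζ hc hs w => ?_⟩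
    funext a
    rw [Pi.neg_apply, eval_integral fun a => ?_, eval_integral fun a => ?_]
    · exact (h x₀ w a).integral_eq ζ hζ hc hs
    · exact integrable_mul_of_locallyIntegrableOn (h x₀ w a).locInt_deriv hζ.continuous hc hs
    · exact integrable_mul_of_locallyIntegrableOn (h x₀ w a).locInt
        (contDiff_fderiv_apply hζ w).continuous
        (hasCompactSupport_fderiv_apply hc w) ((tsupport_fderiv_apply_le w).trans hs)

variable {Γ : Subgroup (SOplus m)} {u : M → HypMfd Γ} {φ : M → Hyp m → Matrix (Idx m) (Idx m) ℝ}
  {du : (x : M) → Hyp m → (TangentSpace I x →L[ℝ] Mink m)} {U : Set M} {v : M → Hyp m}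

/-- The signs of the Lorentzian inner product. -/
def minkSign : Idx m → ℝ := Sum.elim (fun _ => 1) (fun _ => -1)

lemma mink_eq_sum_minkSign (X Y : Mink m) : mink X Y = ∑ a, minkSign a * (X a * Y a) := by
  rw [mink_eq, Fintype.sum_sum_type]
  simp [minkSign, sub_eq_add_neg]

lemma continuousOn_lift_chart (hv : IsLocalLift u U v) (x₀ : M) :
    ContinuousOn (fun y => (v ((extChartAt I x₀).symm y)).1)
      ((extChartAt I x₀).target ∩ (extChartAt I x₀).symm ⁻¹' U) :=
  continuous_subtype_val.comp_continuousOn (hv.continuousOn.comp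
    ((continuousOn_extChartAt_symm x₀).mono Set.inter_subset_left) fun _ hy => hy.2)

/-- The weak differential of `u` is tangent to hyperbolic space, almost everywhere in a chart: it
is the weak differential of the constant `(u, u)^♯ = -1`. -/
lemma ae_mink_eq_zero_chart (hv : IsLocalLift u U v)
    (hdu : HasWeakDifferentialOn U (fun x => (v x).1) fun x => du x (v x)) (x₀ : M)
    (w : EuclideanSpace ℝ (Fin n)) :
    ∀ᵐ y ∂(volume : Measure (EuclideanSpace ℝ (Fin n))), y ∈ chartInterior I x₀ U →
      mink (du ((extChartAt I x₀).symm y) (v ((extChartAt I x₀).symm y)) (chartInvD I x₀ y w))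
        (v ((extChartAt I x₀).symm y)).1 = 0 := by
  have hO := isOpen_chartInterior (I := I) x₀ U
  have hd := hasWeakDifferentialOn_iff.1 hdu x₀ w
  have hc := (continuousOn_lift_chart (I := I) hv x₀).mono interior_subset
  have hsum := HasWeakDeriv.sum Finset.univ fun a _ =>
    (((hd a).sq hO (continuousOn_pi.1 hc a)).const_mul hO (minkSign a))
  have h0 := hsum.ae_eq_zero_of_const hO (c := -1) fun y hy => by
    have h := (v ((extChartAt I x₀).symm y)).2.1
    rw [mink_eq_sum_minkSign] at h
    simpa only [sq] using h
  filter_upwards [h0] with y hy hyO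
  have h := hy hyO
  have h2 : (2 : ℝ) * mink (du ((extChartAt I x₀).symm y) (v ((extChartAt I x₀).symm y))
      (chartInvD I x₀ y w)) (v ((extChartAt I x₀).symm y)).1 = 0 := by
    rw [← h, mink_eq_sum_minkSign, Finset.mul_sum]
    exact Finset.sum_congr rfl fun a _ => by ring
  linarith

variable [IsManifold I ∞ M]

/-- The weak differential of `φ u` is `(dφ) u + φ du`. -/
lemma hasWeakDifferentialOn_mulVec (hΓ : IsHyperbolicGroup Γ) (hφ : IsSmoothAdSection I u φ)
    (hv : IsLocalLift u U v)
    (hdu : HasWeakDifferentialOn U (fun x => (v x).1) fun x => du x (v x))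
    {η : (x : M) → Hyp m → (TangentSpace I x →L[ℝ] Mink m)}
    (hη : ∀ x X t, η x X t = flatD I u φ x X t *ᵥ X.1 + φ x X *ᵥ du x X t) :
    HasWeakDifferentialOn U (fun x => φ x (v x) *ᵥ (v x).1) fun x => η x (v x) := by
  rw [hasWeakDifferentialOn_iff] at hdu ⊢
  intro x₀ w a
  have hO := isOpen_chartInterior (I := I) x₀ U
  have hs : ContDiffOn ℝ ∞ (alongLift φ v ∘ (extChartAt I x₀).symm) (chartInterior I x₀ U) :=
    (hφ.contDiffOn hv x₀).mono interior_subset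
  have hsum := HasWeakDeriv.sum Finset.univ fun b _ =>
    (hdu x₀ w b).smooth_mul hO (contDiffOn_pi.1 (contDiffOn_pi.1 hs a) b)
  refine hsum.congr hO.measurableSet (fun y _ => rfl) fun y hy => ?_
  have hyt := mem_target_of_mem_chartInterior hy
  rw [hη, flatD_chartInvD hΓ hφ hv hyt (symm_mem_of_mem_chartInterior hy), Pi.add_apply,
    Matrix.mulVec, Matrix.mulVec, dotProduct, dotProduct, ← Finset.sum_add_distrib]
  refine Finset.sum_congr rfl fun b _ => ?_
  have hr : Set.range I ∈ nhds y := Filter.mem_of_superset (hO.mem_nhds hy) fun z hz =>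
    extChartAt_target_subset_range x₀ (mem_target_of_mem_chartInterior hz)
  rw [fderivWithin_of_mem_nhds hr]
  have hd : DifferentiableAt ℝ (alongLift φ v ∘ (extChartAt I x₀).symm) y :=
    (hs.contDiffAt (hO.mem_nhds hy)).differentiableAt (by simp)
  have hd' := (hasFDerivAt_pi'.1 (hasFDerivAt_pi'.1 hd.hasFDerivAt a) b).fderiv
  change fderiv ℝ (fun y => (alongLift φ v ∘ (extChartAt I x₀).symm) y a b) y w * _ + _ = _
  rw [hd']
  rfl

end WeakDifferential

/-! ### Almost everywhere statements and measurability in charts -/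

section Transfer

variable {n : ℕ} {H : Type*} [TopologicalSpace H]
  {I : ModelWithCorners ℝ (EuclideanSpace ℝ (Fin n)) H}
  {M : Type*} [TopologicalSpace M] [ChartedSpace H M] [IsManifold I ∞ M]
  [MeasurableSpace M] [BorelSpace M]

lemma ae_riemVolume_of_ae_chart (g : Metric I M) (x₀ : M) {U : Set M} (hU : IsOpen U)
    (hUs : U ⊆ (extChartAt I x₀).source) {P : M → Prop}
    (h : ∀ᵐ y ∂(volume : Measure (EuclideanSpace ℝ (Fin n))), y ∈ chartInterior I x₀ U →
      P ((extChartAt I x₀).symm y)) :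
    ∀ᵐ x ∂((riemVolume g).restrict U), P x := by
  have h1 := (map_riemVolume_absolutelyContinuous g x₀ hU hUs).ae_le
    ((ae_restrict_iff' (isOpen_chartInterior x₀ U).measurableSet).2 h)
  have h2 := ae_of_ae_map (aemeasurable_extChartAt_riemVolume g x₀ hUs hU.measurableSet) h1
  filter_upwards [h2, ae_restrict_mem hU.measurableSet] with x hx hxU
  rwa [(extChartAt I x₀).left_inv (hUs hxU)] at hx

lemma aestronglyMeasurable_of_chart (g : Metric I M) (x₀ : M) {U : Set M} (hU : IsOpen U)
    (hUs : U ⊆ (extChartAt I x₀).source) {f : M → ℝ}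
    (h : AEStronglyMeasurable (fun y => f ((extChartAt I x₀).symm y))
      (volume.restrict (chartInterior I x₀ U))) :
    AEStronglyMeasurable f ((riemVolume g).restrict U) := by
  have h1 := (h.mono_ac (map_riemVolume_absolutelyContinuous g x₀ hU hUs)).comp_aemeasurable
    (aemeasurable_extChartAt_riemVolume g x₀ hUs hU.measurableSet)
  refine h1.congr ?_
  filter_upwards [ae_restrict_mem hU.measurableSet] with x hxU
  rw [Function.comp_apply, (extChartAt I x₀).left_inv (hUs hxU)]

/-- A property that holds almost everywhere near each point of a compact space holds almost
everywhere. Compactness replaces the usual second countability. -/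
lemma ae_of_ae_restrict_nhds {X : Type*} [TopologicalSpace X] [CompactSpace X] [MeasurableSpace X]
    [OpensMeasurableSpace X] {μ : Measure X} {P : X → Prop}
    (h : ∀ x, ∃ U, IsOpen U ∧ x ∈ U ∧ ∀ᵐ y ∂(μ.restrict U), P y) : ∀ᵐ y ∂μ, P y := by
  -- `{y | ¬ P y}` need not be compact: restrict the measure to it instead
  have h0 : (μ.restrict {y | ¬ P y}) Set.univ = 0 := by
    refine isCompact_univ.measure_zero_of_nhdsWithin fun x _ => ?_
    obtain ⟨U, hU, hxU, hae⟩ := h x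
    refine ⟨U, mem_nhdsWithin_of_mem_nhds (hU.mem_nhds hxU), ?_⟩
    rw [ae_iff, Measure.restrict_apply' hU.measurableSet] at hae
    rwa [Measure.restrict_apply hU.measurableSet, Set.inter_comm]
  rwa [Measure.restrict_apply_univ] at h0

lemma lintegral_lt_top_of_nhds {X : Type*} [TopologicalSpace X] [CompactSpace X]
    [MeasurableSpace X] [OpensMeasurableSpace X] {μ : Measure X} {F : X → ENNReal}
    (h : ∀ x, ∃ U, IsOpen U ∧ x ∈ U ∧ ∫⁻ y in U, F y ∂μ < ⊤) : ∫⁻ y, F y ∂μ < ⊤ := by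
  have h0 : (μ.withDensity F) Set.univ < ⊤ := by
    refine isCompact_univ.measure_lt_top_of_nhdsWithin fun x _ => ?_
    obtain ⟨U, hU, hxU, hF⟩ := h x
    exact ⟨U, mem_nhdsWithin_of_mem_nhds (hU.mem_nhds hxU), by
      rwa [withDensity_apply _ hU.measurableSet]⟩
  rwa [withDensity_apply _ MeasurableSet.univ, Measure.restrict_univ] at h0

end Transfer

/-! ### The Noether current at a point -/

section Pointwise

variable {n m : ℕ} {H : Type*} [TopologicalSpace H]
  {I : ModelWithCorners ℝ (EuclideanSpace ℝ (Fin n)) H}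
  {M : Type*} [TopologicalSpace M] [ChartedSpace H M] [IsManifold I ∞ M]

/-- The bilinear map `(v, w) ↦ v w^♯`. -/
def vecMulSharpB (m : ℕ) : Mink m →ₗ[ℝ] Mink m →ₗ[ℝ] Matrix (Idx m) (Idx m) ℝ :=
  LinearMap.mk₂ ℝ (fun v w => Matrix.vecMulVec v (sharp w))
    (fun _ _ _ => Matrix.add_vecMulVec _ _ _) (fun _ _ _ => Matrix.smul_vecMulVec _ _ _)
    (fun _ _ _ => by simp only [sharp, Matrix.mulVec_add, Matrix.vecMulVec_add])
    (fun _ _ _ => by simp only [sharp, Matrix.mulVec_smul, Matrix.vecMulVec_smul])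

/-- The trace form `(A, B) ↦ Tr A B`. -/
def traceB (m : ℕ) :
    Matrix (Idx m) (Idx m) ℝ →ₗ[ℝ] Matrix (Idx m) (Idx m) ℝ →ₗ[ℝ] ℝ :=
  LinearMap.mk₂ ℝ (fun A B => (A * B).trace)
    (fun _ _ _ => by rw [Matrix.add_mul, Matrix.trace_add])
    (fun _ _ _ => by rw [Matrix.smul_mul, Matrix.trace_smul])
    (fun _ _ _ => by rw [Matrix.mul_add, Matrix.trace_add])
    (fun _ _ _ => by rw [Matrix.mul_smul, Matrix.trace_smul])

/-- Evaluation of matrices at a vector. -/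
def mulVecAt (X : Mink m) : Matrix (Idx m) (Idx m) ℝ →L[ℝ] Mink m :=
  LinearMap.toContinuousLinearMap
    { toFun := fun B => B *ᵥ X
      map_add' := fun _ _ => Matrix.add_mulVec _ _ _
      map_smul' := fun _ _ => Matrix.smul_mulVec _ _ _ }

/-- A matrix as a continuous linear map. -/
def mulVecL (A : Matrix (Idx m) (Idx m) ℝ) : Mink m →L[ℝ] Mink m :=
  LinearMap.toContinuousLinearMap (Matrix.toLin' A)

lemma Scur_apply (g : Metric I M) (p : ℝ) (x : M) (W : TangentSpace I x →L[ℝ] Mink m)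
    (t : TangentSpace I x) : Scur g p x W t = Qpow g x (p - 2) W *ᵥ W t := rfl

/-- The pairings that occur below, in an orthonormal frame. -/
lemma exists_frame (g : Metric I M) (x : M) : ∃ e : Fin n → TangentSpace I x,
    (∀ W : TangentSpace I x →L[ℝ] Mink m, Qsq g x W = stress fun α => W (e α)) ∧
    (∀ A B : TangentSpace I x →L[ℝ] Mink m,
      pair g x mink A B = ∑ α, mink (A (e α)) (B (e α))) ∧
    (∀ (X : Mink m) (A B : TangentSpace I x →L[ℝ] Mink m),
      pair g x (plusInner X) A B = ∑ α, plusInner X (A (e α)) (B (e α))) ∧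
    ∀ A B : TangentSpace I x →L[ℝ] Matrix (Idx m) (Idx m) ℝ,
      pair g x (fun A B => (A * B).trace) A B = ∑ α, (A (e α) * B (e α)).trace := by
  obtain ⟨e, he⟩ := exists_orthonormal_frame g x
  exact ⟨e, fun W => he _ _ (vecMulSharpB m) W W, fun A B => he _ _ (minkB m) A B,
    fun X A B => he _ _ (plusB X) A B, fun A B => he _ _ (traceB m) A B⟩

lemma pair_plusInner_self_nonneg (g : Metric I M) (x : M) {X : Mink m} (hX : X ∈ hyperboloid m)
    (W : TangentSpace I x →L[ℝ] Mink m) : 0 ≤ pair g x (plusInner X) W W := by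
  obtain ⟨e, -, -, he, -⟩ := exists_frame (m := m) g x
  rw [he]
  exact Finset.sum_nonneg fun α _ => plusInner_self_nonneg hX _

lemma pair_plusInner_add_le (g : Metric I M) (x : M) {X : Mink m} (hX : X ∈ hyperboloid m)
    (A B : TangentSpace I x →L[ℝ] Mink m) :
    pair g x (plusInner X) (A + B) (A + B) ≤
      2 * pair g x (plusInner X) A A + 2 * pair g x (plusInner X) B B := by
  obtain ⟨e, -, -, he, -⟩ := exists_frame (m := m) g x
  rw [he, he, he, Finset.mul_sum, Finset.mul_sum, ← Finset.sum_add_distrib]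
  exact Finset.sum_le_sum fun α _ => plusInner_add_self_le hX _ _

lemma pair_plusInner_mulVecL_le (g : Metric I M) (x : M) {X : Mink m} (hX : X ∈ hyperboloid m)
    (φ : Matrix (Idx m) (Idx m) ℝ) (W : TangentSpace I x →L[ℝ] Mink m) :
    pair g x (plusInner X) ((mulVecL φ).comp W) ((mulVecL φ).comp W) ≤
      ((plusGram X)⁻¹ * φᵀ * plusGram X * φ).trace * pair g x (plusInner X) W W := by
  obtain ⟨e, -, -, he, -⟩ := exists_frame (m := m) g x
  rw [he, he, Finset.mul_sum]
  exact Finset.sum_le_sum fun α _ => plusInner_mulVec_le hX φ _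

variable (g : Metric I M) {x : M} {X : Mink m} {W : TangentSpace I x →L[ℝ] Mink m}

lemma mink_Scur (hW : ∀ t, mink (W t) X = 0) (p : ℝ) (t : TangentSpace I x) :
    mink (Scur g p x W t) X = 0 := by
  obtain ⟨e, hQ, -⟩ := exists_frame (m := m) g x
  rw [Scur_apply, Qpow, hQ]
  exact mink_matFun_stress_mulVec _ (fun α => hW _) _ (hW t)

lemma pair_noetherCurrent {D : TangentSpace I x →L[ℝ] Matrix (Idx m) (Idx m) ℝ}
    (hD : ∀ t, D t ∈ LieAlgebra.Orthogonal.so' (Fin m) (Fin 1) ℝ)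
    (S : TangentSpace I x →L[ℝ] Mink m) :
    pair g x (fun A B => (A * B).trace) ((crossRight X).comp S) D =
      2 * pair g x mink S ((mulVecAt X).comp D) := by
  obtain ⟨e, -, hm, -, ht⟩ := exists_frame (m := m) g x
  rw [ht, hm, Finset.mul_sum]
  exact Finset.sum_congr rfl fun α _ => trace_cross_mul (hD _) _ _

/-- The term with `φ du` does not contribute to the first variation in the direction of `φ u`,
because `Q^{p-2} Q²` is symmetric and `φ` is skew. -/
lemma pair_Scur_tanProj (hW : ∀ t, mink (W t) X = 0) (p : ℝ) {φ : Matrix (Idx m) (Idx m) ℝ}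
    (hφ : φ ∈ LieAlgebra.Orthogonal.so' (Fin m) (Fin 1) ℝ)
    (A : TangentSpace I x →L[ℝ] Mink m) :
    pair g x mink (Scur g p x W) ((tanProjL X).comp (A + (mulVecL φ).comp W)) =
      pair g x mink (Scur g p x W) A := by
  obtain ⟨e, hQ, hm, -⟩ := exists_frame (m := m) g x
  have h0 : ∑ α, mink (Scur g p x W (e α)) (φ *ᵥ W (e α)) = 0 := by
    have := sum_mink_matFun_stress (fun α => W (e α)) (fun t => t ^ ((p - 2) / 2)) hφ
    rw [← hQ] at this
    exact this
  rw [hm, hm, ← add_zero (∑ α, mink (Scur g p x W (e α)) (A (e α))), ← h0,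
    ← Finset.sum_add_distrib]
  refine Finset.sum_congr rfl fun α _ => ?_
  change mink _ (tanProj X (A (e α) + φ *ᵥ W (e α))) = _
  rw [tanProj, mink_add_right, mink_smul_right, mink_Scur g hW, mul_zero, add_zero, mink_add_right]

lemma rpow_half_le_one_add {E p : ℝ} (hE : 0 ≤ E) (hp : 1 < p) :
    E ^ ((p - 1) / 2) ≤ 1 + E ^ (p / 2) := by
  rcases le_total E 1 with h | h
  · have h1 := Real.rpow_le_one hE h (by linarith : 0 ≤ (p - 1) / 2)
    have h2 := Real.rpow_nonneg hE (p / 2)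
    linarith
  · have h1 := Real.rpow_le_rpow_of_exponent_le h (by linarith : (p - 1) / 2 ≤ p / 2)
    linarith

lemma abs_pair_Scur_le (hX : X ∈ hyperboloid m) (hW : ∀ t, mink (W t) X = 0) {p : ℝ} (hp : 1 < p)
    {A : TangentSpace I x →L[ℝ] Mink m} {C : ℝ} (hC : pair g x (plusInner X) A A ≤ C) :
    |pair g x mink (Scur g p x W) A| ≤
      Real.sqrt (Fintype.card (Idx m) * C) * (1 + pair g x (plusInner X) W W ^ (p / 2)) := by
  obtain ⟨e, hQ, hm, hpl, -⟩ := exists_frame (m := m) g x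
  set E := pair g x (plusInner X) W W with hE
  have hE0 : 0 ≤ E := pair_plusInner_self_nonneg g x hX W
  have hA0 := pair_plusInner_self_nonneg g x hX A
  have hS : ∑ α, plusInner X (Scur g p x W (e α)) (Scur g p x W (e α)) ≤
      Fintype.card (Idx m) * E ^ (p - 1) := by
    have := sum_plusInner_matFun_stress_le (fun α => W (e α)) hX (fun α => hW _) hp
    rw [← hQ, ← hpl] at this
    exact this
  have h1 : pair g x mink (Scur g p x W) A = ∑ α, plusInner X (Scur g p x W (e α)) (A (e α)) := by
    rw [hm]
    exact Finset.sum_congr rfl fun α _ => (plusInner_eq_mink (mink_Scur g hW p _) _).symm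
  have h2 : (pair g x mink (Scur g p x W) A) ^ 2 ≤
      (Fintype.card (Idx m) * C) * E ^ (p - 1) := by
    rw [h1]
    refine (sum_plusInner_sq_le hX _ _).trans ?_
    rw [← hpl X A A]
    calc _ ≤ (Fintype.card (Idx m) * E ^ (p - 1)) * C :=
          mul_le_mul hS hC hA0 (by positivity)
      _ = _ := by ring
  have hC0 : 0 ≤ C := hA0.trans hC
  calc |pair g x mink (Scur g p x W) A|
      ≤ Real.sqrt ((Fintype.card (Idx m) * C) * E ^ (p - 1)) := Real.abs_le_sqrt h2
    _ = Real.sqrt (Fintype.card (Idx m) * C) * E ^ ((p - 1) / 2) := by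
        rw [Real.sqrt_mul (by positivity), Real.sqrt_eq_rpow (E ^ (p - 1)), ← Real.rpow_mul hE0]
        congr 2; ring
    _ ≤ _ := mul_le_mul_of_nonneg_left (rpow_half_le_one_add hE0 hp) (Real.sqrt_nonneg _)

end Pointwise

/-! ### Equivariance under the fundamental group -/

section Equivariance

variable {n m : ℕ} {H : Type*} [TopologicalSpace H]
  {I : ModelWithCorners ℝ (EuclideanSpace ℝ (Fin n)) H}
  {M : Type*} [TopologicalSpace M] [ChartedSpace H M] [IsManifold I ∞ M]
  {Γ : Subgroup (SOplus m)}

lemma sharp_toMat_mulVec (γ : Γ) (v : Mink m) :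
    sharp (toMat γ *ᵥ v) = sharp v ᵥ* toMat γ⁻¹ := by
  have h : eSharp m * toMat γ = (toMat γ⁻¹)ᵀ * eSharp m := by
    have h1 : (toMat γ⁻¹)ᵀ * (toMat γ)ᵀ = 1 := by
      rw [← Matrix.transpose_mul, toMat_mul_toMat_inv, Matrix.transpose_one]
    calc eSharp m * toMat γ = ((toMat γ⁻¹)ᵀ * (toMat γ)ᵀ) * (eSharp m * toMat γ) := by
          rw [h1, Matrix.one_mul]
      _ = (toMat γ⁻¹)ᵀ * ((toMat γ)ᵀ * eSharp m * toMat γ) := by simp only [Matrix.mul_assoc]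
      _ = _ := by rw [toMat_isometry]
  rw [sharp, Matrix.mulVec_mulVec, h, ← Matrix.mulVec_mulVec, Matrix.mulVec_transpose]
  rfl

lemma plusInner_toMat_mulVec (γ : Γ) (X v w : Mink m) :
    plusInner (toMat γ *ᵥ X) (toMat γ *ᵥ v) (toMat γ *ᵥ w) = plusInner X v w := by
  simp only [plusInner, mink_mulVec (toMat_isometry γ)]

variable (g : Metric I M) {x : M} {W W' A A' : TangentSpace I x →L[ℝ] Mink m} {γ : Γ}

lemma Qsq_toMat (hW : ∀ t, W' t = toMat γ *ᵥ W t) :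
    Qsq g x W' = toMat γ * Qsq g x W * toMat γ⁻¹ := by
  obtain ⟨e, hQ, -⟩ := exists_frame (m := m) g x
  rw [hQ, hQ, stress, stress, Matrix.mul_sum, Matrix.sum_mul]
  refine Finset.sum_congr rfl fun α _ => ?_
  rw [hW, sharp_toMat_mulVec, Matrix.mul_vecMulVec, Matrix.vecMulVec_mul]

lemma Scur_toMat (p : ℝ) (hW : ∀ t, W' t = toMat γ *ᵥ W t) (t : TangentSpace I x) :
    Scur g p x W' t = toMat γ *ᵥ Scur g p x W t := by
  rw [Scur_apply, Scur_apply, Qpow, Qpow, Qsq_toMat g hW, matFun_conj _ _ (toMat_mul_toMat_inv γ),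
    hW, Matrix.mulVec_mulVec, Matrix.mulVec_mulVec, Matrix.mul_assoc, toMat_inv_mul_toMat,
    Matrix.mul_one]

lemma pair_mink_toMat (hW : ∀ t, W' t = toMat γ *ᵥ W t) (hA : ∀ t, A' t = toMat γ *ᵥ A t) :
    pair g x mink W' A' = pair g x mink W A := by
  simp only [pair, hW, hA, mink_mulVec (toMat_isometry γ)]

lemma pair_plusInner_toMat (X : Mink m) (hW : ∀ t, W' t = toMat γ *ᵥ W t) :
    pair g x (plusInner (toMat γ *ᵥ X)) W' W' = pair g x (plusInner X) W W := by
  simp only [pair, hW, plusInner_toMat_mulVec]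

end Equivariance

/-! ### Continuity and measurability of the local expressions -/

section MatrixValued

variable {ι : Type*} [Fintype ι] [DecidableEq ι]

lemma continuousOn_matrix_inv {X : Type*} [TopologicalSpace X] {s : Set X} {A : X → Matrix ι ι ℝ}
    (hA : ContinuousOn A s) (h : ∀ x ∈ s, (A x).det ≠ 0) : ContinuousOn (fun x => (A x)⁻¹) s := by
  simp_rw [Matrix.inv_def, Ring.inverse_eq_inv']
  exact ((continuous_id.matrix_det.comp_continuousOn hA).inv₀ h).smul
    (continuous_id.matrix_adjugate.comp_continuousOn hA)

lemma aemeasurable_aeval {α : Type*} [MeasurableSpace α] {μ : Measure α} {T : α → Matrix ι ι ℝ}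
    (hT : ∀ i j, AEMeasurable (fun x => T x i j) μ) (q : Polynomial ℝ) (i j : ι) :
    AEMeasurable (fun x => Polynomial.aeval (T x) q i j) μ := by
  have hpow : ∀ (k : ℕ) i j, AEMeasurable (fun x => (T x ^ k) i j) μ := fun k => by
    induction k with
    | zero => intro i j; simp only [pow_zero]; exact aemeasurable_const
    | succ k ih =>
      intro i j
      simp only [pow_succ, Matrix.mul_apply]
      exact Finset.aemeasurable_fun_sum _ fun l _ => (ih i l).mul (hT l j)
  induction q using Polynomial.induction_on' with
  | add p q hp hq => simp only [map_add, Matrix.add_apply]; exact hp.add hq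
  | monomial k a =>
    simp only [Polynomial.aeval_monomial, ← Algebra.smul_def, Matrix.smul_apply, smul_eq_mul]
    exact (hpow k i j).const_mul a

end MatrixValued

section Continuity

variable {m : ℕ}

lemma continuous_plusInner :
    Continuous fun q : Mink m × Mink m × Mink m => plusInner q.1 q.2.1 q.2.2 := by
  simp_rw [plusInner, mink_eq]; fun_prop

lemma continuous_plusGram : Continuous fun X : Mink m => plusGram X := by
  have h : Continuous fun X : Mink m => sharp X := continuous_const.matrix_mulVec continuous_id
  exact continuous_const.add ((h.matrix_vecMulVec h).const_smul (2 : ℝ))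

lemma sharp_apply (X : Mink m) (a : Idx m) : sharp X a = minkSign a * X a := by
  cases a <;>
    simp [sharp, LieAlgebra.Orthogonal.indefiniteDiagonal, Matrix.mulVec_diagonal, minkSign]

end Continuity

section Local

variable {n m : ℕ} {H : Type*} [TopologicalSpace H]
  {I : ModelWithCorners ℝ (EuclideanSpace ℝ (Fin n)) H}
  {M : Type*} [TopologicalSpace M] [ChartedSpace H M]
  {Γ : Subgroup (SOplus m)} {u : M → HypMfd Γ} {φ : M → Hyp m → Matrix (Idx m) (Idx m) ℝ}
  {du : (x : M) → Hyp m → (TangentSpace I x →L[ℝ] Mink m)} {U : Set M} {v : M → Hyp m}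

/-- Continuity of the trace that bounds the square of the norm of `φ` as an endomorphism of `E`. -/
lemma continuousOn_trace_adjoint_mul (hφ : IsSmoothAdSection I u φ) (hv : IsLocalLift u U v) :
    ContinuousOn (fun x => ((plusGram (v x).1)⁻¹ * (φ x (v x))ᵀ * plusGram (v x).1 *
      φ x (v x)).trace) U := by
  have hvc : ContinuousOn (fun x => (v x).1) U :=
    continuous_subtype_val.comp_continuousOn hv.continuousOn
  have hP := continuous_plusGram.comp_continuousOn hvc
  have hPi := continuousOn_matrix_inv hP fun x _ => (plusGram_posDef (v x).2).det_pos.ne'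
  have hφc := hφ.continuousOn hv
  exact continuous_id.matrix_trace.comp_continuousOn
    (((hPi.mul (continuous_id.matrix_transpose.comp_continuousOn hφc)).mul hP).mul hφc)

variable [IsManifold I ∞ M] (g : Metric I M) {x₀ : M}

lemma pair_eq_sum_chartFrame {x : M} (hx : x ∈ (extChartAt I x₀).source) {F K : Type*}
    [AddCommGroup F] [Module ℝ F] [TopologicalSpace F] [AddCommGroup K] [Module ℝ K]
    (b : F →ₗ[ℝ] F →ₗ[ℝ] K) (A B : TangentSpace I x →L[ℝ] F) :
    pair g x (fun v w => b v w) A B = ∑ i, ∑ j, ((gramOf g x (chartFrame I x₀ x))⁻¹ i j) •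
      b (A (chartFrame I x₀ x (EuclideanSpace.single i 1)))
        (B (chartFrame I x₀ x (EuclideanSpace.single j 1))) :=
  pair_eq_sum_of_frame g x b A B (chartFrame_chartCoframe hx) (chartCoframe_chartFrame hx)

lemma continuousOn_gramOf_inv (hUs : U ⊆ (extChartAt I x₀).source) :
    ContinuousOn (fun x => (gramOf g x (chartFrame I x₀ x))⁻¹) U :=
  continuousOn_matrix_inv ((continuousOn_gramOf_chartFrame g x₀).mono hUs) fun _ hx =>
    (gramOf_chartFrame_posDef g (hUs hx)).det_pos.ne'

lemma continuousOn_flatD_chartFrame (hΓ : IsHyperbolicGroup Γ) (hφ : IsSmoothAdSection I u φ)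
    (hv : IsLocalLift u U v) (hUs : U ⊆ (extChartAt I x₀).source)
    (w : EuclideanSpace ℝ (Fin n)) :
    ContinuousOn (fun x => flatD I u φ x (v x) (chartFrame I x₀ x w)) U := by
  set T := (extChartAt I x₀).target ∩ (extChartAt I x₀).symm ⁻¹' U with hT
  -- `T` is relatively open in the range of `I`, so the derivatives within both sets agree on it
  obtain ⟨O, hO, hOT⟩ : ∃ O, IsOpen O ∧ T = Set.range I ∩ O := by
    obtain ⟨O, hO, hOU⟩ := (continuousOn_iff'.1 (continuousOn_extChartAt_symm (I := I) x₀)) U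
      hv.isOpen
    refine ⟨I.symm ⁻¹' (chartAt H x₀).target ∩ O,
      ((chartAt H x₀).open_target.preimage I.continuous_symm).inter hO, ?_⟩
    rw [hT, Set.inter_comm, hOU, extChartAt_target]
    ext y; simp only [Set.mem_inter_iff]; tauto
  have hTu : UniqueDiffOn ℝ T := hOT ▸ I.uniqueDiffOn.inter hO
  have hc := ((hφ.contDiffOn hv x₀).continuousOn_fderivWithin hTu (by simp)).clm_apply
    (continuousOn_const (c := w))
  have hψ : Set.MapsTo (extChartAt I x₀) U T := fun x hx =>
    ⟨(extChartAt I x₀).map_source (hUs hx), by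
      rwa [Set.mem_preimage, (extChartAt I x₀).left_inv (hUs hx)]⟩
  refine (hc.comp ((continuousOn_extChartAt x₀).mono hUs) hψ).congr fun x hx => ?_
  have hy := hψ hx
  have h1 := flatD_chartInvD hΓ hφ hv hy.1 hy.2 w
  rw [chartInvD_eq_chartFrame hy.1, (extChartAt I x₀).left_inv (hUs hx)] at h1
  have h2 : fderivWithin ℝ (alongLift φ v ∘ (extChartAt I x₀).symm) (Set.range I)
      (extChartAt I x₀ x) =
      fderivWithin ℝ (alongLift φ v ∘ (extChartAt I x₀).symm) T (extChartAt I x₀ x) := by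
    rw [hOT, fderivWithin_inter (hO.mem_nhds (hOT ▸ hy).2)]
  exact h1.trans (congrArg (fun L : EuclideanSpace ℝ (Fin n) →L[ℝ] (Idx m → Idx m → ℝ) =>
    Matrix.of (L w)) h2)

lemma continuousOn_pair_flatD (hΓ : IsHyperbolicGroup Γ) (hφ : IsSmoothAdSection I u φ)
    (hv : IsLocalLift u U v) (hUs : U ⊆ (extChartAt I x₀).source) :
    ContinuousOn (fun x => pair g x (plusInner (v x).1)
      ((mulVecAt (v x).1).comp (flatD I u φ x (v x)))
      ((mulVecAt (v x).1).comp (flatD I u φ x (v x)))) U := by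
  have hvc : ContinuousOn (fun x => (v x).1) U :=
    continuous_subtype_val.comp_continuousOn hv.continuousOn
  have hD : ∀ w, ContinuousOn
      (fun x => flatD I u φ x (v x) (chartFrame I x₀ x w) *ᵥ (v x).1) U := fun w =>
    (continuous_fst.matrix_mulVec continuous_snd).comp_continuousOn
      ((continuousOn_flatD_chartFrame hΓ hφ hv hUs w).prodMk hvc)
  have hs : ContinuousOn (fun x => ∑ i, ∑ j, ((gramOf g x (chartFrame I x₀ x))⁻¹ i j) •
      plusInner (v x).1
        (flatD I u φ x (v x) (chartFrame I x₀ x (EuclideanSpace.single i 1)) *ᵥ (v x).1)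
        (flatD I u φ x (v x) (chartFrame I x₀ x (EuclideanSpace.single j 1)) *ᵥ (v x).1)) U := by
    refine continuousOn_finsetSum _ fun i _ => continuousOn_finsetSum _ fun j _ => ?_
    have h1 := continuousOn_pi.1 (continuousOn_pi.1 (continuousOn_gramOf_inv g hUs) i) j
    have h2 := continuous_plusInner.comp_continuousOn (hvc.prodMk
      ((hD (EuclideanSpace.single i 1)).prodMk (hD (EuclideanSpace.single j 1))))
    exact h1.smul h2
  refine hs.congr fun x hx => ?_
  exact pair_eq_sum_chartFrame g (hUs hx) (plusB (v x).1) _ _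

variable [MeasurableSpace M] [BorelSpace M]

lemma ae_mink_eq_zero_lift (hv : IsLocalLift u U v) (hUs : U ⊆ (extChartAt I x₀).source)
    (hdu : HasWeakDifferentialOn U (fun x => (v x).1) fun x => du x (v x)) :
    ∀ᵐ x ∂((riemVolume g).restrict U), ∀ t, mink (du x (v x) t) (v x).1 = 0 := by
  have h : ∀ᵐ x ∂((riemVolume g).restrict U), ∀ i, mink (du x (v x)
      (chartFrame I x₀ x (EuclideanSpace.single i 1))) (v x).1 = 0 := by
    refine ae_riemVolume_of_ae_chart g x₀ hv.isOpen hUs ?_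
    filter_upwards [ae_all_iff.2 fun i =>
      ae_mink_eq_zero_chart hv hdu x₀ (EuclideanSpace.single i 1)] with y hy hyO i
    rw [← chartInvD_eq_chartFrame (mem_target_of_mem_chartInterior hyO)]
    exact hy i hyO
  filter_upwards [h, ae_restrict_mem hv.isOpen.measurableSet] with x hx hxU t
  have h0 : (minkB m).flip (v x).1 ∘ₗ (du x (v x)).toLinearMap ∘ₗ
      (chartFrame I x₀ x).toLinearMap = 0 :=
    (EuclideanSpace.basisFun (Fin n) ℝ).toBasis.ext fun i => by
      simpa [minkB_apply] using hx i
  have := LinearMap.congr_fun h0 (chartCoframe I x₀ x t)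
  simpa [minkB_apply, chartFrame_chartCoframe (hUs hxU)] using this

lemma aemeasurable_weakDifferential (hU : IsOpen U) (hUs : U ⊆ (extChartAt I x₀).source)
    {f : M → Mink m} {η : (x : M) → (TangentSpace I x →L[ℝ] Mink m)}
    (hη : HasWeakDifferentialOn U f η) (w : EuclideanSpace ℝ (Fin n)) (a : Idx m) :
    AEMeasurable (fun x => η x (chartFrame I x₀ x w) a) ((riemVolume g).restrict U) := by
  refine (aestronglyMeasurable_of_chart g x₀ hU hUs ?_).aemeasurable
  refine (hasWeakDifferentialOn_iff.1 hη x₀ w a).locInt_deriv.aestronglyMeasurable.congr ?_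
  filter_upwards [ae_restrict_mem (isOpen_chartInterior x₀ U).measurableSet] with y hy
  rw [chartInvD_eq_chartFrame (mem_target_of_mem_chartInterior hy)]

/-- `Q(du)^r` is measurable: where `du` is tangent, `Q(du)²` is diagonalizable with nonnegative
eigenvalues, so that powers of it are limits of polynomials in `Q(du)²`. -/
lemma aemeasurable_Qpow (r : ℝ) (hv : IsLocalLift u U v) (hUs : U ⊆ (extChartAt I x₀).source)
    (hdu : HasWeakDifferentialOn U (fun x => (v x).1) fun x => du x (v x)) (a b : Idx m) :
    AEMeasurable (fun x => Qpow g x r (du x (v x)) a b) ((riemVolume g).restrict U) := by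
  have hw := aemeasurable_weakDifferential g hv.isOpen hUs hdu
  have hmem := ae_restrict_mem (μ := riemVolume g) hv.isOpen.measurableSet
  have hQ : ∀ a b, AEMeasurable (fun x => Qsq g x (du x (v x)) a b)
      ((riemVolume g).restrict U) := fun a b => by
    refine AEMeasurable.congr (f := fun x => ∑ i, ∑ j, (gramOf g x (chartFrame I x₀ x))⁻¹ i j *
      (du x (v x) (chartFrame I x₀ x (EuclideanSpace.single i 1)) a *
        (minkSign b * du x (v x) (chartFrame I x₀ x (EuclideanSpace.single j 1)) b))) ?_ ?_
    · refine Finset.aemeasurable_fun_sum _ fun i _ => Finset.aemeasurable_fun_sum _ fun j _ => ?_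
      have hG := continuousOn_pi.1 (continuousOn_pi.1 (continuousOn_gramOf_inv g hUs) i) j
      exact (hG.aemeasurable hv.isOpen.measurableSet).mul ((hw _ a).mul ((hw _ b).const_mul _))
    · filter_upwards [hmem] with x hx
      have h := pair_eq_sum_chartFrame g (hUs hx) (vecMulSharpB m) (du x (v x)) (du x (v x))
      change _ = (pair g x (fun v w => vecMulSharpB m v w) (du x (v x)) (du x (v x))) a b
      rw [h, Matrix.sum_apply]
      refine Finset.sum_congr rfl fun i _ => ?_
      rw [Matrix.sum_apply]
      refine Finset.sum_congr rfl fun j _ => ?_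
      rw [← sharp_apply]
      rfl
  obtain ⟨q, hq⟩ := exists_polynomial_tendsto_rpow (r / 2)
  refine aemeasurable_of_tendsto_metrizable_ae Filter.atTop
    (fun k => aemeasurable_aeval hQ (q k) a b) ?_
  filter_upwards [ae_mink_eq_zero_lift g hv hUs hdu] with x hx
  obtain ⟨e, he, -⟩ := exists_frame (m := m) g x
  obtain ⟨V, d, hV, hd, hdw⟩ := exists_eigenbasis_stress (fun α => du x (v x) (e α)) (v x).2
    fun α => hx _
  rw [← he] at hd
  have hV' : V * (Vᵀ * plusGram (v x).1) = 1 := mul_eq_one_comm.1 hV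
  have h := tendsto_aeval_matFun (f := fun t => t ^ (r / 2)) hd hV' fun i => hq (d i) (by
    rw [hdw]; exact Finset.sum_nonneg fun α _ => sq_nonneg _)
  exact tendsto_pi_nhds.1 (tendsto_pi_nhds.1 h a) b

lemma aemeasurable_pair_Scur (p : ℝ) (hΓ : IsHyperbolicGroup Γ) (hφ : IsSmoothAdSection I u φ)
    (hv : IsLocalLift u U v) (hUs : U ⊆ (extChartAt I x₀).source)
    (hdu : HasWeakDifferentialOn U (fun x => (v x).1) fun x => du x (v x)) :
    AEMeasurable (fun x => pair g x mink (Scur g p x (du x (v x)))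
      ((mulVecAt (v x).1).comp (flatD I u φ x (v x)))) ((riemVolume g).restrict U) := by
  have hUm := hv.isOpen.measurableSet
  have hvc : ContinuousOn (fun x => (v x).1) U :=
    continuous_subtype_val.comp_continuousOn hv.continuousOn
  refine AEMeasurable.congr (f := fun x => ∑ i, ∑ j, (gramOf g x (chartFrame I x₀ x))⁻¹ i j *
    ∑ a, minkSign a * ((∑ b, Qpow g x (p - 2) (du x (v x)) a b *
        du x (v x) (chartFrame I x₀ x (EuclideanSpace.single i 1)) b) *
      (flatD I u φ x (v x) (chartFrame I x₀ x (EuclideanSpace.single j 1)) *ᵥ (v x).1) a)) ?_ ?_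
  · refine Finset.aemeasurable_fun_sum _ fun i _ => Finset.aemeasurable_fun_sum _ fun j _ => ?_
    refine ((continuousOn_pi.1 (continuousOn_pi.1 (continuousOn_gramOf_inv g hUs) i) j).aemeasurable
      hUm).mul (Finset.aemeasurable_fun_sum _ fun a _ => AEMeasurable.const_mul (AEMeasurable.mul
        (Finset.aemeasurable_fun_sum _ fun b _ => (aemeasurable_Qpow g _ hv hUs hdu a b).mul
          (aemeasurable_weakDifferential g hv.isOpen hUs hdu _ b)) ?_) _)
    exact (continuousOn_pi.1 ((continuous_fst.matrix_mulVec continuous_snd).comp_continuousOn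
      ((continuousOn_flatD_chartFrame hΓ hφ hv hUs _).prodMk hvc)) a).aemeasurable hUm
  · filter_upwards [ae_restrict_mem hUm] with x hx
    refine Eq.trans ?_ (pair_eq_sum_chartFrame g (hUs hx) (minkB m) _ _).symm
    refine Finset.sum_congr rfl fun i _ => Finset.sum_congr rfl fun j _ => ?_
    rw [minkB_apply, mink_eq_sum_minkSign]
    rfl

end Local

/-! ### The variations generated by infinitesimal isometries -/

section Noether

variable {n m : ℕ} {H : Type*} [TopologicalSpace H]
  {I : ModelWithCorners ℝ (EuclideanSpace ℝ (Fin n)) H}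
  {M : Type*} [TopologicalSpace M] [ChartedSpace H M]
  {Γ : Subgroup (SOplus m)} {u : M → HypMfd Γ} {φ : M → Hyp m → Matrix (Idx m) (Idx m) ℝ}
  {du : (x : M) → Hyp m → (TangentSpace I x →L[ℝ] Mink m)} {p : ℝ}

variable (I) in
/-- The section `(dφ) u` of `T^*M ⊗ E`. -/
def adTerm (u : M → HypMfd Γ) (φ : M → Hyp m → Matrix (Idx m) (Idx m) ℝ) (x : M) (X : Hyp m) :
    TangentSpace I x →L[ℝ] Mink m :=
  (mulVecAt X.1).comp (flatD I u φ x X)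

/-- The weak differential `(dφ) u + φ du` of the section `φ u` of `E`. -/
def adVariationD (u : M → HypMfd Γ) (φ : M → Hyp m → Matrix (Idx m) (Idx m) ℝ)
    (du : (x : M) → Hyp m → (TangentSpace I x →L[ℝ] Mink m)) (x : M) (X : Hyp m) :
    TangentSpace I x →L[ℝ] Mink m :=
  adTerm I u φ x X + (mulVecL (φ x X)).comp (du x X)

lemma adTerm_smul (hΓ : IsHyperbolicGroup Γ) (hu : Continuous u) (hφ : IsSmoothAdSection I u φ) :
    IsFormSection u (adTerm I u φ) := by
  intro x X hX γ t
  obtain ⟨U, v, hxU, hv, rfl⟩ := exists_localLift hΓ hu hX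
  change flatD I u φ x (γ • v x) t *ᵥ (γ • v x).1 = toMat γ *ᵥ (flatD I u φ x (v x) t *ᵥ (v x).1)
  rw [flatD_smul hΓ hφ hv hxU, coe_smul, Matrix.mulVec_mulVec, Matrix.mulVec_mulVec,
    Matrix.mul_assoc, toMat_inv_mul_toMat, Matrix.mul_one]

lemma mulVec_smul_of_equivariant (hφ : IsSmoothAdSection I u φ) {x : M} {X : Hyp m}
    (hX : proj Γ X = u x) (γ : Γ) (w : Mink m) :
    φ x (γ • X) *ᵥ (toMat γ *ᵥ w) = toMat γ *ᵥ (φ x X *ᵥ w) := by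
  rw [hφ.equivariant x X hX, Matrix.mulVec_mulVec, Matrix.mulVec_mulVec, Matrix.mul_assoc,
    toMat_inv_mul_toMat, Matrix.mul_one]

lemma isTangent_adVariation (hφ : IsSmoothAdSection I u φ) :
    IsTangent u (fun x X => φ x X *ᵥ X.1) := fun x X hX => by
  rw [tanProj, mink_mulVec_self_of_skew (hφ.mem_so x X hX), zero_smul, add_zero]

variable [IsManifold I ∞ M]

/-- The energy density is bounded by that of `du`, wherever `φ` and `dφ` are bounded. -/
lemma pair_adVariationD_rpow_le (g : Metric I M) (hp : 1 < p) {x : M} {X : Hyp m} {C : ℝ}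
    (hC : 0 ≤ C) (h1 : pair g x (plusInner X.1) (adTerm I u φ x X) (adTerm I u φ x X) ≤ C)
    (h2 : ((plusGram X.1)⁻¹ * (φ x X)ᵀ * plusGram X.1 * φ x X).trace ≤ C) :
    pair g x (plusInner X.1) (adVariationD u φ du x X) (adVariationD u φ du x X) ^ (p / 2) ≤
      (4 * C) ^ (p / 2) * (1 + pair g x (plusInner X.1) (du x X) (du x X) ^ (p / 2)) := by
  set E := pair g x (plusInner X.1) (du x X) (du x X)
  have hE : 0 ≤ E := pair_plusInner_self_nonneg g x X.2 _
  have hp2 : 0 ≤ p / 2 := by linarith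
  have h3 : pair g x (plusInner X.1) (adVariationD u φ du x X) (adVariationD u φ du x X) ≤
      4 * C * max 1 E := by
    refine (pair_plusInner_add_le g x X.2 _ _).trans ?_
    have h4 := (pair_plusInner_mulVecL_le g x X.2 (φ x X) (du x X)).trans
      (mul_le_mul_of_nonneg_right h2 hE)
    have h5 : C * E ≤ C * max 1 E := mul_le_mul_of_nonneg_left (le_max_right _ _) hC
    have h6 : C * 1 ≤ C * max 1 E := mul_le_mul_of_nonneg_left (le_max_left _ _) hC
    linarith
  refine (Real.rpow_le_rpow (pair_plusInner_self_nonneg g x X.2 _) h3 hp2).trans ?_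
  rw [Real.mul_rpow (by positivity) (by positivity)]
  refine mul_le_mul_of_nonneg_left ?_ (by positivity)
  have h7 := Real.rpow_nonneg hE (p / 2)
  rcases max_choice 1 E with h | h
  · rw [h, Real.one_rpow]; linarith
  · rw [h]; linarith

/-- Small open sets over which `u` lifts, contained in a chart, with `φ` and `dφ` bounded. -/
lemma exists_good_nhd (g : Metric I M) (hΓ : IsHyperbolicGroup Γ) (hu : Continuous u)
    (hφ : IsSmoothAdSection I u φ) (x₀ : M) :
    ∃ (U : Set M) (v : M → Hyp m) (C : ℝ), x₀ ∈ U ∧ U ⊆ (extChartAt I x₀).source ∧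
      IsLocalLift u U v ∧ 0 ≤ C ∧ ∀ x ∈ U,
        pair g x (plusInner (v x).1) (adTerm I u φ x (v x)) (adTerm I u φ x (v x)) ≤ C ∧
        ((plusGram (v x).1)⁻¹ * (φ x (v x))ᵀ * plusGram (v x).1 * φ x (v x)).trace ≤ C := by
  obtain ⟨U, v, hxU, hv, -⟩ := exists_localLift hΓ hu (proj_base u x₀)
  set U₁ := U ∩ (extChartAt I x₀).source
  have hU₁ : IsOpen U₁ := hv.isOpen.inter (isOpen_extChartAt_source x₀)
  have hx₁ : x₀ ∈ U₁ := ⟨hxU, mem_extChartAt_source x₀⟩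
  have hv₁ := hv.mono hU₁ Set.inter_subset_left
  have c1 := (continuousOn_pair_flatD g hΓ hφ hv₁ Set.inter_subset_right).continuousAt
    (hU₁.mem_nhds hx₁)
  have c2 := (continuousOn_trace_adjoint_mul hφ hv₁).continuousAt (hU₁.mem_nhds hx₁)
  obtain ⟨C₁, hC₁⟩ := exists_gt (pair g x₀ (plusInner (v x₀).1)
    (adTerm I u φ x₀ (v x₀)) (adTerm I u φ x₀ (v x₀)))
  obtain ⟨C₂, hC₂⟩ := exists_gt ((plusGram (v x₀).1)⁻¹ * (φ x₀ (v x₀))ᵀ * plusGram (v x₀).1 *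
    φ x₀ (v x₀)).trace
  obtain ⟨V, hV, hVo, hxV⟩ := mem_nhds_iff.1 (Filter.inter_mem (hU₁.mem_nhds hx₁)
    (Filter.inter_mem (c1.preimage_mem_nhds (Iio_mem_nhds hC₁))
      (c2.preimage_mem_nhds (Iio_mem_nhds hC₂))))
  refine ⟨V, v, max 0 (max C₁ C₂), hxV, fun x hx => (hV hx).1.2,
    hv₁.mono hVo fun x hx => (hV hx).1, le_max_left _ _, fun x hx => ⟨?_, ?_⟩⟩
  · exact (le_of_lt (hV hx).2.1).trans ((le_max_left _ _).trans (le_max_right _ _))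
  · exact (le_of_lt (hV hx).2.2).trans ((le_max_right _ _).trans (le_max_right _ _))

variable {g : Metric I M}

lemma pair_plusInner_base {η : (x : M) → Hyp m → (TangentSpace I x →L[ℝ] Mink m)}
    (hη : IsFormSection u η) {U : Set M} {v : M → Hyp m} (hv : IsLocalLift u U v) {x : M}
    (hx : x ∈ U) :
    pair g x (plusInner (base u x).1) (η x (base u x)) (η x (base u x)) =
      pair g x (plusInner (v x).1) (η x (v x)) (η x (v x)) := by
  obtain ⟨γ, hγ⟩ := hv.exists_smul_eq_base hx
  rw [← hγ, coe_smul]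
  exact pair_plusInner_toMat g _ (hη x (v x) (hv.lifts x hx) γ)

lemma currentDensity_eq (hΓ : IsHyperbolicGroup Γ) (hu : Continuous u)
    (hφ : IsSmoothAdSection I u φ) (x : M) :
    currentDensity g u (noetherCurrent g p du) φ x =
      2 * pair g x mink (Scur g p x (du x (base u x))) (adTerm I u φ x (base u x)) := by
  obtain ⟨U, v, hxU, hv, hvx⟩ := exists_localLift hΓ hu (proj_base u x)
  exact pair_noetherCurrent g (fun t => hvx ▸ flatD_mem_so hΓ hφ hv hxU t) _

variable [MeasurableSpace M] [BorelSpace M] [CompactSpace M]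

lemma setLIntegral_const_mul_one_add_lt_top {F : M → ENNReal} (C : ℝ) (U : Set M)
    (hF : ∫⁻ x, F x ∂(riemVolume g) < ⊤) :
    ∫⁻ x in U, ENNReal.ofReal C * (1 + F x) ∂(riemVolume g) < ⊤ := by
  rw [lintegral_const_mul' _ _ ENNReal.ofReal_ne_top, lintegral_add_left measurable_const]
  refine ENNReal.mul_lt_top ENNReal.ofReal_lt_top (ENNReal.add_lt_top.2 ⟨?_, ?_⟩)
  · rw [lintegral_one]; exact measure_lt_top _ _
  · exact (setLIntegral_le_lintegral _ _).trans_lt hF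

/-- The section `φ u` is continuous and of class `W^{1,p}`. -/
lemma memSobolev_adVariation (hΓ : IsHyperbolicGroup Γ) (hp : 1 < p) (hu : IsSobolevMap g p u du)
    (hφ : IsSmoothAdSection I u φ) :
    MemSobolev g p u (fun x X => φ x X *ᵥ X.1) (adVariationD u φ du) := by
  have hform : IsFormSection u (adVariationD u φ du) := fun x X hX γ t => by
    change adTerm I u φ x (γ • X) t + φ x (γ • X) *ᵥ du x (γ • X) t =
      toMat γ *ᵥ (adTerm I u φ x X t + φ x X *ᵥ du x X t)
    rw [adTerm_smul hΓ hu.1 hφ x X hX, hu.2.isFormSection x X hX,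
      mulVec_smul_of_equivariant hφ hX, Matrix.mulVec_add]
  refine ⟨fun x X hX γ => mulVec_smul_of_equivariant hφ hX γ X.1, hform, fun U v hv => ?_,
    fun U v hv => hasWeakDifferentialOn_mulVec hΓ hφ hv (hu.2.weakDifferential U v hv)
      fun x X t => rfl, ?_⟩
  · exact (continuous_fst.matrix_mulVec continuous_snd).comp_continuousOn
      ((hφ.continuousOn hv).prodMk (continuous_subtype_val.comp_continuousOn hv.continuousOn))
  · refine lintegral_lt_top_of_nhds fun x₀ => ?_
    obtain ⟨U, v, C, hx₀, -, hv, hC, hb⟩ := exists_good_nhd g hΓ hu.1 hφ x₀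
    refine ⟨U, hv.isOpen, hx₀, lt_of_le_of_lt ?_
      (setLIntegral_const_mul_one_add_lt_top ((4 * C) ^ (p / 2)) U hu.2.finiteEnergy)⟩
    refine setLIntegral_mono' hv.isOpen.measurableSet fun x hx => ?_
    rw [pair_plusInner_base hform hv hx, pair_plusInner_base hu.2.isFormSection hv hx,
      ← ENNReal.ofReal_one, ← ENNReal.ofReal_add zero_le_one
        (Real.rpow_nonneg (pair_plusInner_self_nonneg g x (v x).2 _) _),
      ← ENNReal.ofReal_mul (by positivity)]
    exact ENNReal.ofReal_le_ofReal (pair_adVariationD_rpow_le g hp hC (hb x hx).1 (hb x hx).2)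

/-- The weak differential of `u` has values in the tangent spaces of hyperbolic space. -/
lemma ae_mink_eq_zero (hΓ : IsHyperbolicGroup Γ) (hu : IsSobolevMap g p u du) :
    ∀ᵐ x ∂(riemVolume g), ∀ t, mink (du x (base u x) t) (base u x).1 = 0 := by
  refine ae_of_ae_restrict_nhds fun x₀ => ?_
  obtain ⟨U, v, hxU, hv, -⟩ := exists_localLift hΓ hu.1 (proj_base u x₀)
  have hU := hv.isOpen.inter (isOpen_extChartAt_source (I := I) x₀)
  have hv' := hv.mono hU Set.inter_subset_left
  refine ⟨_, hU, ⟨hxU, mem_extChartAt_source x₀⟩, ?_⟩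
  filter_upwards [ae_mink_eq_zero_lift g hv' Set.inter_subset_right
    (hu.2.weakDifferential _ _ hv'), ae_restrict_mem hU.measurableSet] with x hx hxU t
  obtain ⟨γ, hγ⟩ := hv'.exists_smul_eq_base hxU
  rw [← hγ, coe_smul, hu.2.isFormSection x (v x) (hv'.lifts x hxU), mink_mulVec (toMat_isometry γ)]
  exact hx t

/-- The Noether current paired with `dφ` is twice the first variation in the direction of `φ u`. -/
lemma currentDensity_ae_eq (hΓ : IsHyperbolicGroup Γ) (hu : IsSobolevMap g p u du)
    (hφ : IsSmoothAdSection I u φ) :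
    currentDensity g u (noetherCurrent g p du) φ =ᵐ[riemVolume g]
      fun x => 2 * variationDensity g p u du (adVariationD u φ du) x := by
  filter_upwards [ae_mink_eq_zero hΓ hu] with x hx
  rw [currentDensity_eq hΓ hu.1 hφ, variationDensity, adVariationD,
    pair_Scur_tanProj g hx p (hφ.mem_so x _ (proj_base u x))]

lemma integrable_currentDensity (hΓ : IsHyperbolicGroup Γ) (hp : 1 < p)
    (hu : IsSobolevMap g p u du) (hφ : IsSmoothAdSection I u φ) :
    Integrable (currentDensity g u (noetherCurrent g p du) φ) (riemVolume g) := by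
  rw [← integrableOn_univ]
  refine LocallyIntegrable.integrableOn_isCompact (fun x₀ => ?_) isCompact_univ
  obtain ⟨U, v, C, hx₀, hUs, hv, hC, hb⟩ := exists_good_nhd g hΓ hu.1 hφ x₀
  have hUm := hv.isOpen.measurableSet
  refine ⟨U, hv.isOpen.mem_nhds hx₀, ?_, ?_⟩
  · refine AEMeasurable.aestronglyMeasurable (((aemeasurable_pair_Scur g p hΓ hφ hv hUs
      (hu.2.weakDifferential U v hv)).const_mul 2).congr ?_)
    filter_upwards [ae_restrict_mem hUm] with x hx
    rw [currentDensity_eq hΓ hu.1 hφ]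
    obtain ⟨γ, hγ⟩ := hv.exists_smul_eq_base hx
    rw [← hγ]
    congr 1
    exact (pair_mink_toMat g (Scur_toMat g p (hu.2.isFormSection x (v x) (hv.lifts x hx) γ))
      (adTerm_smul hΓ hu.1 hφ x (v x) (hv.lifts x hx) γ)).symm
  · set K := Real.sqrt (Fintype.card (Idx m) * C)
    refine lt_of_le_of_lt (lintegral_mono_ae ?_)
      (setLIntegral_const_mul_one_add_lt_top (2 * K) U hu.2.finiteEnergy)
    filter_upwards [ae_restrict_mem hUm, ae_restrict_of_ae (ae_mink_eq_zero hΓ hu)] with x hx ht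
    have hE := Real.rpow_nonneg
      (pair_plusInner_self_nonneg g x (base u x).2 (du x (base u x))) (p / 2)
    have h1 := (pair_plusInner_base (g := g) (adTerm_smul hΓ hu.1 hφ) hv hx).trans_le (hb x hx).1
    have h2 := abs_pair_Scur_le g (base u x).2 ht hp h1
    rw [← ENNReal.ofReal_one, ← ENNReal.ofReal_add zero_le_one hE,
      ← ENNReal.ofReal_mul (by positivity), Real.enorm_eq_ofReal_abs, currentDensity_eq hΓ hu.1 hφ,
      abs_mul, abs_two]
    refine ENNReal.ofReal_le_ofReal ?_
    rw [mul_assoc]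
    exact mul_le_mul_of_nonneg_left h2 zero_le_two

lemma integral_currentDensity_eq_zero (hΓ : IsHyperbolicGroup Γ) (hu : IsSobolevMap g p u du)
    (hφ : IsSmoothAdSection I u φ)
    (h : ∫ x, variationDensity g p u du (adVariationD u φ du) x ∂(riemVolume g) = 0) :
    ∫ x, currentDensity g u (noetherCurrent g p du) φ x ∂(riemVolume g) = 0 := by
  rw [integral_congr_ae (currentDensity_ae_eq hΓ hu hφ), integral_const_mul, h, mul_zero]

end Noether

end HypNoether

end

theorem mainTheorem7 {n m : ℕ} {H : Type*} [TopologicalSpace H]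
    (I : ModelWithCorners ℝ (EuclideanSpace ℝ (Fin n)) H)
    {M : Type*} [TopologicalSpace M] [ChartedSpace H M] [IsManifold I ∞ M]
    [CompactSpace M] [T2Space M] [MeasurableSpace M] [BorelSpace M]
    (g : HypNoether.Metric I M)
    (Γ : Subgroup (HypNoether.SOplus m)) (hΓ : HypNoether.IsHyperbolicGroup Γ)
    (p : ℝ) (hp : 1 < p)
    (u : M → HypNoether.HypMfd Γ)
    (du : (x : M) → HypNoether.Hyp m → (TangentSpace I x →L[ℝ] HypNoether.Mink m))
    (hu : HypNoether.IsSobolevMap g p u du) :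
    (HypNoether.EulerLagrange g p u du →
      HypNoether.OrthogonalToExact g u (HypNoether.noetherCurrent g p du)) ∧
    (HypNoether.InteriorEulerLagrange g p u du →
      HypNoether.IsDistribCoclosed g u (HypNoether.noetherCurrent g p du)) := by
  refine ⟨fun hEL φ hφ => ⟨HypNoether.integrable_currentDensity hΓ hp hu hφ,
    HypNoether.integral_currentDensity_eq_zero hΓ hu hφ (hEL _ _
      (HypNoether.memSobolev_adVariation hΓ hp hu hφ) (HypNoether.isTangent_adVariation hφ))⟩,
    fun hEL φ hφ ⟨O, hO, hbO, h0⟩ => ⟨HypNoether.integrable_currentDensity hΓ hp hu hφ,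
      HypNoether.integral_currentDensity_eq_zero hΓ hu hφ (hEL _ _
        (HypNoether.memSobolev_adVariation hΓ hp hu hφ) (HypNoether.isTangent_adVariation hφ)
        ⟨O, hO, hbO, fun x hx X hX => by
          simp only [h0 x hx X hX, Matrix.zero_mulVec]⟩)⟩⟩
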